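/- **Setting.** Let $\mathbb F=\mathbb Z/2\mathbb Z$. A toroidal grid diagram $\mathbb G$ of grid number $n$ is an $n\times n$ grid on a torus, with horizontal circles $\alpha_1,\dots,\alpha_n$ and vertical circles $\beta_1,\dots,\beta_n$, in which each row and each column contains exactly one $O$-marking and exactly one $X$-marking, no square being marked twice. Let $O_1,\dots,O_n$ be the $O$-markings. A grid state is a set of $n$ intersection points, one on each $\alpha_k$ and one on each $\beta_k$. $GC^\bullet(\mathbb G)$ is the free $\mathbb F[V_1,\dots,V_n,v]$-module on the grid states, with $$\partial^\bullet(\mathbf x)=\sum_{\mathbf y}\ \sum_{r} V_1^{O_1(r)}\cdots V_n^{O_n(r)}\,v^{m(r)}\,\mathbf y ,$$ where $r$ runs over the embedded rectangles from $\mathbf x$ to $\mathbf y$ (south-west and north-east corners in $\mathbf x$, the other two corners in $\mathbf y$, and $\mathbf x,\mathbf y$ otherwise equal) that contain no $X$-marking, $O_i(r)$ is the number of times $r$ contains $O_i$, and $m(r)=\#(\mathrm{Int}(r)\cap\mathbf x)$. In a fundamental domain, let $J(P,Q)$ be half the number of pairs of a point of $P$ and a point of $Q$ one of which is strictly south-west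 of the other (for $P=Q$: the number of pairs $(p,q)$ with $p$ strictly south-west of $q$), and $M_{\mathbb M}(\mathbf x)=J(\mathbf x,\mathbf x)-2J(\mathbf x,\mathbb M)+J(\mathbb M,\mathbb M)+1$. The bigrading is $M=M_{\mathbb O}$ (Maslov) and $A=\frac12(M_{\mathbb O}-M_{\mathbb X}-(n-1))$ (Alexander) on states; each $V_i$ has bidegree $(-2,-1)$ and $v$ has bidegree $(2,0)$. $GH^\bullet(\mathbb G)$ is the homology of $(GC^\bullet(\mathbb G),\partial^\bullet)$, a bigraded $\mathbb F[U,v]$-module where $U$ acts as multiplication by a chosen $V_i$; the theorem holds for every choice of $i$. Two diagrams differ by a *column commutation* if one arises from the other by interchanging two (cyclically) consecutive columns such that the closed intervals joining the heights of the two markings of each column are disjoint or one lies in the interior of the other. They differ by a *column switch* if they arise by interchanging two consecutive columns such that the $X$-marking of one and the $O$-marking of the other lie in the same row. Row commutations and row switches are defined by reflecting in the diagonal. The $O$-markings of the two diagrams are labelled compatibly with the interchange. Let $\mathbb G'$ arise from $\mathbb G$ by such a column move. Draw both on one torus so that they share the markings and all circles, except that the circle $\beta$ between the two columns, for $\mathbb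 G$, is replaced by a curve $\gamma$ for $\mathbb G'$, which meets $\beta$ in two points $a,b$ inside two different rows. Here $a$ is the south end of the bigon with $\beta$ to the west and $\gamma$ to the east, and this bigon contains the two markings of the column of $\mathbb G$ east of $\beta$; the other bigon contains those of the column of $\mathbb G$ west of $\beta$. Let $T_4$ be the $4$-fold cover of the torus which is $2$-fold in each direction; states, circles and markings lift to $T_4$ by taking preimages, and $\mathbb G_4$, $\mathbb G_4'$ are the lifts of $\mathbb G$, $\mathbb G'$. Polygons in $T_4$ are embedded, have convex corners (each contains one of the four quadrants at the corner) and sides on the lifted circles, and are counted up to deck transformations; $O_i[\cdot]$ counts the preimages of $O_i$ in the polygon. $GC^\bullet(\mathbb G_4)$ is the same bigraded module, with the differential $\partial_4^\bullet$ that counts rectangles in $T_4$ without $X$-markings, with coefficient $\prod_i V_i^{O_i[r]}\,v^{m[r]}$. Here $m[r]=\frac12(p_{\mathbf x}[r]+p_{\mathbf y}[r]-1)$, and $p_{\mathbf x}[r]$ is the sum, over the points of the lift of $\mathbf x$, of the average multiplicity of $r$ in the four squares around the point. A *pentagon* from a state $\mathbf x$ of $\mathbb G$ to a state $\mathbf y'$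 of $\mathbb G'$ has four corners in the lifts of $\mathbf x$ and $\mathbf y'$ (south-west and north-east corners in $\mathbf x$, the others in $\mathbf y'$) and a fifth corner over $a$; in the other direction the fifth corner lies over $b$. A *hexagon* between two states of the same diagram has, besides four such corners, one corner over $a$ and one over $b$. Their multiplicity $m$ is that of the rectangle that agrees with them outside the bigons. Let $P^\bullet:GC^\bullet(\mathbb G_4)\to GC^\bullet(\mathbb G'_4)$ and $(P^\bullet)'$ in the other direction count pentagons without $X$-markings, and let $H^\bullet$ and $(H^\bullet)'$, endomorphisms of $GC^\bullet(\mathbb G_4)$ and $GC^\bullet(\mathbb G_4')$, count hexagons without $X$-markings, all with coefficient $\prod_i V_i^{O_i[\cdot]}v^{m[\cdot]}$. **Theorem.** If $\mathbb G$ and $\mathbb G'$ differ by a commutation or a switch (of columns or of rows), then there is an isomorphism $GH^\bullet(\mathbb G)\cong GH^\bullet(\mathbb G')$ of bigraded $\mathbb F[U,v]$-modules. More precisely, for columns, a drawing as above exists, and for every such drawing: 1. $P^\bullet$ and $(P^\bullet)'$ are bigraded chain maps (with respect to $\partial_4^\bullet$). 2. $H^\bullet$ and $(H^\bullet)'$ are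 homogeneous of degree $(1,0)$, and $$\partial_4^\bullet H^\bullet+H^\bullet\partial_4^\bullet+(P^\bullet)'P^\bullet=\mathrm{Id},\qquad \partial_4^\bullet (H^\bullet)'+(H^\bullet)'\partial_4^\bullet+P^\bullet(P^\bullet)'=\mathrm{Id},$$ so that $P^\bullet$ and $(P^\bullet)'$ are homotopy inverses of each other. 3. Under the identification $\mathbf x\leftrightarrow\mathbf x_4$ of states with their lifts, $P^\bullet$ induces an isomorphism $GH^\bullet(\mathbb G)\to GH^\bullet(\mathbb G')$ of bigraded $\mathbb F[U,v]$-modules. For rows, the same statements hold for the maps obtained by reflecting in the diagonal. -/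

import Mathlib

open Finset

noncomputable section

/-- A toroidal grid diagram of grid number `n`. Columns and rows are indexed by `ZMod n`, increasing
eastward and northward; column `k` lies between the vertical circles `β k` and `β (k + 1)`, row `l`
between the horizontal circles `α l` and `α (l + 1)`. The marking `O_i` lies in column `oCol i` and row
`oRow i`; the `X`-marking of column `k` lies in row `x k`. The representatives `0, …, n - 1` single out
a fundamental domain. -/
structure GridDiagram (n : ℕ) where
  oCol : Fin n ≃ ZMod n
  oRow : Fin n ≃ ZMod n
  x : Equiv.Perm (ZMod n)
  no_square_doubly_marked : ∀ i, x (oCol i) ≠ oRow i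

namespace GridDiagram

variable {n : ℕ}

/-- The row of the `O`-marking of a given column. -/
def o (G : GridDiagram n) : Equiv.Perm (ZMod n) := G.oCol.symm.trans G.oRow

/-- Reflection in the diagonal: rows and columns are exchanged. -/
def transpose (G : GridDiagram n) : GridDiagram n where
  oCol := G.oRow
  oRow := G.oCol
  x := G.x.symm
  no_square_doubly_marked := fun i h =>
    G.no_square_doubly_marked i ((G.x.symm_apply_eq.1 h).symm)

/-! ### Moves -/

/-- `G'` is obtained from `G` by interchanging the consecutive columns `c - 1` and `c`. -/
def ColumnInterchange (G G' : GridDiagram n) (c : ZMod n) : Prop :=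
  (∀ i, G'.oCol i = Equiv.swap (c - 1) c (G.oCol i)) ∧ (∀ i, G'.oRow i = G.oRow i) ∧
    ∀ k, G'.x k = G.x (Equiv.swap (c - 1) c k)

/-- The closed interval of heights between the two markings of column `k`. -/
def columnInterval (G : GridDiagram n) (k : ZMod n) : Set ℕ := Set.uIcc (G.x k).val (G.o k).val

/-- The interior of the interval of heights between the two markings of column `k`. -/
def columnInterior (G : GridDiagram n) (k : ZMod n) : Set ℕ := Set.uIoo (G.x k).val (G.o k).val

/-- Column commutation of columns `c - 1` and `c`: their intervals are disjoint, or one is contained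
in the interior of the other. -/
def ColumnCommutation (G G' : GridDiagram n) (c : ZMod n) : Prop :=
  G.ColumnInterchange G' c ∧
    (Disjoint (G.columnInterval (c - 1)) (G.columnInterval c) ∨
      G.columnInterval (c - 1) ⊆ G.columnInterior c ∨
      G.columnInterval c ⊆ G.columnInterior (c - 1))

/-- Column switch of columns `c - 1` and `c`: the `X`-marking of one of them and the `O`-marking of
the other lie in the same row. -/
def ColumnSwitch (G G' : GridDiagram n) (c : ZMod n) : Prop :=
  G.ColumnInterchange G' c ∧ (G.x (c - 1) = G.o c ∨ G.o (c - 1) = G.x c)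

/-- Row commutation of rows `c - 1` and `c`. -/
def RowCommutation (G G' : GridDiagram n) (c : ZMod n) : Prop :=
  G.transpose.ColumnCommutation G'.transpose c

/-- Row switch of rows `c - 1` and `c`. -/
def RowSwitch (G G' : GridDiagram n) (c : ZMod n) : Prop :=
  G.transpose.ColumnSwitch G'.transpose c

/-- `s` lies on the cyclic arc of rows that runs northward from `a` to `b`. -/
def InArc (a b s : ZMod n) : Prop := (s - a).val ≤ (b - a).val

/-- The two diagrams that differ by interchanging columns `c - 1` and `c` are drawn on one torus: all
vertical circles are shared, except that `β c` for the first diagram is replaced by a curve `γ c` for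
the second one. The circles `β c` and `γ c` cross in a point `a` in the interior of row `A` and a
point `b` in the interior of row `B`. Northward from `a` to `b` the curve `β c` is west of `γ c`, and
the bigon between them contains the two markings of column `c` of the first diagram; northward from `b`
to `a` the curve `γ c` is west of `β c`, and the bigon between them contains the two markings of column
`c - 1` of the first diagram. `IsDrawing G c A B` says that this drawing is possible; markings in rows
`A` and `B` are placed above or below the crossing point so that they lie in the correct bigon. -/
structure IsDrawing (G : GridDiagram n) (c A B : ZMod n) : Prop where
  ne : A ≠ B
  x_east : InArc A B (G.x c)
  o_east : InArc A B (G.o c)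
  x_west : InArc B A (G.x (c - 1))
  o_west : InArc B A (G.o (c - 1))

end GridDiagram

/-! ### The modules -/

/-- The ring `𝔽[V_1, …, V_n, v]` over the field with two elements; `V_i` is the variable `some i`, and
`v` is the variable `none`. -/
abbrev BaseRing (n : ℕ) := MvPolynomial (Option (Fin n)) (ZMod 2)

/-- A grid state is given by a permutation `x`; its point on the vertical circle `β k` lies on the
horizontal circle `α (x k)`. If `β c` is replaced by `γ c`, then the point of column `c` lies on
`γ c ∩ α (x c)`, so the bijection that matches the states of the two diagrams in all but one component
is the identity on permutations. A state of the diagram and its preimage in the 4-fold cover are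
recorded by the same permutation. -/
abbrev GridState (n : ℕ) := Equiv.Perm (ZMod n)

/-- The free `𝔽[V_1, …, V_n, v]`-module on the (finitely many) grid states; the basis element of the
state `x` is `Pi.single x 1`. -/
abbrev GC (n : ℕ) := GridState n → BaseRing n

/-- The translation classes of rectangles in the `2n × 2n` torus under the translations by `n` rows and
by `n` columns: the column and row, modulo `n`, of the south-west corner, and the width and height. An
embedded rectangle in the `N × N` torus has width and height strictly between `0` and `N`; with `N = n`
one gets the rectangles in the grid diagram itself. -/
abbrev Rect (n : ℕ) := (ZMod n × ZMod n) × (ℤ × ℤ)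

namespace Rect

variable {n : ℕ}

def west (r : Rect n) : ZMod n := r.1.1
def south (r : Rect n) : ZMod n := r.1.2
def width (r : Rect n) : ℤ := r.2.1
def height (r : Rect n) : ℤ := r.2.2
def east (r : Rect n) : ZMod n := r.west + (r.width : ZMod n)
def north (r : Rect n) : ZMod n := r.south + (r.height : ZMod n)

/-- The south-west and north-east corners belong to `x`, the north-west and south-east corners belong
to `y`, and `x` and `y` agree in all other columns. -/
def Connects (r : Rect n) (x y : GridState n) : Prop :=
  x r.west = r.south ∧ x r.east = r.north ∧ y r.west = r.north ∧ y r.east = r.south ∧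
    ∀ k, k ≠ r.west → k ≠ r.east → y k = x k

/-- The unit squares of a rectangle, as offsets from the square at its south-west corner. -/
def squares (r : Rect n) : Finset (ℤ × ℤ) := Ico 0 r.width ×ˢ Ico 0 r.height

open scoped Classical in
/-- The point measure `p_x`: the sum, over the points of (the preimage of) `x`, of the average of the
multiplicities of the rectangle in the four squares around the point. -/
def pointMeasure (r : Rect n) (x : GridState n) : ℚ :=
  ∑ s ∈ r.squares, ∑ e ∈ ({0, 1} : Finset ℤ), ∑ f ∈ ({0, 1} : Finset ℤ),
    if x (r.west + ((s.1 + e : ℤ) : ZMod n)) = r.south + ((s.2 + f : ℤ) : ZMod n) then 1 / 4 else 0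

/-- `m[r] = (p_x[r] + p_y[r] - 1) / 2`, which is a natural number whenever `r` connects `x ≠ y`. -/
def mult (r : Rect n) (x y : GridState n) : ℕ :=
  ⌊(r.pointMeasure x + r.pointMeasure y - 1) / 2⌋₊

open scoped Classical in
/-- For a rectangle in the grid diagram itself: the number of points of `x` in its interior. -/
def interiorCount (r : Rect n) (x : GridState n) : ℕ :=
  #{s ∈ Ioo 0 r.width ×ˢ Ioo 0 r.height |
    x (r.west + (s.1 : ZMod n)) = r.south + (s.2 : ZMod n)}

end Rect

/-- The translation classes of pentagons in the 4-fold cover: `p.1` is the rectangle that agrees with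
the pentagon outside of the bigons. The pentagon has one straight vertical side and one broken vertical
side, which lies on lifts of `β c` and `γ c` and turns from one to the other at the fifth corner; the
broken side is the eastern one if `p.2.1 = true` and the western one otherwise. The fifth corner lies
in the row with offset `p.2.2` from the southernmost row. -/
abbrev Pent (n : ℕ) := Rect n × (Bool × ℤ)

namespace Pent

variable {n : ℕ}

def rect (p : Pent n) : Rect n := p.1
def brokenEast (p : Pent n) : Bool := p.2.1
def turn (p : Pent n) : ℤ := p.2.2

/-- `p` goes from the state `x` on the circles with `β c` to the state `y` on the circles with `γ c`,
where the fifth corner is a lift of the crossing point in row `A`. -/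
def Connects (p : Pent n) (c A : ZMod n) (x y : GridState n) : Prop :=
  p.rect.Connects x y ∧ p.rect.west ≠ p.rect.east ∧
    (if p.brokenEast then p.rect.east = c else p.rect.west = c) ∧
    p.turn ∈ Ico 0 p.rect.height ∧ p.rect.south + (p.turn : ZMod n) = A

/-- The unit squares of the diagram of the initial state whose markings lie in the pentagon, as offsets
from the square at the south-west corner of the rectangle. A broken eastern side runs along `γ c`
below the turn and along `β c` above it; a broken western side runs along `β c` below the turn and
along `γ c` above it. At the turn itself, the curve `β c` passes from east of `γ c` (below) to west of
`γ c` (above). So in either case the markings of the column west of `β c` lie in the pentagon when they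
are above the row of the turn, and those of the column east of `β c` when they are below it. -/
def squares (p : Pent n) : Finset (ℤ × ℤ) :=
  let w := p.rect.width
  let h := p.rect.height
  let t := p.turn
  if p.brokenEast then
    (Ico 0 (w - 1) ×ˢ Ico 0 h) ∪ ({w - 1} ×ˢ Ioo t h) ∪ ({w} ×ˢ Ico 0 t)
  else
    (Ico 1 w ×ˢ Ico 0 h) ∪ ({-1} ×ˢ Ioo t h) ∪ ({0} ×ˢ Ico 0 t)

end Pent

/-- The translation classes of hexagons in the 4-fold cover: `h.1` is the rectangle that agrees with the
hexagon outside of the bigons. One vertical side is straight, and the other one, which is the eastern one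
if `h.2.1 = true` and the western one otherwise, runs along `β c`, then along `γ c`, then along `β c`. The
two turns lie in the rows with offsets `h.2.2.1` (lower turn) and `h.2.2.2` (upper turn). -/
abbrev Hexa (n : ℕ) := Rect n × (Bool × (ℤ × ℤ))

namespace Hexa

variable {n : ℕ}

def rect (h : Hexa n) : Rect n := h.1
def brokenEast (h : Hexa n) : Bool := h.2.1
def lower (h : Hexa n) : ℤ := h.2.2.1
def upper (h : Hexa n) : ℤ := h.2.2.2

/-- `h` goes from `x` to `y`, both states on the circles with `β c`. One turn is a lift of the crossing
point `a` in row `A`, the other one a lift of the crossing point `b` in row `B`. As the corners at the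
turns are convex, `b` is the lower turn when the eastern side is broken, and `a` is the lower turn
when the western side is broken. -/
def Connects (h : Hexa n) (c A B : ZMod n) (x y : GridState n) : Prop :=
  h.rect.Connects x y ∧ h.rect.west ≠ h.rect.east ∧
    0 ≤ h.lower ∧ h.lower < h.upper ∧ h.upper < h.rect.height ∧
    (if h.brokenEast then
      h.rect.east = c ∧ h.rect.south + (h.lower : ZMod n) = B ∧ h.rect.south + (h.upper : ZMod n) = A
    else
      h.rect.west = c ∧ h.rect.south + (h.lower : ZMod n) = A ∧ h.rect.south + (h.upper : ZMod n) = B)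

/-- The unit squares of the diagram with `β c` whose markings lie in the hexagon, as offsets from the
square at the south-west corner of the rectangle. -/
def squares (h : Hexa n) : Finset (ℤ × ℤ) :=
  let w := h.rect.width
  let l := h.rect.height
  let t := h.lower
  let u := h.upper
  if h.brokenEast then
    (Ico 0 (w - 1) ×ˢ Ico 0 l) ∪ ({w - 1} ×ˢ (Ico 0 t ∪ Ioo u l)) ∪ ({w} ×ˢ Ioo t u)
  else
    (Ico 1 w ×ˢ Ico 0 l) ∪ ({0} ×ˢ (Ico 0 t ∪ Ioo u l)) ∪ ({-1} ×ˢ Ioo t u)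

end Hexa

namespace GridDiagram

variable {n : ℕ}

/-- None of the given squares (offsets from the square in column `q.1` and row `q.2`) contains an
`X`-marking. -/
def XFree (G : GridDiagram n) (q : ZMod n × ZMod n) (S : Finset (ℤ × ℤ)) : Prop :=
  ∀ s ∈ S, G.x (q.1 + (s.1 : ZMod n)) ≠ q.2 + (s.2 : ZMod n)

open scoped Classical in
/-- The number of the given squares that contain (a lift of) the marking `O_i`. -/
def oMult (G : GridDiagram n) (q : ZMod n × ZMod n) (S : Finset (ℤ × ℤ)) (i : Fin n) : ℕ :=
  #{s ∈ S | G.oCol i = q.1 + (s.1 : ZMod n) ∧ G.oRow i = q.2 + (s.2 : ZMod n)}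

/-- The coefficient `V_1 ^ O_1 ⋯ V_n ^ O_n * v ^ m` of a polygon. -/
def weight (G : GridDiagram n) (q : ZMod n × ZMod n) (S : Finset (ℤ × ℤ)) (m : ℕ) : BaseRing n :=
  (∏ i, MvPolynomial.X (some i) ^ G.oMult q S i) * MvPolynomial.X none ^ m

variable [NeZero n]

/-- The `𝔽[V_1, …, V_n, v]`-linear map with matrix entries `coeff x y` (from `x` to `y`). -/
def linearMapOf (coeff : GridState n → GridState n → BaseRing n) : GC n →ₗ[BaseRing n] GC n :=
  Fintype.linearCombination (BaseRing n) fun x => ∑ y, Pi.single y (coeff x y)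

/-- All translation classes of embedded rectangles in the `N × N` torus. -/
def allRects (n N : ℕ) [NeZero n] : Finset (Rect n) :=
  univ ×ˢ (Ioo 0 (N : ℤ) ×ˢ Ioo 0 (N : ℤ))

open scoped Classical in
/-- The differential `∂` of the double-point enhanced grid complex: it counts the rectangles in the
grid diagram that contain no `X`-marking. -/
def bdry (G : GridDiagram n) : GC n →ₗ[BaseRing n] GC n :=
  linearMapOf fun x y =>
    ∑ r ∈ allRects n n with r.Connects x y ∧ G.XFree r.1 r.squares,
      G.weight r.1 r.squares (r.interiorCount x)

open scoped Classical in
/-- The differential `∂_4` of the complex of the 4-fold cover: it counts the classes of rectangles in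
the `2n × 2n` torus that contain no `X`-marking. -/
def bdry4 (G : GridDiagram n) : GC n →ₗ[BaseRing n] GC n :=
  linearMapOf fun x y =>
    ∑ r ∈ allRects n (2 * n) with r.Connects x y ∧ G.XFree r.1 r.squares,
      G.weight r.1 r.squares (r.mult x y)

open scoped Classical in
/-- The pentagon map, from the complex of `G` to the complex of the diagram with columns `c - 1` and `c`
interchanged, where the fifth corner is the crossing point in row `A`. It counts classes of pentagons
in the 4-fold cover that contain no `X`-marking. -/
def pentMap (G : GridDiagram n) (c A : ZMod n) : GC n →ₗ[BaseRing n] GC n :=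
  linearMapOf fun x y =>
    ∑ p ∈ (allRects n (2 * n) ×ˢ ((univ : Finset Bool) ×ˢ Ico 0 (2 * n : ℤ))).filter
        (fun p : Pent n => p.Connects c A x y ∧ G.XFree p.rect.1 p.squares),
      G.weight p.rect.1 p.squares (p.rect.mult x y)

open scoped Classical in
/-- The hexagon map. It counts classes of hexagons in the 4-fold cover that contain no `X`-marking. -/
def hexMap (G : GridDiagram n) (c A B : ZMod n) : GC n →ₗ[BaseRing n] GC n :=
  linearMapOf fun x y =>
    ∑ h ∈ (allRects n (2 * n) ×ˢ
          ((univ : Finset Bool) ×ˢ (Ico 0 (2 * n : ℤ) ×ˢ Ico 0 (2 * n : ℤ)))).filter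
        (fun h : Hexa n => h.Connects c A B x y ∧ G.XFree h.rect.1 h.squares),
      G.weight h.rect.1 h.squares (h.rect.mult x y)

/-! ### Gradings -/

open scoped Classical in
/-- The Maslov function of a grid state with respect to a set of markings, one in each column, the one of
column `k` being in row `mk k`. It is `J(x, x) - 2 J(x, mk) + J(mk, mk) + 1` in the fundamental
domain, where `J` is the symmetrization of the number of pairs of points with the first strictly
south-west of the second. Points of the state have integer coordinates, and markings lie in the
centers of the squares. -/
def maslovOf (mk : Equiv.Perm (ZMod n)) (x : GridState n) : ℤ :=
  (#{p : ZMod n × ZMod n | p.1.val < p.2.val ∧ (x p.1).val < (x p.2).val} : ℤ)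
    - #{p : ZMod n × ZMod n | p.1.val ≤ p.2.val ∧ (x p.1).val ≤ (mk p.2).val}
    - #{p : ZMod n × ZMod n | p.1.val < p.2.val ∧ (mk p.1).val < (x p.2).val}
    + #{p : ZMod n × ZMod n | p.1.val < p.2.val ∧ (mk p.1).val < (mk p.2).val} + 1

/-- The Maslov grading of a grid state. -/
def maslov (G : GridDiagram n) (x : GridState n) : ℤ := maslovOf G.o x

/-- The Alexander grading of a grid state. -/
def alexander (G : GridDiagram n) (x : GridState n) : ℚ :=
  ((maslovOf G.o x : ℚ) - maslovOf G.x x - (n - 1)) / 2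

/-- The homogeneous elements of bidegree (Maslov, Alexander) `(d, s)`: `v` has bidegree `(2, 0)`, and
each `V_i` has bidegree `(-2, -1)`. -/
def homogeneous (G : GridDiagram n) (d : ℤ) (s : ℚ) : Submodule (ZMod 2) (GC n) :=
  Submodule.span (ZMod 2)
    {z | ∃ (x : GridState n) (e : Option (Fin n) →₀ ℕ),
      G.maslov x - 2 * ∑ i, (e (some i) : ℤ) + 2 * (e none : ℤ) = d ∧
      G.alexander x - ∑ i, (e (some i) : ℚ) = s ∧
      z = Pi.single x (MvPolynomial.monomial e 1)}

/-- `f` is homogeneous of degree `(a, b)` as a map from the complex of `G` to the complex of `G'`. -/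
def IsHomogeneousMap (G G' : GridDiagram n) (f : GC n →ₗ[BaseRing n] GC n) (a : ℤ) (b : ℚ) : Prop :=
  ∀ d s, ∀ z ∈ G.homogeneous d s, f z ∈ G'.homogeneous (d + a) (s + b)

/-! ### Homology -/

/-- The cycles of the double-point enhanced grid complex. -/
abbrev cycles (G : GridDiagram n) : Submodule (BaseRing n) (GC n) := LinearMap.ker G.bdry

/-- The boundaries, inside the cycles. -/
abbrev boundaries (G : GridDiagram n) : Submodule (BaseRing n) G.cycles :=
  (LinearMap.range G.bdry).comap G.cycles.subtype

end GridDiagram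

/-- The ring `𝔽[U, v]`; `U` is the variable `0`, and `v` is the variable `1`. -/
abbrev UVRing := MvPolynomial (Fin 2) (ZMod 2)

/-- The ring homomorphism `𝔽[U, v] → 𝔽[V_1, …, V_n, v]` with `U ↦ V_i` and `v ↦ v`. -/
def uvHom {n : ℕ} (i : Fin n) : UVRing →+* BaseRing n :=
  (MvPolynomial.aeval ![MvPolynomial.X (some i), MvPolynomial.X none]).toRingHom

namespace GridDiagram

variable {n : ℕ} [NeZero n]

/-- The double-point enhanced grid homology of `G`, as an `𝔽[U, v]`-module where `U` acts through
multiplication by `V_i`. -/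
def GH (G : GridDiagram n) (_i : Fin n) : Type := G.cycles ⧸ G.boundaries

instance (G : GridDiagram n) (i : Fin n) : AddCommGroup (G.GH i) :=
  inferInstanceAs (AddCommGroup (G.cycles ⧸ G.boundaries))

instance (G : GridDiagram n) (i : Fin n) : Module (BaseRing n) (G.GH i) :=
  inferInstanceAs (Module (BaseRing n) (G.cycles ⧸ G.boundaries))

instance (G : GridDiagram n) (i : Fin n) : Module UVRing (G.GH i) :=
  Module.compHom (G.GH i) (uvHom i)

/-- The homology class of a cycle. -/
def homologyClass (G : GridDiagram n) (i : Fin n) : G.cycles →ₗ[BaseRing n] G.GH i :=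
  G.boundaries.mkQ

/-- The homogeneous part of bidegree `(d, s)` of the homology. -/
def homologyHomogeneous (G : GridDiagram n) (i : Fin n) (d : ℤ) (s : ℚ) : Set (G.GH i) :=
  {ξ | ∃ z : G.cycles, (z : GC n) ∈ G.homogeneous d s ∧ G.homologyClass i z = ξ}

/-- `φ` respects the bigradings of the homologies. -/
def IsBigradedIso {G G' : GridDiagram n} {i : Fin n} (φ : G.GH i ≃ₗ[UVRing] G'.GH i) : Prop :=
  ∀ d s, φ '' G.homologyHomogeneous i d s = G'.homologyHomogeneous i d s

/-- `φ` is the map induced on homology by `f`. -/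
def IsInducedBy {G G' : GridDiagram n} {i : Fin n} (φ : G.GH i ≃ₗ[UVRing] G'.GH i)
    (f : GC n →ₗ[BaseRing n] GC n) : Prop :=
  ∀ z : G.cycles, ∃ hz : f z ∈ G'.cycles, φ (G.homologyClass i z) = G'.homologyClass i ⟨f z, hz⟩

/-- `P` and `P'` are bigraded chain maps between the complexes of the 4-fold covers of `G` and `G'`,
and `H`, `H'` are homogeneous of degree `(1, 0)` and are chain homotopies from `P' ∘ P` and from
`P ∘ P'` to the identity maps. -/
structure AreHomotopyInverse (G G' : GridDiagram n) (P P' H H' : GC n →ₗ[BaseRing n] GC n) :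
    Prop where
  chain : G'.bdry4 ∘ₗ P = P ∘ₗ G.bdry4
  chain' : G.bdry4 ∘ₗ P' = P' ∘ₗ G'.bdry4
  bigraded : IsHomogeneousMap G G' P 0 0
  bigraded' : IsHomogeneousMap G' G P' 0 0
  degree : IsHomogeneousMap G G H 1 0
  degree' : IsHomogeneousMap G' G' H' 1 0
  homotopy : G.bdry4 ∘ₗ H + H ∘ₗ G.bdry4 + P' ∘ₗ P = LinearMap.id
  homotopy' : G'.bdry4 ∘ₗ H' + H' ∘ₗ G'.bdry4 + P ∘ₗ P' = LinearMap.id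

/-- A linear map between the complexes of the transposed diagrams, read as a linear map between the
complexes of the diagrams themselves: reflection in the diagonal sends the grid state `x` to `x⁻¹`. -/
def reflected (f : GC n →ₗ[BaseRing n] GC n) : GC n →ₗ[BaseRing n] GC n :=
  LinearMap.funLeft (BaseRing n) (BaseRing n) (fun x : GridState n => x⁻¹) ∘ₗ f ∘ₗ
    LinearMap.funLeft (BaseRing n) (BaseRing n) (fun x : GridState n => x⁻¹)

end GridDiagram

end

/-!
# Invariance of grid homology under commutations and switches

The pentagon maps are chain maps and the hexagon maps are homotopies because, in a composition of two
polygons, the union of the two usually has a second decomposition, which cancels the first one in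
characteristic two. The proof is arranged so that this becomes a computation with products of squares.

**Gradings, and the removal of `v`.** Written with the sawtooth function `saw` on the circle `ℤ/n`, the
Maslov function of a state is, up to a constant, a translation-invariant quadratic form (`maslovOf_eq`).
Its change along a rectangle, a pentagon or a hexagon can thus be computed in one place, without regard
to the fundamental domain (`maslovOf_sub_maslovOf`, `maslovOf_sub_pent`, `maslovOf_sub_hexa`), and all maps
are homogeneous. In a homogeneous polynomial the exponent of `v` is determined by the exponents of the
`V_i`. Hence both sides of each relation, being homogeneous of the same degree, may be compared after
setting `v = 1` (`eq_zero_of_setOne_eq_zero`, `HasDegree.eq_zero`), where the multiplicities `m` play no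
role any more.

**Weights as products.** At `v = 1` the weight of a polygon is the product of the values of its squares,
where a square with an `X`-marking has value zero and the square of `O_i` has value `V_i`
(`setOne_weight_xFree`). Among the polygons in the 4-fold cover with given corners, all but one contain a
whole column or row and have weight zero (`sum_lrun`, `sum_liftTurn`, `sum_liftTwoTurn`). The maps
therefore dualize to operators on functions of states that exchange the values of a state on two columns,
with weights that depend only on these columns and values (`dualOp_bdry4`, `dualOp_pentMap`, `dualOp_hexMap`).

**The relations.** Compositions with corners on four columns cancel by commuting the two exchanges
(`awayOp_crossOp_add`). In those with corners on three columns, the squares between the corners merge into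
a grid of five columns and seven row blocks, so that the claim is a finite list of identities between
products of the values of at most 35 coarse squares, in which rows and columns with an `X`-marking have
product zero. A formal cancellation procedure, proved sound in `sum_reduceSum`, is evaluated on this list
(`reduceSum_chainL_east` and the lemmas after it). The compositions with corners on two columns reduce in
the same way to vertical annuli. An annulus of width more than one contains a whole column. The annuli of
width one are on the two sides of the special circle: for the chain map relation they are equal and cancel,
and for the homotopy relation exactly one of them is free of markings (`IsDrawnVal.annuli`) and gives the
identity map. This proves `rectOp_pentOp` and `rectOp_hexOp`.

**Conclusion.** The differential of the 4-fold cover equals the one of the torus (`bdry4_eq_bdry`), so that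
homotopy inverse maps induce isomorphisms of homology (`exists_isBigradedIso`). A drawing is found by placing
the crossing points in the rows of the markings of one column (`exists_isDrawing`), and the statements for
rows follow by reflection (`areHomotopyInverse_reflected`).
-/

set_option linter.unusedSectionVars false

namespace GridInvariance

/-! ### Cyclic products -/

section Run

variable {R : Type*} [CommRing R] {n : ℕ} [NeZero n]

/-- The product of `f` over the cyclic half-open interval `[s, t)`; it is empty for `s = t`. -/
def run (f : ZMod n → R) (s t : ZMod n) : R := ∏ l ∈ range (t - s).val, f (s + (l : ZMod n))

lemma prod_range_cast (f : ZMod n → R) : ∏ l ∈ range n, f (l : ZMod n) = ∏ l, f l := by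
  refine prod_bij' (fun l _ => (l : ZMod n)) (fun l _ => l.val) (by simp)
    (fun l _ => by simpa using ZMod.val_lt l) (fun l hl => ?_) (fun l _ => by simp) (by simp)
  exact ZMod.val_cast_of_lt (by simpa using hl)

lemma prod_range_add_cast (f : ZMod n → R) (s : ZMod n) :
    ∏ l ∈ range n, f (s + (l : ZMod n)) = ∏ l, f l := by
  rw [prod_range_cast (fun l => f (s + l))]
  exact Fintype.prod_equiv (Equiv.addLeft s) _ _ (fun _ => rfl)

lemma run_self (f : ZMod n → R) (s : ZMod n) : run f s s = 1 := by simp [run]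

lemma run_mul (f g : ZMod n → R) (s t : ZMod n) :
    run (fun l => f l * g l) s t = run f s t * run g s t := prod_mul_distrib

lemma run_add_natCast (f : ZMod n → R) (a : ZMod n) {S T : ℕ} (h : S ≤ T) (hT : T < n + S) :
    run f (a + (S : ZMod n)) (a + (T : ZMod n)) = ∏ l ∈ Ico S T, f (a + (l : ZMod n)) := by
  have h1 : (a + (T : ZMod n)) - (a + (S : ZMod n)) = ((T - S : ℕ) : ZMod n) := by
    rw [Nat.cast_sub h]; ring
  rw [run, h1, ZMod.val_cast_of_lt (by omega), prod_Ico_eq_prod_range]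
  refine prod_congr rfl fun l _ => ?_
  push_cast
  congr 1; ring

lemma run_eq_prod_of_val (f : ZMod n → R) {s t : ZMod n} {m : ℕ} (h : (t - s).val = m) :
    run f s t = ∏ l ∈ range m, f (s + (l : ZMod n)) := by rw [run, h]

lemma run_add_natCast' (f : ZMod n → R) (a : ZMod n) {S T : ℕ} (h : T < S) (hS : S ≤ n) :
    run f (a + (S : ZMod n)) (a + (T : ZMod n)) =
      (∏ l ∈ Ico S n, f (a + (l : ZMod n))) * ∏ l ∈ Ico 0 T, f (a + (l : ZMod n)) := by
  have h1 : (a + (T : ZMod n)) = (a + ((T + n : ℕ) : ZMod n)) := by simp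
  rw [h1, run_add_natCast f a (by omega) (by omega),
    ← prod_Ico_consecutive _ hS (show n ≤ T + n by omega)]
  congr 1
  rw [prod_Ico_eq_prod_range, prod_Ico_eq_prod_range]
  have h2 : T + n - n = T - 0 := by omega
  rw [h2]
  refine prod_congr rfl fun l _ => ?_
  simp

/-- Cyclic intervals may be cut at an intermediate point. -/
lemma run_mul_run (f : ZMod n → R) {s t u : ZMod n} (h : (t - s).val ≤ (u - s).val) :
    run f s t * run f t u = run f s u := by
  have ht : t = s + ((t - s).val : ZMod n) := by simp
  have hu : u = s + ((u - s).val : ZMod n) := by simp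
  have h0 : s = s + ((0 : ℕ) : ZMod n) := by simp
  have hlt := ZMod.val_lt (u - s)
  have e1 : run f s t = ∏ l ∈ Ico 0 (t - s).val, f (s + (l : ZMod n)) := by
    conv_lhs => rw [h0, ht]
    simpa using run_add_natCast f s (Nat.zero_le (t - s).val) (by omega)
  have e2 : run f s u = ∏ l ∈ Ico 0 (u - s).val, f (s + (l : ZMod n)) := by
    conv_lhs => rw [h0, hu]
    simpa using run_add_natCast f s (Nat.zero_le (u - s).val) (by omega)
  have e3 : run f t u = ∏ l ∈ Ico (t - s).val (u - s).val, f (s + (l : ZMod n)) := by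
    conv_lhs => rw [ht, hu]
    exact run_add_natCast f s h (by omega)
  rw [e1, e2, e3, prod_Ico_consecutive _ (Nat.zero_le _) h]

lemma run_mul_run_eq_prod (f : ZMod n → R) {s t : ZMod n} (h : s ≠ t) :
    run f s t * run f t s = ∏ l, f l := by
  have ht : t = s + ((t - s).val : ZMod n) := by simp
  have h0 : s = s + ((n : ℕ) : ZMod n) := by simp
  have hlt := ZMod.val_lt (t - s)
  have hpos : 0 < (t - s).val := by
    rw [Nat.pos_iff_ne_zero, Ne, ZMod.val_eq_zero, sub_eq_zero]; exact h.symm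
  have e1 : run f s t = ∏ l ∈ Ico 0 (t - s).val, f (s + (l : ZMod n)) := by
    have h0 : s = s + ((0 : ℕ) : ZMod n) := by simp
    conv_lhs => rw [h0, ht]
    simpa using run_add_natCast f s (Nat.zero_le (t - s).val) (by omega)
  have e3 : run f t s = ∏ l ∈ Ico (t - s).val n, f (s + (l : ZMod n)) := by
    have := run_add_natCast f s hlt.le (by omega)
    rw [← ht, ← h0] at this
    exact this
  rw [e1, e3, prod_Ico_consecutive _ (Nat.zero_le _) hlt.le, ← prod_range_add_cast f s,
    prod_Ico_eq_prod_range]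
  simp

lemma run_succ (f : ZMod n → R) {s t : ZMod n} (h : s ≠ t) :
    run f s t = f s * run f (s + 1) t := by
  have hpos : 0 < (t - s).val := by
    rw [Nat.pos_iff_ne_zero, Ne, ZMod.val_eq_zero, sub_eq_zero]; exact h.symm
  have h1 : (t - (s + 1)).val = (t - s).val - 1 := by
    have e : t - (s + 1) = (((t - s).val - 1 : ℕ) : ZMod n) := by
      rw [Nat.cast_sub hpos]; simp; ring
    rw [e, ZMod.val_cast_of_lt]
    have := ZMod.val_lt (t - s); omega
  rw [run, run, h1]
  obtain ⟨m, hm⟩ : ∃ m, (t - s).val = m + 1 := ⟨_, (Nat.succ_pred_eq_of_pos hpos).symm⟩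
  rw [hm, prod_range_succ', mul_comm]
  simp only [Nat.cast_zero, add_zero, Nat.add_sub_cancel, Nat.cast_add, Nat.cast_one]
  congr 1
  refine prod_congr rfl fun l _ => ?_
  congr 1; ring

end Run

/-! ### Formal products of squares

The torus is cut into a few columns and a few blocks of rows, along the circles on which the corners of
the polygons lie. Column `c` of row block `b` is encoded as the number `8 * b + c`, and a product of
values of squares as a list of such numbers. -/

section Formal

variable {R : Type*} [CommRing R]

/-- The value of an encoded square. -/
def sqVal (C : ℕ → ℕ → R) (s : ℕ) : R := C (s % 8) (s / 8)

/-- The product of the values of a list of encoded squares. -/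
def evalSq (C : ℕ → ℕ → R) (L : List ℕ) : R := (L.map (sqVal C)).prod

lemma evalSq_append (C : ℕ → ℕ → R) (L M : List ℕ) :
    evalSq C (L ++ M) = evalSq C L * evalSq C M := by simp [evalSq]

lemma evalSq_perm (C : ℕ → ℕ → R) {L M : List ℕ} (h : L.Perm M) : evalSq C L = evalSq C M :=
  (h.map _).prod_eq

lemma evalSq_filter_mul (C : ℕ → ℕ → R) (p : ℕ → Bool) (L : List ℕ) :
    evalSq C (L.filter p) * evalSq C (L.filter (fun a => !p a)) = evalSq C L := by
  rw [← evalSq_append]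
  exact evalSq_perm C (List.filter_append_perm p L)

lemma evalSq_eq_one (C : ℕ → ℕ → R) {L : List ℕ} (h : ∀ s ∈ L, sqVal C s = 1) :
    evalSq C L = 1 := by
  refine List.prod_eq_one fun a ha => ?_
  obtain ⟨s, hs, rfl⟩ := List.mem_map.1 ha
  exact h s hs

/-- The set of the elements of a list as a bit mask, which makes membership quick to decide. -/
def mask (L : List ℕ) : ℕ := L.foldr (fun s m => m ||| 1 <<< s) 0

/-- All elements of `z` occur in the list with bit mask `m`. -/
def covers (m : ℕ) (z : List ℕ) : Bool := (m &&& mask z).beq (mask z)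

/-- Remove the squares of value one. -/
def dropOnes (ones L : List ℕ) : List ℕ := L.filter fun s => !(mask ones).testBit s

/-- If `L` contains all squares of `z`, then let it contain each of them only once. -/
def collapse (z L : List ℕ) : List ℕ :=
  if covers (mask L) z then z ++ L.filter (fun s => !(mask z).testBit s) else L

/-- `L` contains all squares, except for those of value one, of a list with product zero. -/
def vanishes (ones : List ℕ) (zeros : List (List ℕ)) (L : List ℕ) : Bool :=
  zeros.any (covers (mask L ||| mask ones))

/-- Add a term to a sum in characteristic two, where a second copy of a term cancels the first one. -/
def toggle (L : List ℕ) : List (List ℕ) → List (List ℕ)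
  | [] => [L]
  | M :: Ms => if L.isPerm M then Ms else M :: toggle L Ms

/-- The terms that are left of a sum of products after all cancellations. -/
def reduceSum (ones : List ℕ) (idem zeros : List (List ℕ)) (T : List (List ℕ)) : List (List ℕ) :=
  ((T.map fun L => idem.foldr collapse (dropOnes ones L)).filter
    fun L => !vanishes ones zeros L).foldr toggle []

lemma testBit_mask (L : List ℕ) (s : ℕ) : (mask L).testBit s = true ↔ s ∈ L := by
  induction L with
  | nil => simp [mask]
  | cons t L ih =>
    rw [mask, List.foldr_cons, ← mask, Nat.testBit_or, Bool.or_eq_true, ih, Nat.one_shiftLeft,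
      Nat.testBit_two_pow, decide_eq_true_eq, List.mem_cons, or_comm, eq_comm]

lemma testBit_of_covers {m : ℕ} {z : List ℕ} (h : covers m z = true) {s : ℕ} (hs : s ∈ z) :
    m.testBit s = true := by
  have h1 : m &&& mask z = mask z := Nat.eq_of_beq_eq_true h
  have h2 := (testBit_mask z s).2 hs
  rw [← h1, Nat.testBit_and, Bool.and_eq_true] at h2
  exact h2.1

variable (C : ℕ → ℕ → R)

lemma evalSq_dropOnes {ones : List ℕ} (h : ∀ s ∈ ones, sqVal C s = 1) (L : List ℕ) :
    evalSq C (dropOnes ones L) = evalSq C L := by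
  rw [dropOnes, ← evalSq_filter_mul C (fun s => (mask ones).testBit s) L,
    evalSq_eq_one C (L := L.filter fun s => (mask ones).testBit s), one_mul]
  intro s hs
  exact h s ((testBit_mask _ _).1 (List.mem_filter.1 hs).2)

/-- If the product over `z` absorbs each of its own factors, as it does when it is zero or when all
factors are one, then further copies of these factors may be dropped. -/
lemma evalSq_mul_of_subset {z : List ℕ} (hz : ∀ s ∈ z, evalSq C z * sqVal C s = evalSq C z) :
    ∀ L : List ℕ, (∀ s ∈ L, s ∈ z) → evalSq C z * evalSq C L = evalSq C z
  | [], _ => by simp [evalSq]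
  | s :: L, h => by
      have h1 : evalSq C (s :: L) = sqVal C s * evalSq C L := by simp [evalSq]
      rw [h1, ← mul_assoc, hz s (h s (by simp))]
      exact evalSq_mul_of_subset hz L fun t ht => h t (by simp [ht])

lemma evalSq_of_subset {z L : List ℕ} (hn : z.Nodup) (h : z ⊆ L) :
    ∃ M : List ℕ, (∀ s ∈ M, s ∈ L) ∧ evalSq C L = evalSq C z * evalSq C M := by
  obtain ⟨M, hM⟩ := Multiset.le_iff_exists_add.1
    (Multiset.coe_le.2 (List.subperm_of_subset hn h))
  obtain ⟨M, rfl⟩ := Quot.exists_rep M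
  have hp : L.Perm (z ++ M) := Multiset.coe_eq_coe.1 hM
  exact ⟨M, fun s hs => hp.mem_iff.2 (List.mem_append_right _ hs),
    by rw [evalSq_perm C hp, evalSq_append]⟩

lemma evalSq_collapse {z : List ℕ} (hn : z.Nodup)
    (hz : ∀ s ∈ z, evalSq C z * sqVal C s = evalSq C z) (L : List ℕ) :
    evalSq C (collapse z L) = evalSq C L := by
  rw [collapse]
  split_ifs with h
  · have h' : z ⊆ L.filter fun s => (mask z).testBit s := fun s hs =>
      List.mem_filter.2 ⟨(testBit_mask _ _).1 (testBit_of_covers h hs), (testBit_mask _ _).2 hs⟩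
    obtain ⟨M, hM, he⟩ := evalSq_of_subset C hn h'
    rw [evalSq_append, ← evalSq_filter_mul C (fun s => (mask z).testBit s) L, he,
      evalSq_mul_of_subset C hz M fun s hs =>
        (testBit_mask _ _).1 (List.mem_filter.1 (hM s hs)).2]
  · rfl

lemma evalSq_foldr_collapse {idem : List (List ℕ)} (h : ∀ z ∈ idem, z.Nodup ∧
    ∀ s ∈ z, evalSq C z * sqVal C s = evalSq C z) (L : List ℕ) :
    evalSq C (idem.foldr collapse L) = evalSq C L := by
  induction idem with
  | nil => rfl
  | cons z zs ih =>
    rw [List.foldr_cons, evalSq_collapse C (h z (by simp)).1 (h z (by simp)).2,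
      ih fun y hy => h y (by simp [hy])]

lemma evalSq_of_vanishes {ones : List ℕ} {zeros : List (List ℕ)}
    (h1 : ∀ s ∈ ones, sqVal C s = 1) (h0 : ∀ z ∈ zeros, z.Nodup ∧ evalSq C z = 0) {L : List ℕ}
    (h : vanishes ones zeros L = true) : evalSq C L = 0 := by
  obtain ⟨z, hz, hL⟩ := List.any_eq_true.1 h
  have hsub : z ⊆ L ++ ones := fun s hs => by
    have := testBit_of_covers hL hs
    rw [Nat.testBit_or, Bool.or_eq_true, testBit_mask, testBit_mask] at this
    exact List.mem_append.2 this
  obtain ⟨M, -, he⟩ := evalSq_of_subset C (h0 z hz).1 hsub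
  have := evalSq_append C L ones
  rw [he, (h0 z hz).2, zero_mul, evalSq_eq_one C h1, mul_one] at this
  exact this.symm

lemma sum_toggle (h2 : ∀ a : R, a + a = 0) (L : List ℕ) : ∀ Ms : List (List ℕ),
    ((toggle L Ms).map (evalSq C)).sum = evalSq C L + (Ms.map (evalSq C)).sum
  | [] => by simp [toggle]
  | M :: Ms => by
    rw [toggle]
    split_ifs with h
    · rw [List.map_cons, List.sum_cons, ← add_assoc, evalSq_perm C (List.isPerm_iff.1 h), h2,
        zero_add]
    · rw [List.map_cons, List.sum_cons, sum_toggle h2 L Ms, List.map_cons, List.sum_cons]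
      ring

/-- Soundness of the formal cancellation: the terms that are dropped are zero or cancel in pairs. -/
lemma sum_reduceSum (h2 : ∀ a : R, a + a = 0) {ones : List ℕ} {idem zeros : List (List ℕ)}
    (h1 : ∀ s ∈ ones, sqVal C s = 1)
    (hi : ∀ z ∈ idem, z.Nodup ∧ ∀ s ∈ z, evalSq C z * sqVal C s = evalSq C z)
    (h0 : ∀ z ∈ zeros, z.Nodup ∧ evalSq C z = 0) (T : List (List ℕ)) :
    ((reduceSum ones idem zeros T).map (evalSq C)).sum = (T.map (evalSq C)).sum := by
  induction T with
  | nil => rfl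
  | cons L T ih =>
    rw [reduceSum] at ih ⊢
    rw [List.map_cons, List.map_cons, List.sum_cons, ← ih]
    have he : evalSq C (idem.foldr collapse (dropOnes ones L)) = evalSq C L := by
      rw [evalSq_foldr_collapse C hi, evalSq_dropOnes C h1]
    rw [List.filter_cons]
    split_ifs with h
    · rw [List.foldr_cons, sum_toggle C h2, he]
    · have : vanishes ones zeros (idem.foldr collapse (dropOnes ones L)) = true := by
        simpa using h
      rw [← he, evalSq_of_vanishes C h1 h0 this, zero_add]

end Formal

/-! ### Coarse grids -/

section Coarse

/-- The row blocks of the cyclic interval `[S, T)`, where there are seven blocks in all. -/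
def seg (S T : ℕ) : List ℕ :=
  if S ≤ T then List.range' S (T - S) else List.range' S (7 - S) ++ List.range' 0 T

/-- The squares in the given columns and row blocks. -/
def strip (cols rows : List ℕ) : List ℕ := rows.flatMap fun b => cols.map fun c => 8 * b + c

/-- The seven row blocks, whose boundaries are given by `bd`, refine the cut of the torus along the
horizontal circles at the boundaries with indices in `st`. The block `B` consists of a single row, and
so does the last one. -/
structure IsCoarse (n : ℕ) (bd : ℕ → ℕ) (st : List ℕ) (B : ℕ) : Prop where
  mono : Monotone bd
  zero : bd 0 = 0
  last : bd 6 + 1 = n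
  top : bd 7 = n
  turn : bd (B + 1) = bd B + 1
  turn_lt : B < 6
  st_le : ∀ S ∈ st, S ≤ 6
  st_inj : ∀ S ∈ st, ∀ T ∈ st, bd S = bd T → S = T

variable {R : Type*} [CommRing R] {n : ℕ} [NeZero n]

/-- The product of the functions `C c` over the columns `c` of a list. -/
def colP (C : ℕ → ZMod n → R) (cols : List ℕ) (l : ZMod n) : R := (cols.map fun c => C c l).prod

/-- The value of column `c` of block `b`, where the rows are counted from `a`. -/
def blockVal (C : ℕ → ZMod n → R) (bd : ℕ → ℕ) (a : ZMod n) (c b : ℕ) : R :=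
  ∏ l ∈ Ico (bd b) (bd (b + 1)), C c (a + (l : ZMod n))

/-- `S` and `T` are compared in the same way as the boundaries with these indices. -/
def Compat (bd : ℕ → ℕ) (S T : ℕ) : Prop := S ≤ T ↔ bd S ≤ bd T

variable {C : ℕ → ZMod n → R} {bd : ℕ → ℕ} {a : ZMod n} {st : List ℕ} {B : ℕ}

lemma sqVal_code (C : ℕ → ℕ → R) {b c : ℕ} (hc : c < 8) : sqVal C (8 * b + c) = C c b := by
  rw [sqVal, Nat.mul_add_mod, Nat.mod_eq_of_lt hc, Nat.mul_add_div (by norm_num),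
    Nat.div_eq_of_lt hc, add_zero]

lemma evalSq_cons (C : ℕ → ℕ → R) (s : ℕ) (L : List ℕ) :
    evalSq C (s :: L) = sqVal C s * evalSq C L := by simp [evalSq]

lemma evalSq_code_map (C : ℕ → ℕ → R) (b : ℕ) :
    ∀ cols : List ℕ, (∀ c ∈ cols, c < 8) →
      evalSq C (cols.map fun c => 8 * b + c) = (cols.map fun c => C c b).prod
  | [], _ => by simp [evalSq]
  | c :: cols, h => by
      rw [List.map_cons, evalSq_cons, sqVal_code C (h c (by simp)),
        evalSq_code_map C b cols fun d hd => h d (by simp [hd]), List.map_cons, List.prod_cons]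

lemma blockVal_colP (cols : List ℕ) (b : ℕ) :
    (cols.map fun c => blockVal C bd a c b).prod =
      ∏ l ∈ Ico (bd b) (bd (b + 1)), colP C cols (a + (l : ZMod n)) := by
  induction cols with
  | nil => simp [colP]
  | cons c cols ih =>
    rw [List.map_cons, List.prod_cons, ih, blockVal, ← prod_mul_distrib]
    simp [colP]

lemma evalSq_strip_range' (hm : Monotone bd) {cols : List ℕ} (hc : ∀ c ∈ cols, c < 8)
    (S : ℕ) : ∀ k : ℕ, evalSq (blockVal C bd a) (strip cols (List.range' S k)) =
      ∏ l ∈ Ico (bd S) (bd (S + k)), colP C cols (a + (l : ZMod n))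
  | 0 => by simp [strip, evalSq]
  | k + 1 => by
      have : List.range' S (k + 1) = List.range' S k ++ [S + k] := by
        simpa using List.range'_concat (step := 1) (s := S) (n := k)
      rw [this, strip, List.flatMap_append, evalSq_append, ← strip,
        evalSq_strip_range' hm hc S k]
      simp only [List.flatMap_cons, List.flatMap_nil, List.append_nil]
      rw [evalSq_code_map _ _ _ hc, blockVal_colP, ← add_assoc,
        prod_Ico_consecutive _ (hm (by omega)) (hm (by omega))]

lemma evalSq_strip_seg (h : IsCoarse n bd st B) {cols : List ℕ} (hc : ∀ c ∈ cols, c < 8)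
    {S T : ℕ} (hS : S ≤ 7) (hT : T ≤ 6) (hST : Compat bd S T) :
    evalSq (blockVal C bd a) (strip cols (seg S T)) =
      run (colP C cols) (a + (bd S : ZMod n)) (a + (bd T : ZMod n)) := by
  have h6 := h.last
  have hTn : bd T < n := by have := h.mono hT; omega
  have hSn : bd S ≤ n := by have := h.mono hS; have := h.top; omega
  rw [seg]
  split_ifs with hle
  · have hle' := hST.1 hle
    rw [evalSq_strip_range' h.mono hc, show S + (T - S) = T by omega,
      run_add_natCast _ _ hle' (by omega)]
  · have hlt : bd T < bd S := by
      by_contra hcon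
      exact hle (hST.2 (by omega))
    rw [strip, List.flatMap_append, ← strip, ← strip, evalSq_append,
      evalSq_strip_range' h.mono hc, evalSq_strip_range' h.mono hc, run_add_natCast' _ _ hlt hSn,
      show S + (7 - S) = 7 by omega, h.top, h.zero, zero_add]

lemma IsCoarse.compat (h : IsCoarse n bd st B) {S T : ℕ} (hS : S ∈ st) (hT : T ∈ st) :
    Compat bd S T := by
  refine ⟨fun hle => h.mono hle, fun hle => ?_⟩
  by_contra hlt
  have := h.mono (show T ≤ S by omega)
  exact hlt (h.st_inj S hS T hT (by omega)).le

/-- The blocks `B` and `6` are single rows, that is, they are nonempty. Therefore their boundaries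
are compared correctly with all other boundaries, although these may coincide with each other. -/
lemma IsCoarse.compat_turn (h : IsCoarse n bd st B) (S : ℕ) : Compat bd S B := by
  refine ⟨fun hle => h.mono hle, fun hle => ?_⟩
  by_contra hlt
  have := h.mono (show B + 1 ≤ S by omega)
  have := h.turn
  omega

lemma IsCoarse.turn_compat (h : IsCoarse n bd st B) (S : ℕ) : Compat bd (B + 1) S := by
  refine ⟨fun hle => h.mono hle, fun hle => ?_⟩
  by_contra hlt
  have := h.mono (show S ≤ B by omega)
  have := h.turn
  omega

lemma IsCoarse.compat_last (h : IsCoarse n bd st B) {S : ℕ} (hS : S ≤ 6) : Compat bd S 6 :=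
  ⟨fun hle => h.mono hle, fun _ => hS⟩

lemma IsCoarse.last_compat (h : IsCoarse n bd st B) {S : ℕ} (hS : S ≤ 6) : Compat bd 7 S := by
  refine ⟨fun hle => h.mono hle, fun hle => ?_⟩
  have := h.mono hS
  have := h.top
  have := h.last
  omega

/-! ### Polygons -/

/-- The weight of a polygon with one turn, in row `A`, between the horizontal circles `s` and `t`: the
rows contribute the values of `f` below the turn, of `g` above it, and of `m` at the turn. -/
def turn (f m g : ZMod n → R) (A s t : ZMod n) : R := run f s A * m A * run g (A + 1) t

/-- The weight of a polygon with two turns, the lower one in row `A` and the upper one in row `B`. -/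
def twoTurn (f m g : ZMod n → R) (A B s t : ZMod n) : R :=
  run f s A * m A * run g (A + 1) B * m B * run f (B + 1) t

/-- The squares of a polygon with one turn in block `A`, with the columns `cols` and the additional
column `f` below the turn and `g` above it. -/
def turnL (cols : List ℕ) (f g A S T : ℕ) : List ℕ :=
  strip (f :: cols) (seg S A) ++ (strip cols [A] ++ strip (g :: cols) (seg (A + 1) T))

/-- The squares of a polygon with two turns, in the blocks `A` and `B`. -/
def twoTurnL (cols : List ℕ) (f g A B S T : ℕ) : List ℕ :=
  strip (f :: cols) (seg S A) ++ (strip cols [A] ++ (strip (g :: cols) (seg (A + 1) B) ++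
    (strip cols [B] ++ strip (f :: cols) (seg (B + 1) T))))

lemma evalSq_strip_singleton {cols : List ℕ} (hc : ∀ c ∈ cols, c < 8) {A : ℕ}
    (hA : bd (A + 1) = bd A + 1) :
    evalSq (blockVal C bd a) (strip cols [A]) = colP C cols (a + (bd A : ZMod n)) := by
  simp only [strip, List.flatMap_cons, List.flatMap_nil, List.append_nil]
  rw [evalSq_code_map _ _ _ hc, blockVal_colP, hA]
  simp

lemma cast_turn {A : ℕ} (hA : bd (A + 1) = bd A + 1) :
    a + (bd A : ZMod n) + 1 = a + (bd (A + 1) : ZMod n) := by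
  rw [hA]; push_cast; ring

lemma evalSq_turnL (h : IsCoarse n bd st B) {cols : List ℕ} {f g : ℕ}
    (hc : ∀ c ∈ f :: g :: cols, c < 8) {A S T : ℕ} (hA : bd (A + 1) = bd A + 1) (hA6 : A ≤ 6)
    (hS : S ≤ 6) (hT : T ≤ 6) (hSA : Compat bd S A) (hAT : Compat bd (A + 1) T) :
    evalSq (blockVal C bd a) (turnL cols f g A S T) =
      turn (colP C (f :: cols)) (colP C cols) (colP C (g :: cols)) (a + (bd A : ZMod n))
        (a + (bd S : ZMod n)) (a + (bd T : ZMod n)) := by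
  rw [turnL, evalSq_append, evalSq_append, turn, cast_turn hA,
    evalSq_strip_seg h (by simp at hc ⊢; tauto) (by omega) hA6 hSA,
    evalSq_strip_seg h (by simp at hc ⊢; tauto) (by omega) hT hAT,
    evalSq_strip_singleton (by simp at hc ⊢; tauto) hA]
  ring

lemma evalSq_twoTurnL (h : IsCoarse n bd st B) {cols : List ℕ} {f g : ℕ}
    (hc : ∀ c ∈ f :: g :: cols, c < 8) {A A' S T : ℕ} (hA : bd (A + 1) = bd A + 1)
    (hA' : bd (A' + 1) = bd A' + 1) (hA6 : A ≤ 6) (hA6' : A' ≤ 6)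
    (hS : S ≤ 6) (hT : T ≤ 6) (hSA : Compat bd S A) (hAA : Compat bd (A + 1) A')
    (hAT : Compat bd (A' + 1) T) :
    evalSq (blockVal C bd a) (twoTurnL cols f g A A' S T) =
      twoTurn (colP C (f :: cols)) (colP C cols) (colP C (g :: cols)) (a + (bd A : ZMod n))
        (a + (bd A' : ZMod n)) (a + (bd S : ZMod n)) (a + (bd T : ZMod n)) := by
  rw [twoTurnL, evalSq_append, evalSq_append, evalSq_append, evalSq_append, twoTurn,
    cast_turn hA, cast_turn hA',
    evalSq_strip_seg h (by simp at hc ⊢; tauto) (by omega) hA6 hSA,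
    evalSq_strip_seg h (by simp at hc ⊢; tauto) (by omega) hA6' hAA,
    evalSq_strip_seg h (by simp at hc ⊢; tauto) (by omega) hT hAT,
    evalSq_strip_singleton (by simp at hc ⊢; tauto) hA,
    evalSq_strip_singleton (by simp at hc ⊢; tauto) hA']
  ring

end Coarse

/-! ### Polygons through the special column -/

section Values

variable {R : Type*} [CommRing R] {n : ℕ} [NeZero n]

/-- The weights of the two polygons with one turn that exchange the point of the special column, in row
`s`, and the point of another column, in row `t`: one of them has the columns `u` and the special
column on its western side, the other one has the columns `w` and the special column on its eastern
side. -/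
def pentV (C : ℕ → ZMod n → R) (f g : ℕ) (u w : List ℕ) (A s t : ZMod n) : R :=
  turn (colP C (f :: u)) (colP C u) (colP C (g :: u)) A s t +
    turn (colP C (f :: w)) (colP C w) (colP C (g :: w)) A t s

/-- The weights of the two polygons with two turns that exchange the point of the special column and
the point of another column. -/
def hexV (C : ℕ → ZMod n → R) (f g : ℕ) (u w : List ℕ) (A B s t : ZMod n) : R :=
  twoTurn (colP C (f :: u)) (colP C u) (colP C (g :: u)) A B s t +
    twoTurn (colP C (g :: w)) (colP C w) (colP C (f :: w)) B A t s

/-- The weights of the two rectangles with columns `r` and `r'`. -/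
def rectV (C : ℕ → ZMod n → R) (r r' : List ℕ) (s t : ZMod n) : R :=
  run (colP C r) s t + run (colP C r') t s

/-- The squares of the polygons of `pentV`. -/
def pentL (f g : ℕ) (u w : List ℕ) (A S T : ℕ) : List (List ℕ) :=
  [turnL u f g A S T, turnL w f g A T S]

/-- The squares of the polygons of `hexV`. -/
def hexL (f g : ℕ) (u w : List ℕ) (A B S T : ℕ) : List (List ℕ) :=
  [twoTurnL u f g A B S T, twoTurnL w g f B A T S]

/-- The squares of the rectangles of `rectV`. -/
def rectL (r r' : List ℕ) (S T : ℕ) : List (List ℕ) := [strip r (seg S T), strip r' (seg T S)]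

/-- All products of a term of `L` and a term of `M`. -/
def prods (L M : List (List ℕ)) : List (List ℕ) := L.flatMap fun a => M.map (a ++ ·)

/-- The sum of the values of products of squares. -/
def sumEval (X : ℕ → ℕ → R) (T : List (List ℕ)) : R := (T.map (evalSq X)).sum

lemma sumEval_append (X : ℕ → ℕ → R) (L M : List (List ℕ)) :
    sumEval X (L ++ M) = sumEval X L + sumEval X M := by simp [sumEval]

lemma sumEval_map_append (X : ℕ → ℕ → R) (a : List ℕ) (M : List (List ℕ)) :
    sumEval X (M.map (a ++ ·)) = evalSq X a * sumEval X M := by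
  induction M with
  | nil => simp [sumEval]
  | cons m M ih =>
    rw [sumEval] at ih ⊢
    rw [List.map_cons, List.map_cons, List.sum_cons, ih, evalSq_append]
    simp only [sumEval, List.map_cons, List.sum_cons]
    ring

lemma sumEval_prods (X : ℕ → ℕ → R) (L M : List (List ℕ)) :
    sumEval X (prods L M) = sumEval X L * sumEval X M := by
  induction L with
  | nil => simp [sumEval, prods]
  | cons a L ih =>
    rw [prods, List.flatMap_cons, sumEval_append, ← prods, ih, sumEval_map_append]
    simp only [sumEval, List.map_cons, List.sum_cons]
    ring

variable {C : ℕ → ZMod n → R} {bd : ℕ → ℕ} {a : ZMod n} {st : List ℕ} {B : ℕ}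

lemma IsCoarse.turn_last (h : IsCoarse n bd st B) : bd (6 + 1) = bd 6 + 1 := by
  rw [h.last]; exact h.top

lemma sumEval_pentL_last (h : IsCoarse n bd st B) {f g : ℕ} {u w : List ℕ}
    (hc : ∀ c ∈ f :: g :: (u ++ w), c < 8) {S T : ℕ} (hS : S ∈ st) (hT : T ∈ st) :
    sumEval (blockVal C bd a) (pentL f g u w 6 S T) =
      pentV C f g u w (a + (bd 6 : ZMod n)) (a + (bd S : ZMod n)) (a + (bd T : ZMod n)) := by
  have hS6 := h.st_le S hS
  have hT6 := h.st_le T hT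
  simp only [sumEval, pentL, List.map_cons, List.map_nil, List.sum_cons, List.sum_nil, add_zero]
  rw [pentV, evalSq_turnL h (by simp at hc ⊢; grind) h.turn_last le_rfl hS6 hT6
    (h.compat_last hS6) (h.last_compat hT6), evalSq_turnL h (by simp at hc ⊢; grind)
    h.turn_last le_rfl hT6 hS6 (h.compat_last hT6) (h.last_compat hS6)]

lemma sumEval_pentL (h : IsCoarse n bd st B) {f g : ℕ} {u w : List ℕ}
    (hc : ∀ c ∈ f :: g :: (u ++ w), c < 8) {S T : ℕ} (hS : S ∈ st) (hT : T ∈ st) :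
    sumEval (blockVal C bd a) (pentL f g u w B S T) =
      pentV C f g u w (a + (bd B : ZMod n)) (a + (bd S : ZMod n)) (a + (bd T : ZMod n)) := by
  have hS6 := h.st_le S hS
  have hT6 := h.st_le T hT
  simp only [sumEval, pentL, List.map_cons, List.map_nil, List.sum_cons, List.sum_nil, add_zero]
  rw [pentV, evalSq_turnL h (by simp at hc ⊢; grind) h.turn h.turn_lt.le hS6 hT6
    (h.compat_turn S) (h.turn_compat T), evalSq_turnL h (by simp at hc ⊢; grind)
    h.turn h.turn_lt.le hT6 hS6 (h.compat_turn T) (h.turn_compat S)]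

lemma sumEval_hexL (h : IsCoarse n bd st B) {f g : ℕ} {u w : List ℕ}
    (hc : ∀ c ∈ f :: g :: (u ++ w), c < 8) {S T : ℕ} (hS : S ∈ st) (hT : T ∈ st) :
    sumEval (blockVal C bd a) (hexL f g u w 6 B S T) =
      hexV C f g u w (a + (bd 6 : ZMod n)) (a + (bd B : ZMod n)) (a + (bd S : ZMod n))
        (a + (bd T : ZMod n)) := by
  have hS6 := h.st_le S hS
  have hT6 := h.st_le T hT
  have hB := h.turn_lt
  simp only [sumEval, hexL, List.map_cons, List.map_nil, List.sum_cons, List.sum_nil, add_zero]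
  rw [hexV, evalSq_twoTurnL h (by simp at hc ⊢; grind) h.turn_last h.turn le_rfl hB.le hS6 hT6
    (h.compat_last hS6) (h.last_compat hB.le) (h.turn_compat T),
    evalSq_twoTurnL h (by simp at hc ⊢; grind) h.turn h.turn_last hB.le le_rfl hT6 hS6
    (h.compat_turn T) (h.compat_last (by omega)) (h.last_compat hS6)]

lemma sumEval_rectL (h : IsCoarse n bd st B) {r r' : List ℕ}
    (hc : ∀ c ∈ r ++ r', c < 8) {S T : ℕ} (hS : S ∈ st) (hT : T ∈ st) :
    sumEval (blockVal C bd a) (rectL r r' S T) =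
      rectV C r r' (a + (bd S : ZMod n)) (a + (bd T : ZMod n)) := by
  have hS6 := h.st_le S hS
  have hT6 := h.st_le T hT
  simp only [sumEval, rectL, List.map_cons, List.map_nil, List.sum_cons, List.sum_nil, add_zero]
  rw [rectV, evalSq_strip_seg h (by simp at hc ⊢; grind) (by omega) hT6 (h.compat hS hT),
    evalSq_strip_seg h (by simp at hc ⊢; grind) (by omega) hS6 (h.compat hT hS)]

/-! ### Formal cancellation -/

/-- The row blocks that certainly contain a row: the two single rows, and the blocks between consecutive
boundaries that are distinct because they both carry corners. -/
def fullRows (st : List ℕ) (B : ℕ) : List ℕ :=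
  (List.range 7).filter fun b => b == B || b == 6 || (st.contains b && st.contains (b + 1))

/-- The squares of column `c`. -/
def wholeCol (c : ℕ) : List ℕ := (List.range 7).map fun b => 8 * b + c

/-- The squares of row block `b`. -/
def wholeRow (b : ℕ) : List ℕ := (List.range 5).map fun c => 8 * b + c

/-- The lists of squares with product zero: nonempty row blocks and the columns in `zc`. -/
def zeroLists (st : List ℕ) (B : ℕ) (zc : List ℕ) : List (List ℕ) :=
  (fullRows st B).map wholeRow ++ zc.map wholeCol

/-- The five columns are the result of merging the columns of a diagram: every row contains an
`X`-marking, where the value is zero, and so does each of the columns in `zc`; columns `0` and `2` may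
be empty. -/
structure IsCols (C : ℕ → ZMod n → R) (zc : List ℕ) : Prop where
  row : ∀ l, C 0 l * C 1 l * C 2 l * C 3 l * C 4 l = 0
  col : ∀ c ∈ zc, ∏ l, C c l = 0
  idem : ∀ c ∈ [0, 2], (∏ l, C c l = 0) ∨ ∀ l, C c l = 1

lemma evalSq_wholeCol (h : IsCoarse n bd st B) {c : ℕ} (hc : c < 8) :
    evalSq (blockVal C bd a) (wholeCol c) = ∏ l, C c l := by
  have h1 : wholeCol c = strip [c] (List.range' 0 7) := by
    simp [wholeCol, strip, List.range_eq_range', List.range']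
  rw [h1, evalSq_strip_range' h.mono (by simpa using hc), zero_add, h.zero, h.top,
    ← prod_range_add_cast (C c) a, ← Nat.Ico_zero_eq_range]
  simp [colP]

lemma evalSq_wholeRow {b : ℕ} :
    evalSq (blockVal C bd a) (wholeRow b) = ∏ l ∈ Ico (bd b) (bd (b + 1)),
      (C 0 (a + (l : ZMod n)) * C 1 (a + (l : ZMod n)) * C 2 (a + (l : ZMod n)) *
        C 3 (a + (l : ZMod n)) * C 4 (a + (l : ZMod n))) := by
  rw [wholeRow, evalSq_code_map _ _ _ (by simp; omega), blockVal_colP]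
  refine prod_congr rfl fun l _ => ?_
  simp [colP, List.range_succ, mul_assoc]

lemma fullRows_lt (h : IsCoarse n bd st B) {b : ℕ} (hb : b ∈ fullRows st B) :
    bd b < bd (b + 1) := by
  simp only [fullRows, List.mem_filter, List.mem_range, Bool.or_eq_true, beq_iff_eq,
    Bool.and_eq_true, List.contains_iff_mem] at hb
  obtain ⟨-, (rfl | rfl) | ⟨h1, h2⟩⟩ := hb
  · rw [h.turn]; omega
  · rw [h.turn_last]; omega
  · refine lt_of_le_of_ne (h.mono (by omega)) fun he => ?_
    have := h.st_inj _ h1 _ h2 he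
    omega

lemma sumEval_eq_zero (h2 : ∀ x : R, x + x = 0) (h : IsCoarse n bd st B) {zc : List ℕ}
    (hzc : ∀ c ∈ zc, c < 8) (hC : IsCols C zc) {ones : List ℕ}
    (h1 : ∀ s ∈ ones, sqVal (blockVal C bd a) s = 1) {T : List (List ℕ)}
    (hT : reduceSum ones [wholeCol 0, wholeCol 2] (zeroLists st B zc) T = []) :
    sumEval (blockVal C bd a) T = 0 := by
  have key := sum_reduceSum (blockVal C bd a) h2 h1 (idem := [wholeCol 0, wholeCol 2])
    (zeros := zeroLists st B zc) ?_ ?_ T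
  · rw [sumEval, ← key, hT]; rfl
  · intro z hz
    obtain ⟨c, hc, rfl⟩ : ∃ c ∈ [0, 2], z = wholeCol c := by simpa using hz
    have hc8 : c < 8 := by simp at hc; omega
    refine ⟨List.Nodup.map (fun x y hxy => by simp at hxy; omega) List.nodup_range, ?_⟩
    intro s hs
    rw [evalSq_wholeCol h hc8]
    rcases hC.idem c hc with h0 | h0
    · rw [h0, zero_mul]
    · obtain ⟨b, -, rfl⟩ := List.mem_map.1 hs
      rw [sqVal_code _ hc8, blockVal, prod_eq_one (fun l _ => h0 l),
        prod_eq_one (fun l _ => h0 _), mul_one]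
  · intro z hz
    rcases List.mem_append.1 hz with hz | hz
    · obtain ⟨b, hb, rfl⟩ := List.mem_map.1 hz
      refine ⟨List.Nodup.map (fun x y hxy => by simp at hxy; omega) List.nodup_range, ?_⟩
      rw [evalSq_wholeRow]
      exact prod_eq_zero (mem_Ico.2 ⟨le_rfl, fullRows_lt h hb⟩) (hC.row _)
    · obtain ⟨c, hc, rfl⟩ := List.mem_map.1 hz
      refine ⟨List.Nodup.map (fun x y hxy => by simp at hxy; omega) List.nodup_range, ?_⟩
      rw [evalSq_wholeCol h (hzc c hc), hC.col c hc]

end Values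

/-! ### The local identities -/

section Local

/-- The compositions of a pentagon and a rectangle whose corners lie on the special column and two other
columns, cyclically permuting the points on these columns. -/
def chainL (ui wi uk wk r r' : List ℕ) (S₁ S₂ S₃ : ℕ) : List (List ℕ) :=
  prods (pentL 4 3 ui wi 6 S₁ S₂) (rectL r r' S₁ S₃) ++
  (prods (rectL r r' S₂ S₃) (pentL 4 3 uk wk 6 S₁ S₂) ++
  (prods (pentL 4 3 uk wk 6 S₁ S₃) (rectL (3 :: ui) (4 :: wi) S₃ S₂) ++
  prods (rectL (4 :: uk) (3 :: wk) S₁ S₃) (pentL 4 3 ui wi 6 S₃ S₂)))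

/-- The compositions of a hexagon and a rectangle, or of two pentagons, whose corners lie on the special
column and two other columns, cyclically permuting the points on these columns. -/
def homotopyL (B : ℕ) (ui wi uk wk r r' : List ℕ) (S₁ S₂ S₃ : ℕ) : List (List ℕ) :=
  prods (hexL 4 3 ui wi 6 B S₁ S₂) (rectL r r' S₁ S₃) ++
  (prods (rectL r r' S₂ S₃) (hexL 4 3 uk wk 6 B S₁ S₂) ++
  (prods (hexL 4 3 uk wk 6 B S₁ S₃) (rectL (4 :: ui) (3 :: wi) S₃ S₂) ++
  (prods (rectL (4 :: uk) (3 :: wk) S₁ S₃) (hexL 4 3 ui wi 6 B S₃ S₂) ++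
  prods (pentL 4 3 uk wk 6 S₁ S₃) (pentL 3 4 ui wi B S₃ S₂))))

/-- The compositions of a pentagon and a rectangle that exchange the same two points twice, and the two
vertical annuli which are left. -/
def chainLoopL (u w : List ℕ) (S T : ℕ) : List (List ℕ) :=
  prods (pentL 4 3 u w 6 S T) (rectL (3 :: u) (4 :: w) T S) ++
  (prods (rectL (4 :: u) (3 :: w) S T) (pentL 4 3 u w 6 T S) ++
  [turnL u 4 3 6 S S, turnL w 4 3 6 S S])

/-- The compositions of a hexagon and a rectangle, or of two pentagons, that exchange the same two
points twice, and the two vertical annuli which are left. -/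
def homotopyLoopL (B : ℕ) (u w : List ℕ) (S T : ℕ) : List (List ℕ) :=
  prods (hexL 4 3 u w 6 B S T) (rectL (4 :: u) (3 :: w) T S) ++
  (prods (rectL (4 :: u) (3 :: w) S T) (hexL 4 3 u w 6 B T S) ++
  (prods (pentL 4 3 u w 6 S T) (pentL 3 4 u w B T S) ++
  [twoTurnL u 4 3 6 B S S, twoTurnL w 3 4 B 6 S S]))

/-- The squares of the special columns `3` and `4` that contain no marking, when the markings of column
`4` lie in the blocks up to `B`, and those of column `3` in the blocks from `B`. -/
def emptySquares (B : ℕ) : List ℕ :=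
  (List.range B).map (fun b => 8 * b + 3) ++ (List.range' (B + 1) (5 - B)).map (fun b => 8 * b + 4)

/-- The possible positions of three circles and a special row among the seven row blocks: the circles
in any order, and the special row `B` below, between or above them. A circle is given by the block above
it. The row `A` of the other turn is always block `6`, so that the relative position of `A` and the
circles is no further case. -/
def positions₃ : List (ℕ × ℕ × ℕ × ℕ) :=
  [(3, 4, 5, 1), (1, 4, 5, 2), (1, 2, 5, 3), (1, 2, 3, 4), (3, 5, 4, 1), (1, 5, 4, 2), (1, 5, 2, 3),
   (1, 3, 2, 4), (4, 3, 5, 1), (4, 1, 5, 2), (2, 1, 5, 3), (2, 1, 3, 4), (4, 5, 3, 1), (4, 5, 1, 2),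
   (2, 5, 1, 3), (2, 3, 1, 4), (5, 3, 4, 1), (5, 1, 4, 2), (5, 1, 2, 3), (3, 1, 2, 4), (5, 4, 3, 1),
   (5, 4, 1, 2), (5, 2, 1, 3), (3, 2, 1, 4)]

/-- The possible positions of two circles and a special row among the seven row blocks. -/
def positions₂ : List (ℕ × ℕ × ℕ) :=
  [(3, 4, 1), (1, 4, 2), (1, 2, 3), (4, 3, 1), (4, 1, 2), (2, 1, 3)]

set_option maxRecDepth 100000 in
/-- The terms of the chain map relation cancel in every position, by evaluation. Here the first of
the two other circles lies between the columns `0` and `1`, and the second one between `1` and `2`;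
the columns `3` and `4` are the ones to the west and to the east of the special circle. -/
lemma reduceSum_chainL_east : ∀ P ∈ positions₃, reduceSum [] [wholeCol 0, wholeCol 2]
    (zeroLists [P.1, P.2.1, P.2.2.1] P.2.2.2 [1, 3, 4])
    (chainL [0] [1, 2] [0, 1] [2] [1] [2, 3, 4, 0] P.1 P.2.1 P.2.2.1) = [] := by
  decide +kernel

/-- The same with the two other circles exchanged. -/
lemma reduceSum_chainL_west : ∀ P ∈ positions₃, reduceSum [] [wholeCol 0, wholeCol 2]
    (zeroLists [P.1, P.2.1, P.2.2.1] P.2.2.2 [1, 3, 4])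
    (chainL [0, 1] [2] [0] [1, 2] [2, 3, 4, 0] [1] P.1 P.2.1 P.2.2.1) = [] := by
  decide +kernel

/-- The terms of the homotopy relation cancel in every position. Unlike for the chain map relation,
this uses that the parts `emptySquares` of the special columns contain no marking. -/
lemma reduceSum_homotopyL_east : ∀ P ∈ positions₃,
    reduceSum (emptySquares P.2.2.2) [wholeCol 0, wholeCol 2]
    (zeroLists [P.1, P.2.1, P.2.2.1] P.2.2.2 [1, 3, 4])
    (homotopyL P.2.2.2 [0] [1, 2] [0, 1] [2] [1] [2, 3, 4, 0] P.1 P.2.1 P.2.2.1) = [] := by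
  decide +kernel

lemma reduceSum_homotopyL_west : ∀ P ∈ positions₃,
    reduceSum (emptySquares P.2.2.2) [wholeCol 0, wholeCol 2]
    (zeroLists [P.1, P.2.1, P.2.2.1] P.2.2.2 [1, 3, 4])
    (homotopyL P.2.2.2 [0, 1] [2] [0] [1, 2] [2, 3, 4, 0] [1] P.1 P.2.1 P.2.2.1) = [] := by
  decide +kernel

/-- The terms that exchange the same two points twice cancel up to two annuli. There is only one
other circle, so that column `1` is empty. -/
lemma reduceSum_chainLoopL : ∀ P ∈ positions₂,
    reduceSum (wholeCol 1) [wholeCol 0, wholeCol 2]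
    (zeroLists [P.1, P.2.1] P.2.2 [3, 4]) (chainLoopL [0] [2] P.1 P.2.1) = [] := by
  decide +kernel

lemma reduceSum_homotopyLoopL : ∀ P ∈ positions₂,
    reduceSum (emptySquares P.2.2 ++ wholeCol 1) [wholeCol 0, wholeCol 2]
    (zeroLists [P.1, P.2.1] P.2.2 [3, 4]) (homotopyLoopL P.2.2 [0] [2] P.1 P.2.1) = [] := by
  decide +kernel

end Local

section Local

/-- The boundaries of seven row blocks: `0`, six numbers, and the number `n` of rows. -/
def bdOf (a₁ a₂ a₃ a₄ a₅ a₆ n : ℕ) : ℕ → ℕ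
  | 0 => 0
  | 1 => a₁
  | 2 => a₂
  | 3 => a₃
  | 4 => a₄
  | 5 => a₅
  | 6 => a₆
  | _ + 7 => n

lemma monotone_bdOf {a₁ a₂ a₃ a₄ a₅ a₆ n : ℕ} (h₁ : a₁ ≤ a₂) (h₂ : a₂ ≤ a₃) (h₃ : a₃ ≤ a₄)
    (h₄ : a₄ ≤ a₅) (h₅ : a₅ ≤ a₆) (h₆ : a₆ ≤ n) : Monotone (bdOf a₁ a₂ a₃ a₄ a₅ a₆ n) :=
  monotone_nat_of_le_succ fun
    | 0 => Nat.zero_le _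
    | 1 => h₁
    | 2 => h₂
    | 3 => h₃
    | 4 => h₄
    | 5 => h₅
    | 6 => h₆
    | _ + 7 => le_rfl

lemma IsCoarse.of_subset {n : ℕ} {bd : ℕ → ℕ} {st st' : List ℕ} {B : ℕ}
    (h : IsCoarse n bd st B) (hs : st' ⊆ st) : IsCoarse n bd st' B :=
  { h with
    st_le := fun S hS => h.st_le S (hs hS)
    st_inj := fun S hS T hT => h.st_inj S (hs hS) T (hs hT) }

/-- Three rows `x < y < z` and the row `β` cut `n` rows into seven blocks, of which the last one is
the top row. All six orders of the three rows are recorded at once. -/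
lemma exists_isCoarse_of_lt {n β x y z : ℕ} (hβ : β + 1 < n) (hxy : x < y) (hyz : y < z)
    (hz : z < n) : ∃ bd X Y Z B, IsCoarse n bd [X, Y, Z] B ∧ bd B = β ∧ bd X = x ∧ bd Y = y ∧
      bd Z = z ∧ (X, Y, Z, B) ∈ positions₃ ∧ (X, Z, Y, B) ∈ positions₃ ∧ (Y, X, Z, B) ∈ positions₃ ∧
      (Y, Z, X, B) ∈ positions₃ ∧ (Z, X, Y, B) ∈ positions₃ ∧ (Z, Y, X, B) ∈ positions₃ := by
  rcases lt_or_ge β x with h | h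
  · refine ⟨bdOf β (β + 1) x y z (n - 1) n, 3, 4, 5, 1, ⟨monotone_bdOf (by omega) (by omega)
      (by omega) (by omega) (by omega) (by omega), rfl, by simp only [bdOf]; omega, rfl, rfl,
      by norm_num, by decide, by simp [bdOf]; omega⟩, rfl, rfl, rfl, rfl, by decide⟩
  rcases lt_or_ge β y with h' | h'
  · refine ⟨bdOf x β (β + 1) y z (n - 1) n, 1, 4, 5, 2, ⟨monotone_bdOf (by omega) (by omega)
      (by omega) (by omega) (by omega) (by omega), rfl, by simp only [bdOf]; omega, rfl, rfl,
      by norm_num, by decide, by simp [bdOf]; omega⟩, rfl, rfl, rfl, rfl, by decide⟩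
  rcases lt_or_ge β z with h'' | h''
  · refine ⟨bdOf x y β (β + 1) z (n - 1) n, 1, 2, 5, 3, ⟨monotone_bdOf (by omega) (by omega)
      (by omega) (by omega) (by omega) (by omega), rfl, by simp only [bdOf]; omega, rfl, rfl,
      by norm_num, by decide, by simp [bdOf]; omega⟩, rfl, rfl, rfl, rfl, by decide⟩
  · refine ⟨bdOf x y z β (β + 1) (n - 1) n, 1, 2, 3, 4, ⟨monotone_bdOf (by omega) (by omega)
      (by omega) (by omega) (by omega) (by omega), rfl, by simp only [bdOf]; omega, rfl, rfl,
      by norm_num, by decide, by simp [bdOf]; omega⟩, rfl, rfl, rfl, rfl, by decide⟩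

lemma exists_isCoarse₃ {n β x y z : ℕ} (hβ : β + 1 < n) (hx : x < n) (hy : y < n) (hz : z < n)
    (hxy : x ≠ y) (hyz : y ≠ z) (hxz : x ≠ z) : ∃ bd X Y Z B, IsCoarse n bd [X, Y, Z] B ∧
      bd B = β ∧ bd X = x ∧ bd Y = y ∧ bd Z = z ∧ (X, Y, Z, B) ∈ positions₃ := by
  rcases lt_or_gt_of_ne hxy with h1 | h1 <;> rcases lt_or_gt_of_ne hyz with h2 | h2 <;>
    rcases lt_or_gt_of_ne hxz with h3 | h3 <;> first | omega | skip
  · obtain ⟨bd, X, Y, Z, B, h, hB, hX, hY, hZ, hm⟩ := exists_isCoarse_of_lt hβ h1 h2 hz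
    exact ⟨bd, X, Y, Z, B, h, hB, hX, hY, hZ, hm.1⟩
  · obtain ⟨bd, X, Y, Z, B, h, hB, hX, hY, hZ, hm⟩ := exists_isCoarse_of_lt hβ h3 h2 hy
    exact ⟨bd, X, Z, Y, B, h.of_subset (by simp), hB, hX, hZ, hY, hm.2.1⟩
  · obtain ⟨bd, X, Y, Z, B, h, hB, hX, hY, hZ, hm⟩ := exists_isCoarse_of_lt hβ h3 h1 hy
    exact ⟨bd, Y, Z, X, B, h.of_subset (by simp), hB, hY, hZ, hX, hm.2.2.2.1⟩
  · obtain ⟨bd, X, Y, Z, B, h, hB, hX, hY, hZ, hm⟩ := exists_isCoarse_of_lt hβ h1 h3 hz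
    exact ⟨bd, Y, X, Z, B, h.of_subset (by simp), hB, hY, hX, hZ, hm.2.2.1⟩
  · obtain ⟨bd, X, Y, Z, B, h, hB, hX, hY, hZ, hm⟩ := exists_isCoarse_of_lt hβ h2 h3 hx
    exact ⟨bd, Z, X, Y, B, h.of_subset (by simp), hB, hZ, hX, hY, hm.2.2.2.2.1⟩
  · obtain ⟨bd, X, Y, Z, B, h, hB, hX, hY, hZ, hm⟩ := exists_isCoarse_of_lt hβ h2 h1 hx
    exact ⟨bd, Z, Y, X, B, h.of_subset (by simp), hB, hZ, hY, hX, hm.2.2.2.2.2⟩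

lemma exists_isCoarse₂ {n β x y : ℕ} (hβ : β + 1 < n) (hx : x < n) (hy : y < n) (hxy : x ≠ y) :
    ∃ bd X Y B, IsCoarse n bd [X, Y] B ∧ bd B = β ∧ bd X = x ∧ bd Y = y ∧
      (X, Y, B) ∈ positions₂ := by
  have key : ∀ {x y : ℕ}, x < y → y < n → ∃ bd X Y B, IsCoarse n bd [X, Y] B ∧ bd B = β ∧
      bd X = x ∧ bd Y = y ∧ (X, Y, B) ∈ positions₂ ∧ (Y, X, B) ∈ positions₂ := by
    intro x y hxy hy
    rcases lt_or_ge β x with h | h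
    · refine ⟨bdOf β (β + 1) x y (n - 1) (n - 1) n, 3, 4, 1, ⟨monotone_bdOf (by omega) (by omega)
        (by omega) (by omega) (by omega) (by omega), rfl, by simp only [bdOf]; omega, rfl, rfl,
        by norm_num, by decide, by simp [bdOf]; omega⟩, rfl, rfl, rfl, by decide⟩
    rcases lt_or_ge β y with h' | h'
    · refine ⟨bdOf x β (β + 1) y (n - 1) (n - 1) n, 1, 4, 2, ⟨monotone_bdOf (by omega) (by omega)
        (by omega) (by omega) (by omega) (by omega), rfl, by simp only [bdOf]; omega, rfl, rfl,
        by norm_num, by decide, by simp [bdOf]; omega⟩, rfl, rfl, rfl, by decide⟩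
    · refine ⟨bdOf x y β (β + 1) (n - 1) (n - 1) n, 1, 2, 3, ⟨monotone_bdOf (by omega) (by omega)
        (by omega) (by omega) (by omega) (by omega), rfl, by simp only [bdOf]; omega, rfl, rfl,
        by norm_num, by decide, by simp [bdOf]; omega⟩, rfl, rfl, rfl, by decide⟩
  rcases lt_or_gt_of_ne hxy with h | h
  · obtain ⟨bd, X, Y, B, h, hB, hX, hY, hm⟩ := key h hy
    exact ⟨bd, X, Y, B, h, hB, hX, hY, hm.1⟩
  · obtain ⟨bd, X, Y, B, h, hB, hX, hY, hm⟩ := key h hx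
    exact ⟨bd, Y, X, B, h.of_subset (by simp), hB, hY, hX, hm.2⟩

variable {R : Type*} [CommRing R] {n : ℕ} [NeZero n]

lemma val_sub_succ_lt {A B : ZMod n} (h : A ≠ B) : (B - (A + 1)).val + 1 < n := by
  have h1 := ZMod.val_lt (B - (A + 1))
  have h2 : (B - (A + 1)).val + 1 ≠ n := by
    intro he
    have := congrArg (Nat.cast : ℕ → ZMod n) he
    simp at this
    exact h (by rw [eq_comm]; linear_combination this)
  omega

lemma IsCoarse.cast_last {bd : ℕ → ℕ} {st : List ℕ} {B : ℕ} (h : IsCoarse n bd st B)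
    (A : ZMod n) : A + 1 + (bd 6 : ZMod n) = A := by
  have := congrArg (Nat.cast : ℕ → ZMod n) h.last
  simp at this
  linear_combination this

lemma add_val_cast {a s : ZMod n} {m : ℕ} (h : m = (s - a).val) : a + (m : ZMod n) = s := by
  subst h; simp

/-- Three rows and a row `B`, cut at the row `A`. -/
lemma exists_isCoarse_zmod₃ {A B s₁ s₂ s₃ : ZMod n} (hAB : A ≠ B) (h₁₂ : s₁ ≠ s₂) (h₂₃ : s₂ ≠ s₃)
    (h₁₃ : s₁ ≠ s₃) : ∃ bd S₁ S₂ S₃ B', IsCoarse n bd [S₁, S₂, S₃] B' ∧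
      bd B' = (B - (A + 1)).val ∧
      A + 1 + (bd S₁ : ZMod n) = s₁ ∧ A + 1 + (bd S₂ : ZMod n) = s₂ ∧
      A + 1 + (bd S₃ : ZMod n) = s₃ ∧ (S₁, S₂, S₃, B') ∈ positions₃ := by
  have hne : ∀ {s t : ZMod n}, s ≠ t → (s - (A + 1)).val ≠ (t - (A + 1)).val :=
    fun h he => h (sub_left_injective (ZMod.val_injective n he))
  obtain ⟨bd, S₁, S₂, S₃, B', h, hB, e₁, e₂, e₃, hm⟩ := exists_isCoarse₃ (val_sub_succ_lt hAB)
    (ZMod.val_lt (s₁ - (A + 1))) (ZMod.val_lt (s₂ - (A + 1))) (ZMod.val_lt (s₃ - (A + 1)))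
    (hne h₁₂) (hne h₂₃) (hne h₁₃)
  exact ⟨bd, S₁, S₂, S₃, B', h, hB, add_val_cast e₁, add_val_cast e₂,
    add_val_cast e₃, hm⟩

/-- Two rows and a row `B`, cut at the row `A`. -/
lemma exists_isCoarse_zmod₂ {A B s₁ s₂ : ZMod n} (hAB : A ≠ B) (h₁₂ : s₁ ≠ s₂) :
    ∃ bd S₁ S₂ B', IsCoarse n bd [S₁, S₂] B' ∧ bd B' = (B - (A + 1)).val ∧
      A + 1 + (bd S₁ : ZMod n) = s₁ ∧ A + 1 + (bd S₂ : ZMod n) = s₂ ∧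
      (S₁, S₂, B') ∈ positions₂ := by
  have hne : ∀ {s t : ZMod n}, s ≠ t → (s - (A + 1)).val ≠ (t - (A + 1)).val :=
    fun h he => h (sub_left_injective (ZMod.val_injective n he))
  obtain ⟨bd, S₁, S₂, B', h, hB, e₁, e₂, hm⟩ := exists_isCoarse₂ (val_sub_succ_lt hAB)
    (ZMod.val_lt (s₁ - (A + 1))) (ZMod.val_lt (s₂ - (A + 1))) (hne h₁₂)
  exact ⟨bd, S₁, S₂, B', h, hB, add_val_cast e₁, add_val_cast e₂, hm⟩

/-- The special columns `3` and `4` have no markings in the rows strictly between `A` and `B`, and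
strictly between `B` and `A`, respectively. -/
structure IsDrawn (C : ℕ → ZMod n → R) (A B : ZMod n) : Prop where
  ne : A ≠ B
  west : ∀ l, (l - (A + 1)).val < (B - (A + 1)).val → C 3 l = 1
  east : ∀ l, l ≠ A → (B - (A + 1)).val < (l - (A + 1)).val → C 4 l = 1

variable {C : ℕ → ZMod n → R} {A B : ZMod n}

lemma IsDrawn.sqVal_eq_one (hd : IsDrawn C A B) {bd : ℕ → ℕ} {st : List ℕ} {B' : ℕ}
    (h : IsCoarse n bd st B') (hB : bd B' = (B - (A + 1)).val) :
    ∀ s ∈ emptySquares B', sqVal (blockVal C bd (A + 1)) s = 1 := by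
  have hn := h.last
  have hval : ∀ l, l < n → (A + 1 + (l : ZMod n) - (A + 1)).val = l := fun l hl => by
    rw [add_sub_cancel_left, ZMod.val_cast_of_lt hl]
  intro s hs
  rcases List.mem_append.1 hs with hs | hs
  · obtain ⟨b, hb, rfl⟩ := List.mem_map.1 hs
    rw [sqVal_code _ (by norm_num), blockVal]
    refine prod_eq_one fun l hl => hd.west _ ?_
    have h1 := h.mono (show b + 1 ≤ B' by simpa using hb)
    have h2 := h.mono h.turn_lt.le
    rw [mem_Ico] at hl
    rw [hval l (by omega), ← hB]
    omega
  · obtain ⟨b, hb, rfl⟩ := List.mem_map.1 hs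
    have hb' : B' + 1 ≤ b ∧ b ≤ 5 := by
      have := h.turn_lt
      rw [List.mem_range'_1] at hb; omega
    rw [sqVal_code _ (by norm_num), blockVal]
    refine prod_eq_one fun l hl => ?_
    have h1 := h.mono hb'.1
    have h2 := h.mono (show b + 1 ≤ 6 by omega)
    have h3 := h.turn
    rw [mem_Ico] at hl
    refine hd.east _ (fun he => ?_) (by rw [hval l (by omega), ← hB]; omega)
    have h4 := hval l (by omega)
    have h5 := hval (bd 6) (by omega)
    rw [he] at h4
    rw [h.cast_last A] at h5
    omega

variable (h2 : ∀ x : R, x + x = 0)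
include h2

/-- The contributions to the chain map relation of polygons with corners on the special column and two
other columns cancel. Going east from the special column, the first of the other columns is the one of
the first pentagon. -/
lemma chain_triple_east (hC : IsCols C [1, 3, 4]) (hAB : A ≠ B) {s₁ s₂ s₃ : ZMod n} (h₁₂ : s₁ ≠ s₂)
    (h₂₃ : s₂ ≠ s₃) (h₁₃ : s₁ ≠ s₃) :
    pentV C 4 3 [0] [1, 2] A s₁ s₂ * rectV C [1] [2, 3, 4, 0] s₁ s₃ +
      (rectV C [1] [2, 3, 4, 0] s₂ s₃ * pentV C 4 3 [0, 1] [2] A s₁ s₂ +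
      (pentV C 4 3 [0, 1] [2] A s₁ s₃ * rectV C [3, 0] [4, 1, 2] s₃ s₂ +
      rectV C [4, 0, 1] [3, 2] s₁ s₃ * pentV C 4 3 [0] [1, 2] A s₃ s₂)) = 0 := by
  obtain ⟨bd, S₁, S₂, S₃, B', h, hB, rfl, rfl, rfl, hm⟩ :=
    exists_isCoarse_zmod₃ hAB h₁₂ h₂₃ h₁₃
  have key := sumEval_eq_zero (a := A + 1) h2 h (by simp) hC (by simp)
    (reduceSum_chainL_east _ hm)
  simp only [chainL, sumEval_append, sumEval_prods] at key
  rw [sumEval_pentL_last h (by simp) (by simp) (by simp), sumEval_rectL h (by simp) (by simp)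
    (by simp), sumEval_rectL h (by simp) (by simp) (by simp), sumEval_pentL_last h (by simp)
    (by simp) (by simp), sumEval_pentL_last h (by simp) (by simp) (by simp), sumEval_rectL h
    (by simp) (by simp) (by simp), sumEval_rectL h (by simp) (by simp) (by simp),
    sumEval_pentL_last h (by simp) (by simp) (by simp), h.cast_last] at key
  exact key

/-- The contributions to the chain map relation of polygons with corners on the special column and two
other columns cancel. Going east from the special column, the first of the other columns is the one of
the last pentagon. -/
lemma chain_triple_west (hC : IsCols C [1, 3, 4]) (hAB : A ≠ B) {s₁ s₂ s₃ : ZMod n} (h₁₂ : s₁ ≠ s₂)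
    (h₂₃ : s₂ ≠ s₃) (h₁₃ : s₁ ≠ s₃) :
    pentV C 4 3 [0, 1] [2] A s₁ s₂ * rectV C [2, 3, 4, 0] [1] s₁ s₃ +
      (rectV C [2, 3, 4, 0] [1] s₂ s₃ * pentV C 4 3 [0] [1, 2] A s₁ s₂ +
      (pentV C 4 3 [0] [1, 2] A s₁ s₃ * rectV C [3, 0, 1] [4, 2] s₃ s₂ +
      rectV C [4, 0] [3, 1, 2] s₁ s₃ * pentV C 4 3 [0, 1] [2] A s₃ s₂)) = 0 := by
  obtain ⟨bd, S₁, S₂, S₃, B', h, hB, rfl, rfl, rfl, hm⟩ :=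
    exists_isCoarse_zmod₃ hAB h₁₂ h₂₃ h₁₃
  have key := sumEval_eq_zero (a := A + 1) h2 h (by simp) hC (by simp)
    (reduceSum_chainL_west _ hm)
  simp only [chainL, sumEval_append, sumEval_prods] at key
  rw [sumEval_pentL_last h (by simp) (by simp)
    (by simp), sumEval_rectL h (by simp) (by simp)
    (by simp), sumEval_rectL h (by simp) (by simp)
    (by simp), sumEval_pentL_last h (by simp) (by simp)
    (by simp), sumEval_pentL_last h (by simp) (by simp)
    (by simp), sumEval_rectL h (by simp) (by simp)
    (by simp), sumEval_rectL h (by simp) (by simp)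
    (by simp), sumEval_pentL_last h (by simp) (by simp)
    (by simp), h.cast_last] at key
  exact key

/-- The contributions to the homotopy relation of polygons with corners on the special column and two
other columns cancel, with the columns in the order of `chain_triple_east`. -/
lemma homotopy_triple_east (hC : IsCols C [1, 3, 4]) (hd : IsDrawn C A B) {s₁ s₂ s₃ : ZMod n} (h₁₂ : s₁ ≠ s₂)
    (h₂₃ : s₂ ≠ s₃) (h₁₃ : s₁ ≠ s₃) :
    hexV C 4 3 [0] [1, 2] A B s₁ s₂ * rectV C [1] [2, 3, 4, 0] s₁ s₃ +
      (rectV C [1] [2, 3, 4, 0] s₂ s₃ * hexV C 4 3 [0, 1] [2] A B s₁ s₂ +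
      (hexV C 4 3 [0, 1] [2] A B s₁ s₃ * rectV C [4, 0] [3, 1, 2] s₃ s₂ +
      (rectV C [4, 0, 1] [3, 2] s₁ s₃ * hexV C 4 3 [0] [1, 2] A B s₃ s₂ +
      pentV C 4 3 [0, 1] [2] A s₁ s₃ * pentV C 3 4 [0] [1, 2] B s₃ s₂))) = 0 := by
  obtain ⟨bd, S₁, S₂, S₃, B', h, hB, rfl, rfl, rfl, hm⟩ :=
    exists_isCoarse_zmod₃ hd.ne h₁₂ h₂₃ h₁₃
  have key := sumEval_eq_zero (a := A + 1) h2 h (by simp) hC (hd.sqVal_eq_one h hB)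
    (reduceSum_homotopyL_east _ hm)
  simp only [homotopyL, sumEval_append, sumEval_prods] at key
  rw [sumEval_hexL h (by simp) (by simp)
    (by simp), sumEval_rectL h (by simp) (by simp)
    (by simp), sumEval_rectL h (by simp) (by simp)
    (by simp), sumEval_hexL h (by simp) (by simp)
    (by simp), sumEval_hexL h (by simp) (by simp)
    (by simp), sumEval_rectL h (by simp) (by simp)
    (by simp), sumEval_rectL h (by simp) (by simp)
    (by simp), sumEval_hexL h (by simp) (by simp)
    (by simp), sumEval_pentL_last h (by simp) (by simp)
    (by simp), sumEval_pentL h (by simp) (by simp)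
    (by simp), h.cast_last, add_val_cast hB] at key
  exact key

/-- The contributions to the homotopy relation of polygons with corners on the special column and two
other columns cancel, with the columns in the order of `chain_triple_west`. -/
lemma homotopy_triple_west (hC : IsCols C [1, 3, 4]) (hd : IsDrawn C A B) {s₁ s₂ s₃ : ZMod n} (h₁₂ : s₁ ≠ s₂)
    (h₂₃ : s₂ ≠ s₃) (h₁₃ : s₁ ≠ s₃) :
    hexV C 4 3 [0, 1] [2] A B s₁ s₂ * rectV C [2, 3, 4, 0] [1] s₁ s₃ +
      (rectV C [2, 3, 4, 0] [1] s₂ s₃ * hexV C 4 3 [0] [1, 2] A B s₁ s₂ +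
      (hexV C 4 3 [0] [1, 2] A B s₁ s₃ * rectV C [4, 0, 1] [3, 2] s₃ s₂ +
      (rectV C [4, 0] [3, 1, 2] s₁ s₃ * hexV C 4 3 [0, 1] [2] A B s₃ s₂ +
      pentV C 4 3 [0] [1, 2] A s₁ s₃ * pentV C 3 4 [0, 1] [2] B s₃ s₂))) = 0 := by
  obtain ⟨bd, S₁, S₂, S₃, B', h, hB, rfl, rfl, rfl, hm⟩ :=
    exists_isCoarse_zmod₃ hd.ne h₁₂ h₂₃ h₁₃
  have key := sumEval_eq_zero (a := A + 1) h2 h (by simp) hC (hd.sqVal_eq_one h hB)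
    (reduceSum_homotopyL_west _ hm)
  simp only [homotopyL, sumEval_append, sumEval_prods] at key
  rw [sumEval_hexL h (by simp) (by simp)
    (by simp), sumEval_rectL h (by simp) (by simp)
    (by simp), sumEval_rectL h (by simp) (by simp)
    (by simp), sumEval_hexL h (by simp) (by simp)
    (by simp), sumEval_hexL h (by simp) (by simp)
    (by simp), sumEval_rectL h (by simp) (by simp)
    (by simp), sumEval_rectL h (by simp) (by simp)
    (by simp), sumEval_hexL h (by simp) (by simp)
    (by simp), sumEval_pentL_last h (by simp) (by simp)
    (by simp), sumEval_pentL h (by simp) (by simp)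
    (by simp), h.cast_last, add_val_cast hB] at key
  exact key

omit h2 in
lemma sqVal_wholeCol_one {bd : ℕ → ℕ} {a : ZMod n} (h1 : ∀ l, C 1 l = 1) :
    ∀ s ∈ wholeCol 1, sqVal (blockVal C bd a) s = 1 := by
  intro s hs
  obtain ⟨b, -, rfl⟩ := List.mem_map.1 hs
  rw [sqVal_code _ (by norm_num), blockVal, prod_eq_one (fun l _ => h1 _)]

/-- The contributions to the chain map relation of polygons that exchange the points of the special
column and of one other column twice add up to two vertical annuli. -/
lemma chain_loop (hC : IsCols C [3, 4]) (h1 : ∀ l, C 1 l = 1) (hAB : A ≠ B) {s t : ZMod n}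
    (hst : s ≠ t) :
    pentV C 4 3 [0] [2] A s t * rectV C [3, 0] [4, 2] t s +
      rectV C [4, 0] [3, 2] s t * pentV C 4 3 [0] [2] A t s =
    turn (colP C [4, 0]) (colP C [0]) (colP C [3, 0]) A s s +
      turn (colP C [4, 2]) (colP C [2]) (colP C [3, 2]) A s s := by
  obtain ⟨bd, S, T, B', h, hB, rfl, rfl, hm⟩ := exists_isCoarse_zmod₂ hAB hst
  have hS6 := h.st_le S (by simp)
  have key := sumEval_eq_zero (a := A + 1) h2 h (by simp) hC (sqVal_wholeCol_one h1)
    (reduceSum_chainLoopL _ hm)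
  simp only [chainLoopL, sumEval_append, sumEval_prods] at key
  rw [sumEval_pentL_last h (by simp) (by simp) (by simp), sumEval_rectL h (by simp) (by simp)
    (by simp), sumEval_rectL h (by simp) (by simp) (by simp), sumEval_pentL_last h (by simp)
    (by simp) (by simp)] at key
  simp only [sumEval, List.map_cons, List.map_nil, List.sum_cons, List.sum_nil, add_zero] at key
  rw [evalSq_turnL h (by simp) h.turn_last le_rfl hS6 hS6 (h.compat_last hS6) (h.last_compat hS6),
    evalSq_turnL h (by simp) h.turn_last le_rfl hS6 hS6 (h.compat_last hS6) (h.last_compat hS6),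
    h.cast_last] at key
  linear_combination key - h2 (turn (colP C [4, 0]) (colP C [0]) (colP C [3, 0]) A
    (A + 1 + (bd S : ZMod n)) (A + 1 + (bd S : ZMod n)) + turn (colP C [4, 2]) (colP C [2])
    (colP C [3, 2]) A (A + 1 + (bd S : ZMod n)) (A + 1 + (bd S : ZMod n)))

/-- The contributions to the homotopy relation of polygons that exchange the points of the special
column and of one other column twice add up to two vertical annuli. -/
lemma homotopy_loop (hC : IsCols C [3, 4]) (h1 : ∀ l, C 1 l = 1) (hd : IsDrawn C A B)
    {s t : ZMod n} (hst : s ≠ t) :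
    hexV C 4 3 [0] [2] A B s t * rectV C [4, 0] [3, 2] t s +
      rectV C [4, 0] [3, 2] s t * hexV C 4 3 [0] [2] A B t s +
      pentV C 4 3 [0] [2] A s t * pentV C 3 4 [0] [2] B t s =
    twoTurn (colP C [4, 0]) (colP C [0]) (colP C [3, 0]) A B s s +
      twoTurn (colP C [3, 2]) (colP C [2]) (colP C [4, 2]) B A s s := by
  obtain ⟨bd, S, T, B', h, hB, rfl, rfl, hm⟩ := exists_isCoarse_zmod₂ hd.ne hst
  have hS6 := h.st_le S (by simp)
  have hB6 := h.turn_lt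
  have key := sumEval_eq_zero (a := A + 1) h2 h (by simp) hC (fun s hs =>
    (List.mem_append.1 hs).elim (hd.sqVal_eq_one h hB s) (sqVal_wholeCol_one h1 s))
    (reduceSum_homotopyLoopL _ hm)
  simp only [homotopyLoopL, sumEval_append, sumEval_prods] at key
  rw [sumEval_hexL h (by simp) (by simp) (by simp), sumEval_rectL h (by simp) (by simp)
    (by simp), sumEval_rectL h (by simp) (by simp) (by simp), sumEval_hexL h (by simp)
    (by simp) (by simp), sumEval_pentL_last h (by simp) (by simp) (by simp), sumEval_pentL h
    (by simp) (by simp) (by simp)] at key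
  simp only [sumEval, List.map_cons, List.map_nil, List.sum_cons, List.sum_nil, add_zero] at key
  rw [evalSq_twoTurnL h (by simp) h.turn_last h.turn le_rfl hB6.le hS6 hS6 (h.compat_last hS6)
      (h.last_compat hB6.le) (h.turn_compat S),
    evalSq_twoTurnL h (by simp) h.turn h.turn_last hB6.le le_rfl hS6 hS6 (h.compat_turn S)
      (h.compat_last (by omega)) (h.last_compat hS6), h.cast_last, add_val_cast hB] at key
  linear_combination key - h2 (twoTurn (colP C [4, 0]) (colP C [0]) (colP C [3, 0]) A B
    (A + 1 + (bd S : ZMod n)) (A + 1 + (bd S : ZMod n)) + twoTurn (colP C [3, 2]) (colP C [2])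
    (colP C [4, 2]) B A (A + 1 + (bd S : ZMod n)) (A + 1 + (bd S : ZMod n)))

end Local

/-! ### Compositions of polygon counts -/

section Compose

variable {R : Type*} [CommRing R] {n : ℕ} [NeZero n]

/-- An operator on functions of grid states that sums over the exchanges of the point in column `c`
with the point in another column `i`, with weights that depend on the rows of these two points. -/
def crossOp (c : ZMod n) (φ : ZMod n → ZMod n → ZMod n → R) (f : GridState n → R)
    (x : GridState n) : R :=
  ∑ i ∈ univ.erase c, φ i (x c) (x i) * f (x * Equiv.swap i c)

/-- The analogous operator that sums over the exchanges of two points outside of column `c`. -/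
def awayOp (c : ZMod n) (ρ : ZMod n → ZMod n → ZMod n → ZMod n → R) (f : GridState n → R)
    (x : GridState n) : R :=
  ∑ p ∈ (univ.erase c).offDiag, ρ p.1 p.2 (x p.1) (x p.2) * f (x * Equiv.swap p.1 p.2)

lemma sum_offDiag_swap {α : Type*} [DecidableEq α] (s : Finset α) (g : α × α → R) :
    ∑ p ∈ s.offDiag, g p.swap = ∑ p ∈ s.offDiag, g p :=
  sum_nbij' Prod.swap Prod.swap (by simp; tauto) (by simp; tauto) (by simp) (by simp) (by simp)

lemma sum_sum_eq_diag_add_offDiag {α : Type*} [DecidableEq α] (s : Finset α) (g : α → α → R) :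
    ∑ k ∈ s, ∑ i ∈ s, g k i = ∑ i ∈ s, g i i + ∑ p ∈ s.offDiag, g p.2 p.1 := by
  rw [← sum_product', ← diag_union_offDiag, sum_union (disjoint_diag_offDiag _), sum_diag,
    ← sum_offDiag_swap s (fun p => g p.1 p.2)]
  rfl

lemma swap_mul_swap_left {α : Type*} [DecidableEq α] {c i k : α} (hic : i ≠ c) (hkc : k ≠ c)
    (hik : i ≠ k) : Equiv.swap i k * Equiv.swap k c = Equiv.swap i c * Equiv.swap i k := by
  ext m
  simp only [Equiv.Perm.mul_apply, Equiv.swap_apply_def]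
  split_ifs <;> simp_all

lemma swap_mul_swap_right {α : Type*} [DecidableEq α] {c i k : α} (hic : i ≠ c) (hkc : k ≠ c)
    (hik : i ≠ k) : Equiv.swap k c * Equiv.swap i c = Equiv.swap i c * Equiv.swap i k := by
  ext m
  simp only [Equiv.Perm.mul_apply, Equiv.swap_apply_def]
  split_ifs <;> simp_all

lemma swap_mul_swap_comm {α : Type*} [DecidableEq α] {c i j k : α} (hic : i ≠ c) (hjc : j ≠ c)
    (hik : i ≠ k) (hjk : j ≠ k) :
    Equiv.swap i j * Equiv.swap k c = Equiv.swap k c * Equiv.swap i j := by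
  ext m
  simp only [Equiv.Perm.mul_apply, Equiv.swap_apply_def]
  split_ifs <;> simp_all

variable (c : ZMod n)

/-- The composition of two exchanges with column `c` either exchanges the same points twice, or
permutes the points of `c` and two other columns cyclically. -/
lemma crossOp_crossOp (φ ψ : ZMod n → ZMod n → ZMod n → R) (f : GridState n → R)
    (x : GridState n) :
    crossOp c φ (crossOp c ψ f) x =
      (∑ i ∈ univ.erase c, φ i (x c) (x i) * ψ i (x i) (x c)) * f x +
      ∑ p ∈ (univ.erase c).offDiag, φ p.2 (x c) (x p.2) * ψ p.1 (x p.2) (x p.1) *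
        f (x * (Equiv.swap p.1 c * Equiv.swap p.1 p.2)) := by
  simp only [crossOp, mul_sum]
  rw [sum_sum_eq_diag_add_offDiag, sum_mul]
  congr 1
  · refine sum_congr rfl fun i hi => ?_
    simp [mul_assoc]
  · refine sum_congr rfl fun p hp => ?_
    obtain ⟨h1, h2, h3⟩ := mem_offDiag.1 hp
    have h1 := ne_of_mem_erase h1
    have h2 := ne_of_mem_erase h2
    rw [mul_assoc x, swap_mul_swap_right h1 h2 h3]
    simp [Equiv.swap_apply_of_ne_of_ne h3 h1, mul_assoc]

/-- Polygons with corners on four different columns cancel, so that only those with corners on the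
column `c` and two other columns remain. -/
lemma awayOp_crossOp_add (h2 : ∀ a : R, a + a = 0)
    (ρ : ZMod n → ZMod n → ZMod n → ZMod n → R) (φ : ZMod n → ZMod n → ZMod n → R)
    (f : GridState n → R) (x : GridState n) :
    awayOp c ρ (crossOp c φ f) x + crossOp c φ (awayOp c ρ f) x =
      ∑ p ∈ (univ.erase c).offDiag,
        (φ p.1 (x c) (x p.1) * (ρ p.1 p.2 (x c) (x p.2) + ρ p.2 p.1 (x p.2) (x c)) +
          (ρ p.1 p.2 (x p.1) (x p.2) + ρ p.2 p.1 (x p.2) (x p.1)) * φ p.2 (x c) (x p.1)) *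
        f (x * (Equiv.swap p.1 c * Equiv.swap p.1 p.2)) := by
  set J := univ.erase c with hJ
  let a : ZMod n × ZMod n → ZMod n → R := fun p k =>
    ρ p.1 p.2 (x p.1) (x p.2) * (φ k ((x * Equiv.swap p.1 p.2) c) ((x * Equiv.swap p.1 p.2) k) *
      f (x * Equiv.swap p.1 p.2 * Equiv.swap k c))
  let b : ZMod n × ZMod n → ZMod n → R := fun p k =>
    φ k (x c) (x k) * (ρ p.1 p.2 ((x * Equiv.swap k c) p.1) ((x * Equiv.swap k c) p.2) *
      f (x * Equiv.swap k c * Equiv.swap p.1 p.2))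
  have e1 : awayOp c ρ (crossOp c φ f) x = ∑ p ∈ J.offDiag, ∑ k ∈ J, a p k := by
    simp only [awayOp, crossOp, mul_sum, ← hJ, a]
  have e2 : crossOp c φ (awayOp c ρ f) x = ∑ p ∈ J.offDiag, ∑ k ∈ J, b p k := by
    simp only [awayOp, crossOp, mul_sum, ← hJ, b]
    rw [sum_comm]
  have e3 : ∀ p ∈ J.offDiag, ∑ k ∈ J, (a p k + b p k) =
      (a p p.1 + b p p.1) + (a p p.2 + b p p.2) := by
    intro p hp
    obtain ⟨h1, h2', h3⟩ := mem_offDiag.1 hp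
    rw [← sum_pair (f := fun k => a p k + b p k) h3]
    refine (sum_subset (by intro k hk; simp at hk; rcases hk with rfl | rfl <;> assumption)
      fun k hk hk' => ?_).symm
    simp only [mem_insert, mem_singleton, not_or] at hk'
    have h1 := ne_of_mem_erase h1
    have h2' := ne_of_mem_erase h2'
    have h4 := ne_of_mem_erase hk
    simp only [a, b]
    rw [mul_assoc x, mul_assoc x, swap_mul_swap_comm h1 h2' (Ne.symm hk'.1) (Ne.symm hk'.2)]
    simp only [Equiv.Perm.mul_apply, Equiv.swap_apply_of_ne_of_ne h1.symm h2'.symm,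
      Equiv.swap_apply_of_ne_of_ne hk'.1 hk'.2, Equiv.swap_apply_of_ne_of_ne (Ne.symm hk'.1) h1,
      Equiv.swap_apply_of_ne_of_ne (Ne.symm hk'.2) h2']
    rw [mul_left_comm]
    exact h2 _
  rw [e1, e2, ← sum_add_distrib]
  simp only [← sum_add_distrib]
  rw [sum_congr rfl e3]
  have e4 : ∑ p ∈ J.offDiag, ((a p p.1 + b p p.1) + (a p p.2 + b p p.2)) =
      ∑ p ∈ J.offDiag, (b p p.1 + b p.swap p.1 + (a p p.2 + a p.swap p.2)) := by
    have s1 := sum_offDiag_swap J (fun p => a p p.1)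
    have s2 := sum_offDiag_swap J (fun p => b p p.2)
    simp only [Prod.fst_swap, Prod.snd_swap] at s1 s2
    simp only [sum_add_distrib]
    rw [s1, s2]
    ring
  rw [e4]
  refine sum_congr rfl fun p hp => ?_
  obtain ⟨h1, h2', h3⟩ := mem_offDiag.1 hp
  have h1 := ne_of_mem_erase h1
  have h2' := ne_of_mem_erase h2'
  simp only [a, b, Prod.fst_swap, Prod.snd_swap]
  rw [mul_assoc x, mul_assoc x, mul_assoc x, mul_assoc x, Equiv.swap_comm p.2 p.1,
    swap_mul_swap_left h1 h2' h3]
  simp only [Equiv.Perm.mul_apply, Equiv.swap_apply_of_ne_of_ne h1.symm h2'.symm,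
    Equiv.swap_apply_left, Equiv.swap_apply_right, Equiv.swap_apply_of_ne_of_ne h3.symm h2']
  ring

end Compose

/-! ### The relations for functions of grid states -/

section Relations

variable {R : Type*} [CommRing R] {n : ℕ} [NeZero n]

/-- The rows of the columns `[i, j)`, merged into one column. -/
def arc (F : ZMod n → ZMod n → R) (i j l : ZMod n) : R := run (fun k => F k l) i j

/-- The values of the squares of a grid diagram at `v = 1`: in each row and in each column there is an
`X`-marking, where the value is zero. -/
structure IsGridVal (F : ZMod n → ZMod n → R) : Prop where
  col : ∀ k, ∏ l, F k l = 0
  row : ∀ l, ∏ k, F k l = 0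

/-- The values for the diagram with columns `c - 1` and `c` interchanged. -/
def swapVal (F : ZMod n → ZMod n → R) (c k : ZMod n) : ZMod n → R := F (Equiv.swap (c - 1) c k)

/-- The weights of the rectangles that exchange the point in row `s` of column `c` and the point in row
`t` of column `i`. -/
def rectW (F : ZMod n → ZMod n → R) (c i s t : ZMod n) : R :=
  run (arc F c i) s t + run (arc F i c) t s

/-- The weight of the rectangle from column `i` to column `j`. -/
def rectAway (F : ZMod n → ZMod n → R) (i j s t : ZMod n) : R := run (arc F i j) s t

/-- The weights of the pentagons with a turn in row `A` that exchange the point in row `s` of column `c`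
and the point in row `t` of column `i`. -/
def pentW (F : ZMod n → ZMod n → R) (c A i s t : ZMod n) : R :=
  turn (fun l => F c l * arc F (c + 1) i l) (arc F (c + 1) i)
      (fun l => F (c - 1) l * arc F (c + 1) i l) A s t +
    turn (fun l => F c l * arc F i (c - 1) l) (arc F i (c - 1))
      (fun l => F (c - 1) l * arc F i (c - 1) l) A t s

/-- The weights of the hexagons with turns in the rows `A` and `B` that exchange the point in row `s` of
column `c` and the point in row `t` of column `i`. -/
def hexW (F : ZMod n → ZMod n → R) (c A B i s t : ZMod n) : R :=
  twoTurn (fun l => F c l * arc F (c + 1) i l) (arc F (c + 1) i)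
      (fun l => F (c - 1) l * arc F (c + 1) i l) A B s t +
    twoTurn (fun l => F (c - 1) l * arc F i (c - 1) l) (arc F i (c - 1))
      (fun l => F c l * arc F i (c - 1) l) B A t s

variable {F : ZMod n → ZMod n → R} {c : ZMod n}

/-- Columns are counted eastwards from the special column `c`. -/
lemma exists_natCast_add {i : ZMod n} (h : i ≠ c) : ∃ a : ℕ, 0 < a ∧ a < n ∧ i = c + (a : ZMod n) := by
  refine ⟨(i - c).val, ?_, ZMod.val_lt _, by simp⟩
  rw [Nat.pos_iff_ne_zero, Ne, ZMod.val_eq_zero, sub_eq_zero]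
  exact h

lemma add_natCast_sub_one (c : ZMod n) : c + ((n - 1 : ℕ) : ZMod n) = c - 1 := by
  have : 1 ≤ n := NeZero.one_le
  rw [Nat.cast_sub this]; simp; ring

section Arcs

variable {a b : ℕ}

lemma arc_eq (h : a ≤ b) (hb : b < n + a) (l : ZMod n) :
    arc F (c + (a : ZMod n)) (c + (b : ZMod n)) l = ∏ k ∈ Ico a b, F (c + (k : ZMod n)) l :=
  run_add_natCast _ c h hb

lemma arc_succ_eq (h : 1 ≤ b) (hb : b ≤ n) (l : ZMod n) :
    arc F (c + 1) (c + (b : ZMod n)) l = ∏ k ∈ Ico 1 b, F (c + (k : ZMod n)) l := by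
  simpa using arc_eq (F := F) (c := c) h (by omega) l

lemma arc_pred_eq (ha : a < n) (l : ZMod n) :
    arc F (c + (a : ZMod n)) (c - 1) l = ∏ k ∈ Ico a (n - 1), F (c + (k : ZMod n)) l := by
  rw [← add_natCast_sub_one, arc_eq (by omega) (by omega)]

lemma arc_from_eq (hb : b < n) (l : ZMod n) :
    arc F c (c + (b : ZMod n)) l = ∏ k ∈ Ico 0 b, F (c + (k : ZMod n)) l := by
  simpa using arc_eq (F := F) (c := c) (Nat.zero_le b) (by omega) l

lemma arc_to_eq (h0 : 0 < a) (ha : a < n) (l : ZMod n) :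
    arc F (c + (a : ZMod n)) c l = ∏ k ∈ Ico a n, F (c + (k : ZMod n)) l := by
  simpa using arc_eq (F := F) (c := c) ha.le (by omega) l

lemma arc_around_eq (h : a < b) (hb : b < n) (l : ZMod n) :
    arc F (c + (b : ZMod n)) (c + (a : ZMod n)) l =
      (∏ k ∈ Ico b n, F (c + (k : ZMod n)) l) * ∏ k ∈ Ico 0 a, F (c + (k : ZMod n)) l :=
  run_add_natCast' _ c h hb.le

end Arcs

/-- The five merged columns of which the polygons with corners on the columns `c`, `i` and `k` consist.
-/
def colsOf (F : ZMod n → ZMod n → R) (c i k : ZMod n) : ℕ → ZMod n → R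
  | 0 => arc F (c + 1) i
  | 1 => arc F i k
  | 2 => arc F k (c - 1)
  | 3 => F (c - 1)
  | _ => F c

/-- A nonempty union of columns contains an `X`-marking. -/
lemma prod_arc_eq_zero (hF : IsGridVal F) {i k : ZMod n} (h : i ≠ k) : ∏ l, arc F i k l = 0 := by
  have : ∀ l, arc F i k l = F i l * arc F (i + 1) k l := fun l => run_succ _ h
  simp only [this, prod_mul_distrib, hF.col, zero_mul]

lemma prod_arc_eq_zero_or (hF : IsGridVal F) (i k : ZMod n) :
    (∏ l, arc F i k l = 0) ∨ ∀ l, arc F i k l = 1 := by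
  by_cases h : i = k
  · subst h; exact Or.inr fun l => run_self _ _
  · exact Or.inl (prod_arc_eq_zero hF h)

lemma prod_split {a b m : ℕ} (g : ℕ → R) (h0 : 0 < a) (hab : a ≤ b) (hb : b ≤ m) :
    ∏ k ∈ Ico 0 (m + 1), g k =
      g 0 * ((∏ k ∈ Ico 1 a, g k) * ((∏ k ∈ Ico a b, g k) * ((∏ k ∈ Ico b m, g k) * g m))) := by
  rw [← prod_Ico_succ_top hb, prod_Ico_consecutive _ hab (by omega),
    prod_Ico_consecutive _ (by omega : 1 ≤ a) (by omega), ← prod_eq_prod_Ico_succ_bot (by omega)]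

lemma isCols_colsOf (hF : IsGridVal F) {a b : ℕ} (h0 : 0 < a) (hab : a < b) (hb : b < n) :
    IsCols (colsOf F c (c + (a : ZMod n)) (c + (b : ZMod n))) [1, 3, 4] where
  row l := by
    simp only [colsOf]
    rw [arc_succ_eq (by omega) (by omega), arc_eq hab.le (by omega), arc_pred_eq hb,
      ← hF.row l, ← prod_range_add_cast (fun k => F k l) c]
    have := prod_split (fun k => F (c + (k : ZMod n)) l) h0 hab.le (show b ≤ n - 1 by omega)
    rw [show n - 1 + 1 = n by omega, add_natCast_sub_one, Nat.cast_zero, add_zero] at this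
    rw [← Nat.Ico_zero_eq_range, this]
    ring
  col k hk := by
    have hne : c + (a : ZMod n) ≠ c + (b : ZMod n) := by
      intro h
      have h := congrArg ZMod.val (add_left_cancel h)
      rw [ZMod.val_cast_of_lt (by omega), ZMod.val_cast_of_lt hb] at h
      omega
    simp only [List.mem_cons, List.not_mem_nil, or_false] at hk
    rcases hk with rfl | rfl | rfl
    · exact prod_arc_eq_zero hF hne
    · exact hF.col _
    · exact hF.col _
  idem k hk := by
    simp only [List.mem_cons, List.not_mem_nil, or_false] at hk
    rcases hk with rfl | rfl <;> exact prod_arc_eq_zero_or hF _ _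

lemma swapVal_of_ne (F : ZMod n → ZMod n → R) {k : ZMod n} (h1 : k ≠ c - 1) (h2 : k ≠ c) :
    swapVal F c k = F k := by rw [swapVal, Equiv.swap_apply_of_ne_of_ne h1 h2]

lemma swapVal_self (F : ZMod n → ZMod n → R) : swapVal F c c = F (c - 1) := by simp [swapVal]

lemma swapVal_pred (F : ZMod n → ZMod n → R) : swapVal F c (c - 1) = F c := by simp [swapVal]

lemma natCast_add_ne {a : ℕ} (h0 : 0 < a) (ha : a + 1 < n) :
    c + (a : ZMod n) ≠ c - 1 ∧ c + (a : ZMod n) ≠ c := by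
  constructor
  · rw [← add_natCast_sub_one]
    intro h
    have h := congrArg ZMod.val (add_left_cancel h)
    rw [ZMod.val_cast_of_lt (by omega), ZMod.val_cast_of_lt (by omega)] at h
    omega
  · intro h
    have h := congrArg ZMod.val (add_eq_left.1 h)
    rw [ZMod.val_cast_of_lt (by omega), ZMod.val_zero] at h
    omega

lemma prod_swapVal (F : ZMod n → ZMod n → R) {a b : ℕ} (h0 : 0 < a) (hb : b < n) (l : ZMod n) :
    ∏ k ∈ Ico a b, swapVal F c (c + (k : ZMod n)) l = ∏ k ∈ Ico a b, F (c + (k : ZMod n)) l := by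
  refine prod_congr rfl fun k hk => ?_
  rw [mem_Ico] at hk
  have := natCast_add_ne (c := c) (show 0 < k by omega) (by omega)
  rw [swapVal_of_ne F this.1 this.2]

section ColP

variable {a b : ℕ}

lemma colP_colsOf_fst (h0 : 0 < a) (hab : a < b) (hb : b < n) :
    colP (colsOf F c (c + (a : ZMod n)) (c + (b : ZMod n))) [0, 1] = arc F (c + 1) (c + (b : ZMod n)) := by
  funext l
  simp only [colP, colsOf, List.map_cons, List.map_nil, List.prod_cons, List.prod_nil, mul_one]
  rw [arc_succ_eq (by omega) (by omega), arc_eq hab.le (by omega),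
    arc_succ_eq (by omega) (by omega), prod_Ico_consecutive _ (by omega) hab.le]

lemma colP_colsOf_snd (hab : a < b) (hb : b < n) :
    colP (colsOf F c (c + (a : ZMod n)) (c + (b : ZMod n))) [1, 2] =
      arc F (c + (a : ZMod n)) (c - 1) := by
  funext l
  simp only [colP, colsOf, List.map_cons, List.map_nil, List.prod_cons, List.prod_nil, mul_one]
  rw [arc_pred_eq (by omega), arc_eq hab.le (by omega),
    arc_pred_eq (by omega), prod_Ico_consecutive _ (by omega) (by omega)]

lemma colP_cons (C : ℕ → ZMod n → R) (k : ℕ) (cols : List ℕ) :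
    colP C (k :: cols) = fun l => C k l * colP C cols l := by
  funext l; simp [colP]

lemma colP_singleton (C : ℕ → ZMod n → R) (k : ℕ) : colP C [k] = C k := by
  funext l; simp [colP]

lemma arc_from_eq_mul (h0 : 0 < a) (ha : a < n) (l : ZMod n) :
    arc F c (c + (a : ZMod n)) l = F c l * arc F (c + 1) (c + (a : ZMod n)) l := by
  rw [arc_from_eq ha, arc_succ_eq h0 ha.le, prod_eq_prod_Ico_succ_bot h0]
  simp

lemma arc_to_eq_mul (h0 : 0 < a) (ha : a < n) (l : ZMod n) :
    arc F (c + (a : ZMod n)) c l = F (c - 1) l * arc F (c + (a : ZMod n)) (c - 1) l := by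
  rw [arc_to_eq h0 ha, arc_pred_eq ha, mul_comm, ← add_natCast_sub_one]
  have := prod_Ico_succ_top (show a ≤ n - 1 by omega) (fun k => F (c + (k : ZMod n)) l)
  rwa [show n - 1 + 1 = n by omega] at this

lemma arc_succ_swapVal (h0 : 0 < a) (ha : a < n) (l : ZMod n) :
    arc (swapVal F c) (c + 1) (c + (a : ZMod n)) l = arc F (c + 1) (c + (a : ZMod n)) l := by
  rw [arc_succ_eq h0 ha.le, arc_succ_eq h0 ha.le, prod_swapVal F one_pos ha]

lemma arc_pred_swapVal (h0 : 0 < a) (ha : a < n) (l : ZMod n) :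
    arc (swapVal F c) (c + (a : ZMod n)) (c - 1) l = arc F (c + (a : ZMod n)) (c - 1) l := by
  rw [arc_pred_eq ha, arc_pred_eq ha, prod_swapVal F h0 (by omega)]

lemma arc_eq_swapVal (h0 : 0 < a) (hab : a < b) (hb : b < n) (l : ZMod n) :
    arc (swapVal F c) (c + (a : ZMod n)) (c + (b : ZMod n)) l =
      arc F (c + (a : ZMod n)) (c + (b : ZMod n)) l := by
  rw [arc_eq hab.le (by omega), arc_eq hab.le (by omega), prod_swapVal F h0 hb]

lemma arc_around_eq_mul (h0 : 0 < a) (hab : a < b) (hb : b < n) (l : ZMod n) :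
    arc F (c + (b : ZMod n)) (c + (a : ZMod n)) l = arc F (c + (b : ZMod n)) (c - 1) l *
      (F (c - 1) l * (F c l * arc F (c + 1) (c + (a : ZMod n)) l)) := by
  rw [arc_around_eq hab hb, ← arc_from_eq_mul h0 (hab.trans hb), arc_from_eq (hab.trans hb),
    ← arc_to_eq (h0.trans hab) hb, arc_to_eq_mul (h0.trans hab) hb]
  ring

lemma arc_around_swapVal (h0 : 0 < a) (hab : a < b) (hb : b < n) (l : ZMod n) :
    arc (swapVal F c) (c + (b : ZMod n)) (c + (a : ZMod n)) l =
      arc F (c + (b : ZMod n)) (c + (a : ZMod n)) l := by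
  rw [arc_around_eq_mul h0 hab hb, arc_around_eq_mul h0 hab hb, swapVal_self, swapVal_pred,
    arc_pred_swapVal (h0.trans hab) hb, arc_succ_swapVal h0 (hab.trans hb)]
  ring

end ColP

lemma rectAway_swapVal {i k : ZMod n} (hi : i ≠ c) (hk : k ≠ c) (hik : i ≠ k) :
    rectAway (swapVal F c) i k = rectAway F i k := by
  obtain ⟨a, ha0, han, rfl⟩ := exists_natCast_add hi
  obtain ⟨b, hb0, hbn, rfl⟩ := exists_natCast_add hk
  funext s t
  rw [rectAway, rectAway]
  congr 1
  funext l
  rcases lt_trichotomy a b with h | rfl | h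
  · exact arc_eq_swapVal ha0 h hbn l
  · exact absurd rfl hik
  · exact arc_around_swapVal hb0 h han l

lemma rectW_eq {i : ZMod n} (hi : i ≠ c) (s t : ZMod n) : rectW F c i s t =
    run (fun l => F c l * arc F (c + 1) i l) s t +
      run (fun l => F (c - 1) l * arc F i (c - 1) l) t s := by
  obtain ⟨a, ha0, han, rfl⟩ := exists_natCast_add hi
  rw [rectW]
  congr 2
  · funext l; exact arc_from_eq_mul ha0 han l
  · funext l; exact arc_to_eq_mul ha0 han l

lemma rectW_swapVal {i : ZMod n} (hi : i ≠ c) (s t : ZMod n) : rectW (swapVal F c) c i s t =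
    run (fun l => F (c - 1) l * arc F (c + 1) i l) s t +
      run (fun l => F c l * arc F i (c - 1) l) t s := by
  rw [rectW_eq hi, swapVal_self, swapVal_pred]
  obtain ⟨a, ha0, han, rfl⟩ := exists_natCast_add hi
  simp only [arc_succ_swapVal ha0 han, arc_pred_swapVal ha0 han]

lemma pentW_swapVal {i : ZMod n} (hi : i ≠ c) (A s t : ZMod n) : pentW (swapVal F c) c A i s t =
    turn (fun l => F (c - 1) l * arc F (c + 1) i l) (arc F (c + 1) i)
      (fun l => F c l * arc F (c + 1) i l) A s t +
    turn (fun l => F (c - 1) l * arc F i (c - 1) l) (arc F i (c - 1))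
      (fun l => F c l * arc F i (c - 1) l) A t s := by
  rw [pentW, swapVal_self, swapVal_pred]
  obtain ⟨a, ha0, han, rfl⟩ := exists_natCast_add hi
  simp only [funext (arc_succ_swapVal (F := F) (c := c) ha0 han),
    funext (arc_pred_swapVal (F := F) (c := c) ha0 han)]

end Relations

section Relations

variable {R : Type*} [CommRing R] {n : ℕ} [NeZero n] {F : ZMod n → ZMod n → R} {c : ZMod n}

/-- The five merged columns of which the polygons with corners on the columns `c` and `i` consist; the
second one is empty. -/
def colsOf₂ (F : ZMod n → ZMod n → R) (c i : ZMod n) : ℕ → ZMod n → R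
  | 0 => arc F (c + 1) i
  | 1 => 1
  | 2 => arc F i (c - 1)
  | 3 => F (c - 1)
  | _ => F c

lemma isCols_colsOf₂ (hF : IsGridVal F) {i : ZMod n} (hi : i ≠ c) : IsCols (colsOf₂ F c i) [3, 4] where
  row l := by
    obtain ⟨a, ha0, han, rfl⟩ := exists_natCast_add hi
    simp only [colsOf₂, Pi.one_apply]
    rw [arc_succ_eq (by omega) (by omega), arc_pred_eq han,
      ← hF.row l, ← prod_range_add_cast (fun k => F k l) c]
    have := prod_split (fun k => F (c + (k : ZMod n)) l) ha0 le_rfl (show a ≤ n - 1 by omega)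
    rw [show n - 1 + 1 = n by omega, add_natCast_sub_one, Nat.cast_zero, add_zero, Ico_self,
      prod_empty] at this
    rw [← Nat.Ico_zero_eq_range, this]
    ring
  col k hk := by
    simp only [List.mem_cons, List.not_mem_nil, or_false] at hk
    rcases hk with rfl | rfl <;> exact hF.col _
  idem k hk := by
    simp only [List.mem_cons, List.not_mem_nil, or_false] at hk
    rcases hk with rfl | rfl <;> exact prod_arc_eq_zero_or hF _ _

/-- The markings of column `c` lie in the rows from `A` to `B`, and those of column `c - 1` in the rows
from `B` to `A`, with both ends included. -/
structure IsDrawnVal (F : ZMod n → ZMod n → R) (c A B : ZMod n) : Prop where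
  ne : A ≠ B
  west : ∀ l, (l - (A + 1)).val < (B - (A + 1)).val → F (c - 1) l = 1
  east : ∀ l, l ≠ A → (B - (A + 1)).val < (l - (A + 1)).val → F c l = 1

lemma pentW_eq_pentV {C : ℕ → ZMod n → R} (h3 : C 3 = F (c - 1)) (h4 : C 4 = F c) {u w : List ℕ}
    {i : ZMod n} (hu : colP C u = arc F (c + 1) i) (hw : colP C w = arc F i (c - 1))
    (A s t : ZMod n) : pentV C 4 3 u w A s t = pentW F c A i s t := by
  simp only [pentV, colP_cons, hu, hw, h3, h4]; rfl

lemma hexW_eq_hexV {C : ℕ → ZMod n → R} (h3 : C 3 = F (c - 1)) (h4 : C 4 = F c) {u w : List ℕ}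
    {i : ZMod n} (hu : colP C u = arc F (c + 1) i) (hw : colP C w = arc F i (c - 1))
    (A B s t : ZMod n) : hexV C 4 3 u w A B s t = hexW F c A B i s t := by
  simp only [hexV, colP_cons, hu, hw, h3, h4]; rfl

lemma pentW_eq_pentV' {C : ℕ → ZMod n → R} (h3 : C 3 = F (c - 1)) (h4 : C 4 = F c) {u w : List ℕ}
    {i : ZMod n} (hi : i ≠ c) (hu : colP C u = arc F (c + 1) i) (hw : colP C w = arc F i (c - 1))
    (A s t : ZMod n) : pentV C 3 4 u w A s t = pentW (swapVal F c) c A i s t := by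
  rw [pentW_swapVal hi]
  simp only [pentV, colP_cons, hu, hw, h3, h4]

lemma rectW_eq_rectV {C : ℕ → ZMod n → R} (h3 : C 3 = F (c - 1)) (h4 : C 4 = F c) {u w : List ℕ}
    {i : ZMod n} (hi : i ≠ c) (hu : colP C u = arc F (c + 1) i) (hw : colP C w = arc F i (c - 1))
    (s t : ZMod n) : rectV C (4 :: u) (3 :: w) s t = rectW F c i s t := by
  rw [rectW_eq hi]
  simp only [rectV, colP_cons, hu, hw, h3, h4]

lemma rectW_eq_rectV' {C : ℕ → ZMod n → R} (h3 : C 3 = F (c - 1)) (h4 : C 4 = F c) {u w : List ℕ}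
    {i : ZMod n} (hi : i ≠ c) (hu : colP C u = arc F (c + 1) i) (hw : colP C w = arc F i (c - 1))
    (s t : ZMod n) : rectV C (3 :: u) (4 :: w) s t = rectW (swapVal F c) c i s t := by
  rw [rectW_swapVal hi]
  simp only [rectV, colP_cons, hu, hw, h3, h4]

lemma rectAway_eq_rectV {a b : ℕ} (h0 : 0 < a) (hab : a < b) (hb : b < n) (s t : ZMod n) :
    rectV (colsOf F c (c + (a : ZMod n)) (c + (b : ZMod n))) [1] [2, 3, 4, 0] s t =
      rectAway F (c + (a : ZMod n)) (c + (b : ZMod n)) s t +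
        rectAway F (c + (b : ZMod n)) (c + (a : ZMod n)) t s := by
  rw [rectV, rectAway, rectAway, colP_singleton]
  congr 2
  funext l
  simp only [colP, colsOf, List.map_cons, List.map_nil, List.prod_cons, List.prod_nil, mul_one]
  exact (arc_around_eq_mul h0 hab hb l).symm

lemma rectAway_eq_rectV' {a b : ℕ} (h0 : 0 < a) (hab : a < b) (hb : b < n) (s t : ZMod n) :
    rectV (colsOf F c (c + (a : ZMod n)) (c + (b : ZMod n))) [2, 3, 4, 0] [1] s t =
      rectAway F (c + (b : ZMod n)) (c + (a : ZMod n)) s t +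
        rectAway F (c + (a : ZMod n)) (c + (b : ZMod n)) t s := by
  have h1 : ∀ r r' : List ℕ, rectV (colsOf F c (c + (a : ZMod n)) (c + (b : ZMod n))) r r' s t =
      rectV (colsOf F c (c + (a : ZMod n)) (c + (b : ZMod n))) r' r t s :=
    fun r r' => add_comm _ _
  rw [h1, rectAway_eq_rectV h0 hab hb, add_comm]

variable (h2 : ∀ x : R, x + x = 0)
include h2

/-- The polygons with corners on the special column and on the columns `i` and `k` cancel in the
chain map relation. -/
lemma chain_triple (hF : IsGridVal F) {A : ZMod n} {i k : ZMod n} (hi : i ≠ c) (hk : k ≠ c)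
    (hik : i ≠ k) {s₁ s₂ s₃ : ZMod n} (h₁₂ : s₁ ≠ s₂) (h₂₃ : s₂ ≠ s₃) (h₁₃ : s₁ ≠ s₃) :
    pentW F c A i s₁ s₂ * (rectAway F i k s₁ s₃ + rectAway F k i s₃ s₁) +
      (rectAway F i k s₂ s₃ + rectAway F k i s₃ s₂) * pentW F c A k s₁ s₂ +
      pentW F c A k s₁ s₃ * rectW (swapVal F c) c i s₃ s₂ +
      rectW F c k s₁ s₃ * pentW F c A i s₃ s₂ = 0 := by
  -- The weights do not involve `B`; any second row will do for the row blocks.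
  have hAB : ∃ B : ZMod n, A ≠ B := by
    by_contra! h
    exact h₁₂ ((h s₁).symm.trans (h s₂))
  obtain ⟨B, hAB⟩ := hAB
  obtain ⟨a, ha0, han, rfl⟩ := exists_natCast_add hi
  obtain ⟨b, hb0, hbn, rfl⟩ := exists_natCast_add hk
  rcases lt_trichotomy a b with h | rfl | h
  · have e0 := colP_singleton (colsOf F c (c + (a : ZMod n)) (c + (b : ZMod n))) 0
    have e2 := colP_singleton (colsOf F c (c + (a : ZMod n)) (c + (b : ZMod n))) 2
    have e01 := colP_colsOf_fst (F := F) (c := c) ha0 h hbn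
    have e12 := colP_colsOf_snd (F := F) (c := c) h hbn
    have key := chain_triple_east h2 (isCols_colsOf (c := c) hF ha0 h hbn) hAB h₁₂ h₂₃ h₁₃
    rw [pentW_eq_pentV rfl rfl e0 e12, pentW_eq_pentV rfl rfl e01 e2, pentW_eq_pentV rfl rfl e01 e2,
      pentW_eq_pentV rfl rfl e0 e12, rectW_eq_rectV' rfl rfl hi e0 e12,
      rectW_eq_rectV rfl rfl hk e01 e2, rectAway_eq_rectV ha0 h hbn,
      rectAway_eq_rectV ha0 h hbn] at key
    linear_combination key
  · exact absurd rfl hik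
  · have e0 := colP_singleton (colsOf F c (c + (b : ZMod n)) (c + (a : ZMod n))) 0
    have e2 := colP_singleton (colsOf F c (c + (b : ZMod n)) (c + (a : ZMod n))) 2
    have e01 := colP_colsOf_fst (F := F) (c := c) hb0 h han
    have e12 := colP_colsOf_snd (F := F) (c := c) h han
    have key := chain_triple_west h2 (isCols_colsOf (c := c) hF hb0 h han) hAB h₁₂ h₂₃ h₁₃
    rw [pentW_eq_pentV rfl rfl e01 e2, pentW_eq_pentV rfl rfl e0 e12, pentW_eq_pentV rfl rfl e0 e12,
      pentW_eq_pentV rfl rfl e01 e2, rectW_eq_rectV' rfl rfl hi e01 e2,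
      rectW_eq_rectV rfl rfl hk e0 e12, rectAway_eq_rectV' hb0 h han,
      rectAway_eq_rectV' hb0 h han] at key
    linear_combination key

/-- The polygons with corners on the special column and on the columns `i` and `k` cancel in the
homotopy relation. -/
lemma homotopy_triple (hF : IsGridVal F) {A B : ZMod n} (hd : IsDrawnVal F c A B) {i k : ZMod n}
    (hi : i ≠ c) (hk : k ≠ c) (hik : i ≠ k) {s₁ s₂ s₃ : ZMod n} (h₁₂ : s₁ ≠ s₂) (h₂₃ : s₂ ≠ s₃)
    (h₁₃ : s₁ ≠ s₃) :
    hexW F c A B i s₁ s₂ * (rectAway F i k s₁ s₃ + rectAway F k i s₃ s₁) +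
      (rectAway F i k s₂ s₃ + rectAway F k i s₃ s₂) * hexW F c A B k s₁ s₂ +
      hexW F c A B k s₁ s₃ * rectW F c i s₃ s₂ +
      rectW F c k s₁ s₃ * hexW F c A B i s₃ s₂ +
      pentW F c A k s₁ s₃ * pentW (swapVal F c) c B i s₃ s₂ = 0 := by
  have hd' : ∀ i k, IsDrawn (colsOf F c i k) A B := fun i k => ⟨hd.ne, hd.west, hd.east⟩
  obtain ⟨a, ha0, han, rfl⟩ := exists_natCast_add hi
  obtain ⟨b, hb0, hbn, rfl⟩ := exists_natCast_add hk
  rcases lt_trichotomy a b with h | rfl | h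
  · have e0 := colP_singleton (colsOf F c (c + (a : ZMod n)) (c + (b : ZMod n))) 0
    have e2 := colP_singleton (colsOf F c (c + (a : ZMod n)) (c + (b : ZMod n))) 2
    have e01 := colP_colsOf_fst (F := F) (c := c) ha0 h hbn
    have e12 := colP_colsOf_snd (F := F) (c := c) h hbn
    have key := homotopy_triple_east h2 (isCols_colsOf (c := c) hF ha0 h hbn) (hd' _ _) h₁₂ h₂₃ h₁₃
    rw [hexW_eq_hexV rfl rfl e0 e12, hexW_eq_hexV rfl rfl e01 e2, hexW_eq_hexV rfl rfl e01 e2,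
      hexW_eq_hexV rfl rfl e0 e12, rectW_eq_rectV rfl rfl hi e0 e12,
      rectW_eq_rectV rfl rfl hk e01 e2, rectAway_eq_rectV ha0 h hbn,
      rectAway_eq_rectV ha0 h hbn, pentW_eq_pentV rfl rfl e01 e2,
      pentW_eq_pentV' rfl rfl hi e0 e12] at key
    linear_combination key
  · exact absurd rfl hik
  · have e0 := colP_singleton (colsOf F c (c + (b : ZMod n)) (c + (a : ZMod n))) 0
    have e2 := colP_singleton (colsOf F c (c + (b : ZMod n)) (c + (a : ZMod n))) 2
    have e01 := colP_colsOf_fst (F := F) (c := c) hb0 h han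
    have e12 := colP_colsOf_snd (F := F) (c := c) h han
    have key := homotopy_triple_west h2 (isCols_colsOf (c := c) hF hb0 h han) (hd' _ _) h₁₂ h₂₃ h₁₃
    rw [hexW_eq_hexV rfl rfl e01 e2, hexW_eq_hexV rfl rfl e0 e12, hexW_eq_hexV rfl rfl e0 e12,
      hexW_eq_hexV rfl rfl e01 e2, rectW_eq_rectV rfl rfl hi e01 e2,
      rectW_eq_rectV rfl rfl hk e0 e12, rectAway_eq_rectV' hb0 h han,
      rectAway_eq_rectV' hb0 h han, pentW_eq_pentV rfl rfl e0 e12,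
      pentW_eq_pentV' rfl rfl hi e01 e2] at key
    linear_combination key

omit h2

/-! ### Vertical annuli -/

lemma run_dvd (u : ZMod n → R) (s B t : ZMod n) :
    run u s t ∣ run u s B * (u B * run u (B + 1) t) := by
  rcases lt_or_ge (B - s).val (t - s).val with h | h
  · have hne : B ≠ t := by rintro rfl; exact lt_irrefl _ h
    rw [← run_succ u hne, run_mul_run u h.le]
  · rw [← run_mul_run u h, mul_assoc]
    exact dvd_mul_right _ _

/-- A loop that goes once around the torus meets every row. -/
lemma prod_dvd_once_around (u : ZMod n → R) (A s : ZMod n) :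
    ∏ l, u l ∣ run u s A * (u A * run u (A + 1) s) := by
  by_cases h : s = A
  · subst h
    rw [run_self, one_mul]
    by_cases h1 : s = s + 1
    · have h1' : n = 1 := by
        have : (1 : ZMod n) = 0 := by simpa using h1.symm
        rwa [← Nat.cast_one, ZMod.natCast_eq_zero_iff, Nat.dvd_one] at this
      subst h1'
      rw [Fintype.prod_subsingleton _ s]
      exact dvd_mul_right _ _
    · have := run_succ u h1
      rw [run_self, mul_one] at this
      rw [← this, run_mul_run_eq_prod u h1]
  · rw [← run_succ u (Ne.symm h), run_mul_run_eq_prod u h]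

/-- A vertical annulus that contains a whole column contains an `X`-marking. -/
lemma turn_loop_eq_zero {u : ZMod n → R} (hu : ∏ l, u l = 0) (f g : ZMod n → R) (A s : ZMod n) :
    turn (fun l => f l * u l) u (fun l => g l * u l) A s s = 0 := by
  obtain ⟨d, hd⟩ := prod_dvd_once_around u A s
  rw [turn, run_mul, run_mul]
  linear_combination (run f s A * run g (A + 1) s) * hd +
    (run f s A * run g (A + 1) s * d) * hu

lemma turn_loop_eq {u : ZMod n → R} (hu : ∀ l, u l = 1) (f g : ZMod n → R) (A s t : ZMod n) :
    turn (fun l => f l * u l) u (fun l => g l * u l) A s t = run f s A * run g (A + 1) t := by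
  simp only [turn, hu, mul_one]

lemma twoTurn_loop_eq_zero {u : ZMod n → R} (hu : ∏ l, u l = 0) (f g : ZMod n → R)
    (A B s : ZMod n) :
    twoTurn (fun l => f l * u l) u (fun l => g l * u l) A B s s = 0 := by
  obtain ⟨d, hd⟩ := prod_dvd_once_around u A s
  obtain ⟨e, he⟩ := run_dvd u (A + 1) B s
  rw [twoTurn, run_mul, run_mul, run_mul]
  linear_combination (run f s A * run g (A + 1) B * run f (B + 1) s) *
    (run u s A * u A * he + e * hd + d * e * hu)

lemma twoTurn_loop_eq {u : ZMod n → R} (hu : ∀ l, u l = 1) (f g : ZMod n → R) (A B s t : ZMod n) :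
    twoTurn (fun l => f l * u l) u (fun l => g l * u l) A B s t =
      run f s A * run g (A + 1) B * run f (B + 1) t := by
  simp only [twoTurn, hu, mul_one]

lemma IsDrawnVal.run_west_eq_one {A B : ZMod n} (hd : IsDrawnVal F c A B) {s t : ZMod n}
    (hst : (s - (A + 1)).val ≤ (t - (A + 1)).val) (ht : (t - (A + 1)).val ≤ (B - (A + 1)).val) :
    run (F (c - 1)) s t = 1 := by
  have hlt := ZMod.val_lt (t - (A + 1))
  have e := run_add_natCast (F (c - 1)) (A + 1) hst (by omega)
  rw [add_val_cast rfl, add_val_cast rfl] at e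
  rw [e]
  refine prod_eq_one fun l hl => hd.west _ ?_
  rw [mem_Ico] at hl
  rw [add_sub_cancel_left, ZMod.val_cast_of_lt (by omega)]
  omega

lemma val_sub_succ_self (A : ZMod n) : (A - (A + 1)).val = n - 1 := by
  have h : 1 ≤ n := NeZero.one_le
  have : A - (A + 1) = ((n - 1 : ℕ) : ZMod n) := by
    rw [Nat.cast_sub h]; simp
  rw [this, ZMod.val_cast_of_lt (by omega)]

lemma val_succ_sub_succ {A B : ZMod n} (h : A ≠ B) :
    (B + 1 - (A + 1)).val = (B - (A + 1)).val + 1 := by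
  have h1 := val_sub_succ_lt h
  have : B + 1 - (A + 1) = (((B - (A + 1)).val + 1 : ℕ) : ZMod n) := by
    push_cast; rw [ZMod.natCast_zmod_val]; ring
  rw [this, ZMod.val_cast_of_lt h1]

lemma IsDrawnVal.run_east_eq_one {A B : ZMod n} (hd : IsDrawnVal F c A B) {s t : ZMod n}
    (hst : (s - (A + 1)).val ≤ (t - (A + 1)).val) (hs : (B - (A + 1)).val < (s - (A + 1)).val) :
    run (F c) s t = 1 := by
  have hlt := ZMod.val_lt (t - (A + 1))
  have e := run_add_natCast (F c) (A + 1) hst (by omega)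
  rw [add_val_cast rfl, add_val_cast rfl] at e
  rw [e]
  refine prod_eq_one fun l hl => ?_
  rw [mem_Ico] at hl
  have hv : (A + 1 + (l : ZMod n) - (A + 1)).val = l := by
    rw [add_sub_cancel_left, ZMod.val_cast_of_lt (by omega)]
  refine hd.east _ (fun he => ?_) (by omega)
  rw [he, val_sub_succ_self] at hv
  omega

/-- The two vertical annuli of width one: exactly one of them contains no marking. -/
lemma IsDrawnVal.annuli {A B : ZMod n} (hF : IsGridVal F) (hd : IsDrawnVal F c A B) (s : ZMod n) :
    run (F c) s A * run (F (c - 1)) (A + 1) B * run (F c) (B + 1) s +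
      run (F (c - 1)) s B * run (F c) (B + 1) A * run (F (c - 1)) (A + 1) s = 1 := by
  have hA := val_sub_succ_self A
  have hB := val_succ_sub_succ hd.ne
  have hlt := ZMod.val_lt (s - (A + 1))
  have hlt' := val_sub_succ_lt hd.ne
  have h0 : (A + 1 - (A + 1)).val = 0 := by simp
  rw [hd.run_west_eq_one (s := A + 1) (t := B) (by omega) le_rfl,
    hd.run_east_eq_one (s := B + 1) (t := A) (by omega) (by omega), mul_one, mul_one]
  have hval : ∀ t u : ZMod n, (u - (A + 1)).val ≤ (t - (A + 1)).val →
      (t - u).val = (t - (A + 1)).val - (u - (A + 1)).val := by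
    intro t u h
    have e : t - u = (((t - (A + 1)).val - (u - (A + 1)).val : ℕ) : ZMod n) := by
      rw [Nat.cast_sub h, ZMod.natCast_zmod_val, ZMod.natCast_zmod_val]; ring
    have := ZMod.val_lt (t - (A + 1))
    rw [e, ZMod.val_cast_of_lt (by omega)]
  rcases le_or_gt (s - (A + 1)).val (B - (A + 1)).val with h | h
  · rw [hd.run_west_eq_one h le_rfl, hd.run_west_eq_one (s := A + 1) (t := s) (by omega) h]
    have hne : s ≠ B + 1 := by rintro rfl; omega
    have h1 := run_mul_run (F c) (s := s) (t := B + 1) (u := A) (by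
      rw [hval (B + 1) s (by omega), hval A s (by omega)]; omega)
    rw [hd.run_east_eq_one (s := B + 1) (t := A) (by omega) (by omega), mul_one] at h1
    rw [← h1, run_mul_run_eq_prod _ hne, hF.col]
    ring
  · rw [hd.run_east_eq_one (s := s) (t := A) (by omega) h,
      hd.run_east_eq_one (s := B + 1) (t := s) (by omega) (by omega)]
    have hne : s ≠ A + 1 := by rintro rfl; omega
    have hs : s - (A + 1) ≠ 0 := sub_ne_zero.2 hne
    have h2 : (A + 1 - s).val = n - (s - (A + 1)).val := by
      have := ZMod.neg_val (s - (A + 1))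
      rw [if_neg hs] at this
      rw [← this, neg_sub]
    have h3 : (B - s).val = n - (s - (A + 1)).val + (B - (A + 1)).val := by
      have e : B - s = ((n - (s - (A + 1)).val + (B - (A + 1)).val : ℕ) : ZMod n) := by
        rw [Nat.cast_add, Nat.cast_sub hlt.le, ZMod.natCast_zmod_val, ZMod.natCast_zmod_val,
          ZMod.natCast_self]
        ring
      rw [e, ZMod.val_cast_of_lt (by omega)]
    have h1 := run_mul_run (F (c - 1)) (s := s) (t := A + 1) (u := B) (by omega)
    rw [hd.run_west_eq_one (s := A + 1) (t := B) (by omega) le_rfl, mul_one] at h1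
    rw [← h1, run_mul_run_eq_prod _ hne, hF.col]
    ring

/-- The operator that counts the rectangles of a diagram. -/
def rectOp (F : ZMod n → ZMod n → R) (f : GridState n → R) (x : GridState n) : R :=
  ∑ p ∈ univ.offDiag, rectAway F p.1 p.2 (x p.1) (x p.2) * f (x * Equiv.swap p.1 p.2)

/-- The rectangles of a diagram, sorted by whether or not they have corners on column `c`. -/
lemma rectOp_eq (F : ZMod n → ZMod n → R) (c : ZMod n) (f : GridState n → R) (x : GridState n) :
    rectOp F f x = crossOp c (rectW F c) f x + awayOp c (rectAway F) f x := by
  have h1 : (univ : Finset (ZMod n)) = insert c (univ.erase c) := by simp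
  have h3 : c ∉ univ.erase c := by simp
  have hd1 : Disjoint (univ.erase c).offDiag ({c} ×ˢ univ.erase c) := by
    rw [disjoint_left]; rintro ⟨a, b⟩; simp; tauto
  have hd2 : Disjoint ((univ.erase c).offDiag ∪ {c} ×ˢ univ.erase c) (univ.erase c ×ˢ {c}) := by
    rw [disjoint_left]; rintro ⟨a, b⟩; simp; tauto
  rw [rectOp, h1, offDiag_insert h3, sum_union hd2, sum_union hd1, crossOp, awayOp]
  simp only [sum_product, sum_singleton, rectW, rectAway, add_mul, sum_add_distrib,
    Equiv.swap_comm c]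
  ring

lemma awayOp_swapVal (F : ZMod n → ZMod n → R) (c : ZMod n) (f : GridState n → R)
    (x : GridState n) :
    awayOp c (rectAway (swapVal F c)) f x = awayOp c (rectAway F) f x := by
  refine sum_congr rfl fun p hp => ?_
  obtain ⟨h1, h2, h3⟩ := mem_offDiag.1 hp
  rw [rectAway_swapVal (ne_of_mem_erase h1) (ne_of_mem_erase h2) h3]

lemma crossOp_add (c : ZMod n) (φ : ZMod n → ZMod n → ZMod n → R) (f g : GridState n → R)
    (x : GridState n) : crossOp c φ (fun y => f y + g y) x = crossOp c φ f x + crossOp c φ g x := by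
  simp only [crossOp, mul_add, sum_add_distrib]

lemma exists_ne_of_mem_erase {i : ZMod n} (h : i ≠ c) : c + 1 ≠ c ∧ c - 1 ≠ c := by
  have h1 : (1 : ZMod n) ≠ 0 := by
    intro h1
    have h1 : n = 1 := by rwa [← Nat.cast_one, ZMod.natCast_eq_zero_iff, Nat.dvd_one] at h1
    subst h1
    exact h (Subsingleton.elim _ _)
  exact ⟨by simpa using h1, by simpa using h1⟩

/-- Among the sums over all other columns of the weights of the annuli on the two sides of column `c`,
only those of width one remain. -/
lemma sum_annuli (hF : IsGridVal F) {i : ZMod n} (hi : i ≠ c) {a b : R}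
    {α β : (ZMod n → R) → R} (hα : ∀ u, ∏ l, u l = 0 → α u = 0) (hβ : ∀ u, ∏ l, u l = 0 → β u = 0)
    (hα' : ∀ u, (∀ l, u l = 1) → α u = a) (hβ' : ∀ u, (∀ l, u l = 1) → β u = b) :
    ∑ i ∈ univ.erase c, (α (arc F (c + 1) i) + β (arc F i (c - 1))) = a + b := by
  obtain ⟨hc1, hc2⟩ := exists_ne_of_mem_erase hi
  rw [sum_add_distrib, sum_eq_single_of_mem (c + 1) (by simpa using hc1),
    sum_eq_single_of_mem (c - 1) (by simpa using hc2), hα' (arc F (c + 1) (c + 1)) fun l => run_self _ _,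
    hβ' (arc F (c - 1) (c - 1)) fun l => run_self _ _]
  · exact fun j _ hj => hβ _ (prod_arc_eq_zero hF hj)
  · exact fun j _ hj => hα _ (prod_arc_eq_zero hF hj.symm)

variable (h2 : ∀ x : R, x + x = 0)
include h2

/-- The pentagon count is a chain map: corners on four columns cancel by `awayOp_crossOp_add`,
corners on three columns by `chain_triple`, and what is left on two columns are two copies of the
same annulus. -/
theorem rectOp_pentOp (hF : IsGridVal F) (A : ZMod n) (f : GridState n → R) (x : GridState n) :
    rectOp F (crossOp c (pentW F c A) f) x +
      crossOp c (pentW F c A) (rectOp (swapVal F c) f) x = 0 := by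
  have e1 : rectOp (swapVal F c) f = fun y => crossOp c (rectW (swapVal F c) c) f y +
      awayOp c (rectAway F) f y := by
    funext y; rw [rectOp_eq _ c, awayOp_swapVal]
  rw [rectOp_eq F c, e1, crossOp_add]
  have e2 := awayOp_crossOp_add c h2 (rectAway F) (pentW F c A) f x
  rw [crossOp_crossOp, crossOp_crossOp]
  have e3 : ∑ p ∈ (univ.erase c).offDiag,
      ((pentW F c A p.1 (x c) (x p.1) * (rectAway F p.1 p.2 (x c) (x p.2) +
          rectAway F p.2 p.1 (x p.2) (x c)) +
        (rectAway F p.1 p.2 (x p.1) (x p.2) + rectAway F p.2 p.1 (x p.2) (x p.1)) *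
          pentW F c A p.2 (x c) (x p.1)) * f (x * (Equiv.swap p.1 c * Equiv.swap p.1 p.2)) +
        rectW F c p.2 (x c) (x p.2) * pentW F c A p.1 (x p.2) (x p.1) *
          f (x * (Equiv.swap p.1 c * Equiv.swap p.1 p.2)) +
        pentW F c A p.2 (x c) (x p.2) * rectW (swapVal F c) c p.1 (x p.2) (x p.1) *
          f (x * (Equiv.swap p.1 c * Equiv.swap p.1 p.2))) = 0 := by
    refine sum_eq_zero fun p hp => ?_
    obtain ⟨h1, h2', h3⟩ := mem_offDiag.1 hp
    have h1 := ne_of_mem_erase h1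
    have h2' := ne_of_mem_erase h2'
    have := chain_triple h2 hF (A := A) h1 h2' h3 (x.injective.ne h1.symm) (x.injective.ne h3)
      (x.injective.ne h2'.symm)
    linear_combination f (x * (Equiv.swap p.1 c * Equiv.swap p.1 p.2)) * this
  have e4 : ∑ i ∈ univ.erase c, rectW F c i (x c) (x i) * pentW F c A i (x i) (x c) +
      ∑ i ∈ univ.erase c, pentW F c A i (x c) (x i) * rectW (swapVal F c) c i (x i) (x c) = 0 := by
    rw [← sum_add_distrib]
    rcases (univ.erase c).eq_empty_or_nonempty with he | ⟨j, hj⟩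
    · rw [he, sum_empty]
    have hj := ne_of_mem_erase hj
    have key : ∀ i ∈ univ.erase c, rectW F c i (x c) (x i) * pentW F c A i (x i) (x c) +
        pentW F c A i (x c) (x i) * rectW (swapVal F c) c i (x i) (x c) =
        turn (fun l => F c l * arc F (c + 1) i l) (arc F (c + 1) i)
          (fun l => F (c - 1) l * arc F (c + 1) i l) A (x c) (x c) +
        turn (fun l => F c l * arc F i (c - 1) l) (arc F i (c - 1))
          (fun l => F (c - 1) l * arc F i (c - 1) l) A (x c) (x c) := by
      intro i hi
      have hi := ne_of_mem_erase hi
      -- The weights do not involve `B`; any second row will do for the row blocks.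
      have hAB : ∃ B : ZMod n, A ≠ B := by
        by_contra! h
        exact hi ((h i).symm.trans (h c))
      obtain ⟨B, hAB⟩ := hAB
      have e0 := colP_singleton (colsOf₂ F c i) 0
      have e2 := colP_singleton (colsOf₂ F c i) 2
      have := chain_loop h2 (isCols_colsOf₂ (c := c) hF hi) (fun l => rfl) hAB
        (x.injective.ne hi.symm)
      rw [pentW_eq_pentV rfl rfl e0 e2, pentW_eq_pentV rfl rfl e0 e2,
        rectW_eq_rectV' rfl rfl hi e0 e2, rectW_eq_rectV rfl rfl hi e0 e2] at this
      simp only [colP_cons (colsOf₂ F c i) _ [_], e0, e2] at this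
      rw [add_comm]
      exact this
    rw [sum_congr rfl key, sum_annuli hF hj
      (α := fun u => turn (fun l => F c l * u l) u (fun l => F (c - 1) l * u l) A (x c) (x c))
      (β := fun u => turn (fun l => F c l * u l) u (fun l => F (c - 1) l * u l) A (x c) (x c))
      (fun u hu => turn_loop_eq_zero hu _ _ _ _) (fun u hu => turn_loop_eq_zero hu _ _ _ _)
      (fun u hu => turn_loop_eq hu _ _ _ _ _) (fun u hu => turn_loop_eq hu _ _ _ _ _), h2]
  simp only [sum_add_distrib] at e2 e3
  linear_combination f x * e4 + e3 + e2

/-- The hexagon count is a homotopy from the composition of the pentagon counts to the identity. On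
four and three columns the compositions cancel, and on two columns exactly one of the two annuli of
width one contains no marking and contributes the identity. -/
theorem rectOp_hexOp (hn : 1 < n) (hF : IsGridVal F) {A B : ZMod n} (hd : IsDrawnVal F c A B)
    (f : GridState n → R) (x : GridState n) :
    rectOp F (crossOp c (hexW F c A B) f) x + crossOp c (hexW F c A B) (rectOp F f) x +
      crossOp c (pentW F c A) (crossOp c (pentW (swapVal F c) c B) f) x = f x := by
  have e1 : rectOp F f = fun y => crossOp c (rectW F c) f y + awayOp c (rectAway F) f y := by
    funext y; rw [rectOp_eq _ c]
  rw [rectOp_eq F c, e1, crossOp_add]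
  have e2 := awayOp_crossOp_add c h2 (rectAway F) (hexW F c A B) f x
  rw [crossOp_crossOp, crossOp_crossOp, crossOp_crossOp]
  have e3 : ∑ p ∈ (univ.erase c).offDiag,
      ((hexW F c A B p.1 (x c) (x p.1) * (rectAway F p.1 p.2 (x c) (x p.2) +
          rectAway F p.2 p.1 (x p.2) (x c)) +
        (rectAway F p.1 p.2 (x p.1) (x p.2) + rectAway F p.2 p.1 (x p.2) (x p.1)) *
          hexW F c A B p.2 (x c) (x p.1)) * f (x * (Equiv.swap p.1 c * Equiv.swap p.1 p.2)) +
        rectW F c p.2 (x c) (x p.2) * hexW F c A B p.1 (x p.2) (x p.1) *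
          f (x * (Equiv.swap p.1 c * Equiv.swap p.1 p.2)) +
        hexW F c A B p.2 (x c) (x p.2) * rectW F c p.1 (x p.2) (x p.1) *
          f (x * (Equiv.swap p.1 c * Equiv.swap p.1 p.2)) +
        pentW F c A p.2 (x c) (x p.2) * pentW (swapVal F c) c B p.1 (x p.2) (x p.1) *
          f (x * (Equiv.swap p.1 c * Equiv.swap p.1 p.2))) = 0 := by
    refine sum_eq_zero fun p hp => ?_
    obtain ⟨h1, h2', h3⟩ := mem_offDiag.1 hp
    have h1 := ne_of_mem_erase h1
    have h2' := ne_of_mem_erase h2'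
    have := homotopy_triple h2 hF hd h1 h2' h3 (x.injective.ne h1.symm)
      (x.injective.ne h3) (x.injective.ne h2'.symm)
    linear_combination f (x * (Equiv.swap p.1 c * Equiv.swap p.1 p.2)) * this
  have e4 : ∑ i ∈ univ.erase c, rectW F c i (x c) (x i) * hexW F c A B i (x i) (x c) +
      ∑ i ∈ univ.erase c, hexW F c A B i (x c) (x i) * rectW F c i (x i) (x c) +
      ∑ i ∈ univ.erase c, pentW F c A i (x c) (x i) * pentW (swapVal F c) c B i (x i) (x c) =
      1 := by
    rw [← sum_add_distrib, ← sum_add_distrib]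
    have hc1 : c + 1 ≠ c := by
      have : Fact (1 < n) := ⟨hn⟩
      simp
    have key : ∀ i ∈ univ.erase c, rectW F c i (x c) (x i) * hexW F c A B i (x i) (x c) +
        hexW F c A B i (x c) (x i) * rectW F c i (x i) (x c) +
        pentW F c A i (x c) (x i) * pentW (swapVal F c) c B i (x i) (x c) =
        twoTurn (fun l => F c l * arc F (c + 1) i l) (arc F (c + 1) i)
          (fun l => F (c - 1) l * arc F (c + 1) i l) A B (x c) (x c) +
        twoTurn (fun l => F (c - 1) l * arc F i (c - 1) l) (arc F i (c - 1))
          (fun l => F c l * arc F i (c - 1) l) B A (x c) (x c) := by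
      intro i hi
      have hi := ne_of_mem_erase hi
      have e0 := colP_singleton (colsOf₂ F c i) 0
      have e2 := colP_singleton (colsOf₂ F c i) 2
      have := homotopy_loop h2 (isCols_colsOf₂ (c := c) hF hi) (fun l => rfl)
        ⟨hd.ne, hd.west, hd.east⟩ (x.injective.ne hi.symm)
      rw [hexW_eq_hexV rfl rfl e0 e2, hexW_eq_hexV rfl rfl e0 e2,
        rectW_eq_rectV rfl rfl hi e0 e2, rectW_eq_rectV rfl rfl hi e0 e2,
        pentW_eq_pentV rfl rfl e0 e2, pentW_eq_pentV' rfl rfl hi e0 e2] at this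
      simp only [colP_cons (colsOf₂ F c i) _ [_], e0, e2] at this
      rw [add_comm (rectW F c i (x c) (x i) * _)]
      exact this
    rw [sum_congr rfl key, sum_annuli hF hc1
      (α := fun u => twoTurn (fun l => F c l * u l) u (fun l => F (c - 1) l * u l) A B (x c) (x c))
      (β := fun u => twoTurn (fun l => F (c - 1) l * u l) u (fun l => F c l * u l) B A (x c) (x c))
      (fun u hu => twoTurn_loop_eq_zero hu _ _ _ _ _)
      (fun u hu => twoTurn_loop_eq_zero hu _ _ _ _ _)
      (fun u hu => twoTurn_loop_eq hu _ _ _ _ _ _)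
      (fun u hu => twoTurn_loop_eq hu _ _ _ _ _ _), hd.annuli hF]
  simp only [sum_add_distrib] at e2 e3
  linear_combination f x * e4 + e3 + e2

end Relations

/-! ### Lifts of polygons -/

section Lifts

variable {R : Type*} [CommRing R] {n : ℕ} [NeZero n]

/-- The product of `f` over the rows with offsets from `a` to `b - 1` from the row `s`. -/
noncomputable def lrun (f : ZMod n → R) (s : ZMod n) (a b : ℤ) : R := ∏ l ∈ Ico a b, f (s + (l : ZMod n))

lemma lrun_eq_prod_range (f : ZMod n → R) (s : ZMod n) (a : ℤ) (m : ℕ) :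
    lrun f s a (a + m) = ∏ l ∈ range m, f (s + (a : ZMod n) + (l : ZMod n)) := by
  refine (prod_nbij (fun l : ℕ => a + (l : ℤ)) (by simp) (fun x _ y _ h => by simpa using h) ?_ ?_).symm
  · intro l hl
    simp only [coe_Ico, Set.mem_Ico] at hl
    exact ⟨(l - a).toNat, by simp; omega, by simp; omega⟩
  · intro l _
    push_cast; congr 1; ring

lemma lrun_eq_run (f : ZMod n → R) (s : ZMod n) {a b : ℤ} (hab : a ≤ b) (h : b < a + n) :
    lrun f s a b = run f (s + (a : ZMod n)) (s + (b : ZMod n)) := by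
  obtain ⟨m, hm⟩ := Int.eq_ofNat_of_zero_le (sub_nonneg.2 hab)
  obtain rfl : b = a + m := by omega
  rw [lrun_eq_prod_range, run_eq_prod_of_val (m := m)]
  push_cast
  rw [← add_assoc, add_sub_cancel_left, ZMod.val_cast_of_lt (by omega)]

lemma lrun_mul_lrun (f : ZMod n → R) (s : ZMod n) {a b d : ℤ} (hab : a ≤ b) (hbd : b ≤ d) :
    lrun f s a b * lrun f s b d = lrun f s a d := by
  rw [lrun, lrun, lrun, ← prod_union, Ico_union_Ico_eq_Ico hab hbd]
  rw [disjoint_left]; intro l; simp only [mem_Ico]; omega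

/-- A product over at least `n` consecutive rows goes all around the torus. -/
lemma lrun_eq_zero {f : ZMod n → R} (hf : ∏ l, f l = 0) (s : ZMod n) {a b : ℤ} (h : a + n ≤ b) :
    lrun f s a b = 0 := by
  rw [← lrun_mul_lrun f s (show a ≤ a + n by omega) h, lrun_eq_prod_range, prod_range_add_cast, hf,
    zero_mul]

lemma lrun_succ (f : ZMod n → R) (s : ZMod n) (a : ℤ) :
    lrun f s a (a + 1) = f (s + (a : ZMod n)) := by
  have := lrun_eq_prod_range f s a 1
  simpa using this

/-- An integer in `[0, n)` that represents `t - s` is the standard representative. -/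
lemma exists_unique_lift {s t : ZMod n} {a : ℤ} (h0 : 0 ≤ a) (hn : a < n)
    (h : s + (a : ZMod n) = t) : a = ((t - s).val : ℤ) := by
  lift a to ℕ using h0
  rw [← h, add_sub_cancel_left, Int.cast_natCast, ZMod.val_cast_of_lt (by omega)]

lemma lift_spec (s t : ZMod n) : s + ((((t - s).val : ℕ) : ℤ) : ZMod n) = t := by simp

/-- The row weights of a polygon of height `h` with one turn, at offset `t`. -/
noncomputable def liftTurn (f u g : ZMod n → R) (s : ZMod n) (h t : ℤ) : R :=
  lrun u s 0 h * (lrun f s 0 t * lrun g s (t + 1) h)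

/-- The row weights of a polygon of height `h` with turns at the offsets `t` and `t'`. -/
noncomputable def liftTwoTurn (f u g : ZMod n → R) (s : ZMod n) (h t t' : ℤ) : R :=
  lrun u s 0 h * (lrun f s 0 t * lrun g s (t + 1) t' * lrun f s (t' + 1) h)

/-- Among the polygons in the 4-fold cover with one turn and with given corners, only one does not
contain all markings of a column: below the turn and above it the height has to be less than `n`. -/
lemma sum_liftTurn {f g : ZMod n → R} (hf : ∏ l, f l = 0) (hg : ∏ l, g l = 0) (u : ZMod n → R)
    (A s s' : ZMod n) :
    (∑ h ∈ Ioo 0 ((2 * n : ℕ) : ℤ), if s' = s + (h : ZMod n) then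
      ∑ t ∈ Ico (0 : ℤ) (2 * n), if t ∈ Ico 0 h ∧ s + (t : ZMod n) = A then
        liftTurn f u g s h t else 0 else 0) =
      turn (fun l => f l * u l) u (fun l => g l * u l) A s s' := by
  have hA := ZMod.val_lt (A - s)
  have hs' := ZMod.val_lt (s' - (A + 1))
  -- the offset of the turn and the height of the only polygon that may contribute
  set t₀ : ℤ := ((A - s).val : ℤ) with ht₀
  set h₀ : ℤ := t₀ + 1 + ((s' - (A + 1)).val : ℤ) with hh₀
  have eA : s + (t₀ : ZMod n) = A := lift_spec s A
  have eA1 : s + ((t₀ + 1 : ℤ) : ZMod n) = A + 1 := by push_cast; rw [← eA]; ring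
  have es' : s + (h₀ : ZMod n) = s' := by
    rw [hh₀, Int.cast_add, ← add_assoc, eA1, lift_spec]
  have huniq : ∀ h t : ℤ, s' = s + (h : ZMod n) → 0 ≤ t → t < h → s + (t : ZMod n) = A →
      liftTurn f u g s h t ≠ 0 → t = t₀ ∧ h = h₀ := by
    intro h t e1 e2 e3 e4 hne
    have htn : t < n := by
      by_contra hcon
      exact hne (by rw [liftTurn, lrun_eq_zero hf s (by omega)]; ring)
    have htt : t = t₀ := exists_unique_lift e2 htn e4
    have hhn : h - (t + 1) < n := by
      by_contra hcon
      exact hne (by rw [liftTurn, lrun_eq_zero hg s (a := t + 1) (by omega)]; ring)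
    refine ⟨htt, ?_⟩
    have := exists_unique_lift (s := A + 1) (t := s') (a := h - (t + 1)) (by omega) hhn (by
      rw [e1, ← eA1, htt]; push_cast; ring)
    omega
  have hval : liftTurn f u g s h₀ t₀ = turn (fun l => f l * u l) u (fun l => g l * u l) A s s' := by
    rw [turn, run_mul, run_mul, liftTurn, ← lrun_mul_lrun u s (show 0 ≤ t₀ by omega)
      (show t₀ ≤ h₀ by omega), ← lrun_mul_lrun u s (show t₀ ≤ t₀ + 1 by omega)
      (show t₀ + 1 ≤ h₀ by omega), lrun_succ, lrun_eq_run u s (by omega) (by omega),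
      lrun_eq_run f s (by omega) (by omega), lrun_eq_run u s (by omega) (by omega),
      lrun_eq_run g s (by omega) (by omega), eA, eA1, es']
    simp only [Int.cast_zero, add_zero]
    ring
  rw [sum_eq_single h₀, if_pos es'.symm, sum_eq_single t₀, if_pos ⟨by rw [mem_Ico]; omega, eA⟩, hval]
  · intro t _ hne
    rw [ite_eq_right_iff]
    rintro ⟨h1, h2⟩
    rw [mem_Ico] at h1
    by_contra hcon
    exact hne (huniq h₀ t es'.symm h1.1 h1.2 h2 hcon).1
  · intro hcon
    exact absurd (mem_Ico.2 ⟨by omega, by omega⟩) hcon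
  · intro h _ hne
    rw [ite_eq_right_iff]
    intro e1
    refine sum_eq_zero fun t _ => ?_
    rw [ite_eq_right_iff]
    rintro ⟨h1, h2⟩
    rw [mem_Ico] at h1
    by_contra hcon
    exact hne (huniq h t e1 h1.1 h1.2 h2 hcon).2
  · intro hcon
    exact absurd (mem_Ioo.2 ⟨by omega, by push_cast; omega⟩) hcon

/-- A polygon with two turns that is too high for the 4-fold cover contains all markings of a column. -/
lemma twoTurn_eq_zero {f : ZMod n → R} (hf : ∏ l, f l = 0) (u g : ZMod n → R) {A B s s' : ZMod n}
    (hAB : A ≠ B)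
    (h : 2 * n ≤ (A - s).val + 1 + (B - (A + 1)).val + 1 + (s' - (B + 1)).val) :
    twoTurn (fun l => f l * u l) u (fun l => g l * u l) A B s s' = 0 := by
  suffices h0 : run f s A * run f (B + 1) s' = 0 by
    rw [twoTurn, run_mul, run_mul, run_mul]
    linear_combination (u A * run u s A * (run g (A + 1) B * run u (A + 1) B) * u B *
      run u (B + 1) s') * h0
  have v1 := ZMod.val_lt (s - A)
  have v2 := ZMod.val_lt (s' - A)
  have v3 := val_sub_succ_lt hAB
  have v4 := ZMod.val_lt (A - s)
  have v5 := ZMod.val_lt (s' - (B + 1))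
  have hB1 : (B + 1 - A).val = (B - (A + 1)).val + 2 ∨ B + 1 = A := by
    by_cases hB : B + 1 = A
    · exact Or.inr hB
    · left
      have e : B + 1 - A = (((B - (A + 1)).val + 2 : ℕ) : ZMod n) := by
        push_cast; rw [ZMod.natCast_zmod_val]; ring
      have : (B - (A + 1)).val + 2 ≠ n := by
        intro he
        rw [he, ZMod.natCast_self] at e
        exact hB (sub_eq_zero.1 e)
      rw [e, ZMod.val_cast_of_lt (by omega)]
  by_cases hs : s = A
  · subst hs; simp at h; omega
  have e1 : (A - s).val = n - (s - A).val := by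
    have := ZMod.neg_val (s - A)
    rw [if_neg (sub_ne_zero.2 hs)] at this
    rw [← this, neg_sub]
  have hsA : 0 < (s - A).val := by
    rw [Nat.pos_iff_ne_zero, Ne, ZMod.val_eq_zero, sub_eq_zero]; exact hs
  have hfull : run f s A * run f A s = 0 := by rw [run_mul_run_eq_prod f hs, hf]
  -- the second run of `f` reaches `A` and goes on to `s'`, which is not below `s`
  have hrun : (s - A).val ≤ (s' - A).val ∧ run f (B + 1) s' = run f (B + 1) A * run f A s' := by
    rcases hB1 with hB1 | hB1
    · have e2 : s' - (B + 1) = (s' - A) - (B + 1 - A) := by ring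
      rcases le_or_gt (B + 1 - A).val (s' - A).val with hle | hlt
      · have : (s' - (B + 1)).val = (s' - A).val - (B + 1 - A).val := by
          rw [e2, ZMod.val_sub hle]
        omega
      · have e3 : (s' - (B + 1)).val = n - (B + 1 - A).val + (s' - A).val := by
          have v6 := ZMod.val_lt (B + 1 - A)
          have e : s' - (B + 1) = ((n - (B + 1 - A).val + (s' - A).val : ℕ) : ZMod n) := by
            rw [Nat.cast_add, Nat.cast_sub v6.le, ZMod.natCast_zmod_val, ZMod.natCast_zmod_val,
              ZMod.natCast_self]
            ring
          rw [e, ZMod.val_cast_of_lt (by omega)]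
        have e4 : (A - (B + 1)).val = n - (B + 1 - A).val := by
          have hne : B + 1 - A ≠ 0 := by intro h0; rw [h0] at hB1; simp at hB1
          have := ZMod.neg_val (B + 1 - A)
          rw [if_neg hne] at this
          rw [← this, neg_sub]
        exact ⟨by omega, (run_mul_run f (by omega)).symm⟩
    · rw [hB1, run_self, one_mul]
      have : (B - (A + 1)).val = n - 2 := by
        have e : B - (A + 1) = ((n - 2 : ℕ) : ZMod n) := by
          rw [Nat.cast_sub (by omega), ZMod.natCast_self, ← hB1]; push_cast; ring
        rw [e, ZMod.val_cast_of_lt (by omega)]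
      rw [hB1] at h
      exact ⟨by omega, rfl⟩
  rw [hrun.2, ← run_mul_run f hrun.1]
  linear_combination (run f (B + 1) A * run f s s') * hfull

/-- Among the polygons in the 4-fold cover with two turns and with given corners, at most one does not
contain all markings of a column. -/
lemma sum_liftTwoTurn {f g : ZMod n → R} (hf : ∏ l, f l = 0) (hg : ∏ l, g l = 0) (u : ZMod n → R)
    {A B : ZMod n} (hAB : A ≠ B) (s s' : ZMod n) :
    (∑ h ∈ Ioo 0 ((2 * n : ℕ) : ℤ), if s' = s + (h : ZMod n) then
      ∑ t ∈ Ico (0 : ℤ) (2 * n) ×ˢ Ico (0 : ℤ) (2 * n),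
        if 0 ≤ t.1 ∧ t.1 < t.2 ∧ t.2 < h ∧ s + (t.1 : ZMod n) = A ∧ s + (t.2 : ZMod n) = B then
          liftTwoTurn f u g s h t.1 t.2 else 0 else 0) =
      twoTurn (fun l => f l * u l) u (fun l => g l * u l) A B s s' := by
  have hA := ZMod.val_lt (A - s)
  have hB := ZMod.val_lt (B - (A + 1))
  have hs' := ZMod.val_lt (s' - (B + 1))
  -- the offsets of the turns and the height of the only polygon that may contribute; this height may
  -- exceed the bound `2 * n` of the cover, in which case `twoTurn_eq_zero` applies
  set t₀ : ℤ := ((A - s).val : ℤ) with ht₀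
  set t₁ : ℤ := t₀ + 1 + ((B - (A + 1)).val : ℤ) with ht₁
  set h₀ : ℤ := t₁ + 1 + ((s' - (B + 1)).val : ℤ) with hh₀
  have eA : s + (t₀ : ZMod n) = A := lift_spec s A
  have eA1 : s + ((t₀ + 1 : ℤ) : ZMod n) = A + 1 := by push_cast; rw [← eA]; ring
  have eB : s + (t₁ : ZMod n) = B := by
    rw [ht₁, Int.cast_add, ← add_assoc, eA1, lift_spec]
  have eB1 : s + ((t₁ + 1 : ℤ) : ZMod n) = B + 1 := by push_cast; rw [← eB]; ring
  have es' : s + (h₀ : ZMod n) = s' := by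
    rw [hh₀, Int.cast_add, ← add_assoc, eB1, lift_spec]
  have huniq : ∀ h t t' : ℤ, s' = s + (h : ZMod n) → 0 ≤ t → t < t' → t' < h →
      s + (t : ZMod n) = A → s + (t' : ZMod n) = B →
      liftTwoTurn f u g s h t t' ≠ 0 → t = t₀ ∧ t' = t₁ ∧ h = h₀ := by
    intro h t t' e1 e2 e3 e4 e5 e6 hne
    have htn : t < n := by
      by_contra hcon
      exact hne (by rw [liftTwoTurn, lrun_eq_zero hf s (a := 0) (by omega)]; ring)
    have htt : t = t₀ := exists_unique_lift e2 htn e5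
    have hhn : t' - (t + 1) < n := by
      by_contra hcon
      exact hne (by rw [liftTwoTurn, lrun_eq_zero hg s (a := t + 1) (by omega)]; ring)
    have htt' := exists_unique_lift (s := A + 1) (t := B) (a := t' - (t + 1)) (by omega) hhn (by
      rw [← e6, ← eA1, htt]; push_cast; ring)
    have hhn' : h - (t' + 1) < n := by
      by_contra hcon
      exact hne (by rw [liftTwoTurn, lrun_eq_zero hf s (a := t' + 1) (by omega)]; ring)
    have := exists_unique_lift (s := B + 1) (t := s') (a := h - (t' + 1)) (by omega) hhn' (by
      rw [e1, ← e6]; push_cast; ring)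
    omega
  have hval : liftTwoTurn f u g s h₀ t₀ t₁ =
      twoTurn (fun l => f l * u l) u (fun l => g l * u l) A B s s' := by
    rw [twoTurn, run_mul, run_mul, run_mul, liftTwoTurn,
      ← lrun_mul_lrun u s (show 0 ≤ t₀ by omega) (show t₀ ≤ h₀ by omega),
      ← lrun_mul_lrun u s (show t₀ ≤ t₀ + 1 by omega) (show t₀ + 1 ≤ h₀ by omega),
      ← lrun_mul_lrun u s (show t₀ + 1 ≤ t₁ by omega) (show t₁ ≤ h₀ by omega),
      ← lrun_mul_lrun u s (show t₁ ≤ t₁ + 1 by omega) (show t₁ + 1 ≤ h₀ by omega),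
      lrun_succ, lrun_succ, lrun_eq_run u s (by omega) (by omega),
      lrun_eq_run u s (by omega) (by omega), lrun_eq_run u s (by omega) (by omega),
      lrun_eq_run f s (by omega) (by omega), lrun_eq_run f s (by omega) (by omega),
      lrun_eq_run g s (by omega) (by omega), eA, eA1, eB, eB1, es']
    simp only [Int.cast_zero, add_zero]
    ring
  have hzero : h₀ ∉ Ioo 0 ((2 * n : ℕ) : ℤ) →
      twoTurn (fun l => f l * u l) u (fun l => g l * u l) A B s s' = 0 := by
    intro hcon
    refine twoTurn_eq_zero hf u g hAB ?_
    rw [mem_Ioo] at hcon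
    push_cast at hcon
    omega
  by_cases hmem : h₀ ∈ Ioo 0 ((2 * n : ℕ) : ℤ)
  · rw [sum_eq_single_of_mem h₀ hmem, if_pos es'.symm, sum_eq_single (t₀, t₁),
      if_pos ⟨by omega, by omega, by omega, eA, eB⟩, hval]
    · intro t _ hne
      rw [ite_eq_right_iff]
      rintro ⟨h1, h2, h3, h4, h5⟩
      by_contra hcon
      obtain ⟨e1, e2, -⟩ := huniq h₀ t.1 t.2 es'.symm h1 h2 h3 h4 h5 hcon
      exact hne (Prod.ext e1 e2)
    · intro hcon
      rw [mem_Ioo] at hmem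
      push_cast at hmem
      exact absurd (mem_product.2 ⟨mem_Ico.2 ⟨by omega, by omega⟩, mem_Ico.2
        ⟨by omega, by omega⟩⟩) hcon
    · intro h _ hne
      rw [ite_eq_right_iff]
      intro e1
      refine sum_eq_zero fun t _ => ?_
      rw [ite_eq_right_iff]
      rintro ⟨h1, h2, h3, h4, h5⟩
      by_contra hcon
      exact hne (huniq h t.1 t.2 e1 h1 h2 h3 h4 h5 hcon).2.2
  · rw [hzero hmem]
    refine sum_eq_zero fun h hh => ?_
    rw [ite_eq_right_iff]
    intro e1
    refine sum_eq_zero fun t _ => ?_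
    rw [ite_eq_right_iff]
    rintro ⟨h1, h2, h3, h4, h5⟩
    by_contra hcon
    exact hmem ((huniq h t.1 t.2 e1 h1 h2 h3 h4 h5 hcon).2.2 ▸ hh)

end Lifts

/-! ### Counting polygons by their corners -/

section Corners

variable {R : Type*} [CommRing R] {n : ℕ} [NeZero n]

/-- The product of the values of the squares with offsets in `S`. -/
def prodSq (F : ZMod n → ZMod n → R) (q : ZMod n × ZMod n) (S : Finset (ℤ × ℤ)) : R :=
  ∏ s ∈ S, F (q.1 + (s.1 : ZMod n)) (q.2 + (s.2 : ZMod n))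

variable {F : ZMod n → ZMod n → R}

lemma prodSq_union (q : ZMod n × ZMod n) {S T : Finset (ℤ × ℤ)} (h : ∀ a b, (a, b) ∈ S → (a, b) ∉ T) :
    prodSq F q (S ∪ T) = prodSq F q S * prodSq F q T :=
  prod_union (disjoint_left.2 fun p hp => h p.1 p.2 hp)

lemma prodSq_box (i s : ZMod n) (a b h₁ h₂ : ℤ) :
    prodSq F (i, s) (Ico a b ×ˢ Ico h₁ h₂) = lrun (fun l => lrun (fun k => F k l) i a b) s h₁ h₂ := by
  rw [prodSq, prod_product_right]; rfl

lemma prodSq_column (i s : ZMod n) (a h₁ h₂ : ℤ) :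
    prodSq F (i, s) ({a} ×ˢ Ico h₁ h₂) = lrun (F (i + (a : ZMod n))) s h₁ h₂ := by
  rw [prodSq, prod_product, prod_singleton]; rfl

lemma Ioo_eq_Ico_succ (a b : ℤ) : Ioo a b = Ico (a + 1) b := by
  ext l; simp only [mem_Ioo, mem_Ico]; omega

/-- A polygon that contains `n` consecutive squares of a row contains the `X`-marking of this row.
-/
lemma prodSq_box_eq_zero (hF : ∀ l, ∏ k, F k l = 0) (q : ZMod n × ZMod n) {S : Finset (ℤ × ℤ)} {a b l : ℤ}
    (h : a + n ≤ b) (hS : Ico a b ×ˢ {l} ⊆ S) : prodSq F q S = 0 := by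
  rw [prodSq, ← prod_sdiff hS]
  have : ∏ s ∈ Ico a b ×ˢ ({l} : Finset ℤ), F (q.1 + (s.1 : ZMod n)) (q.2 + (s.2 : ZMod n)) = 0 := by
    rw [prod_product_right, prod_singleton]
    exact lrun_eq_zero (f := fun k => F k (q.2 + (l : ZMod n))) (hF _) q.1 h
  rw [this, mul_zero]

/-- A rectangle leads to the state in which the rows of its two columns are exchanged. -/
lemma connects_iff {r : Rect n} {x y : GridState n} : r.Connects x y ↔
    x r.west = r.south ∧ x r.east = r.north ∧ y = x * Equiv.swap r.west r.east := by
  constructor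
  · rintro ⟨h1, h2, h3, h4, h5⟩
    refine ⟨h1, h2, Equiv.ext fun k => ?_⟩
    rw [Equiv.Perm.mul_apply]
    by_cases hw : k = r.west
    · rw [hw, Equiv.swap_apply_left, h2, h3]
    by_cases he : k = r.east
    · rw [he, Equiv.swap_apply_right, h1, h4]
    · rw [Equiv.swap_apply_of_ne_of_ne hw he, h5 k hw he]
  · rintro ⟨h1, h2, rfl⟩
    refine ⟨h1, h2, by simp [h2], by simp [h1], fun k hw he => ?_⟩
    rw [Equiv.Perm.mul_apply, Equiv.swap_apply_of_ne_of_ne hw he]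

open scoped Classical in
/-- Rectangles of width less than `n` are determined by the two columns of their corners and by
their height. -/
lemma sum_connects {N : ℕ} (hN : n ≤ N) (W : Rect n → R) (x : GridState n)
    (hW : ∀ (i s : ZMod n) (w h : ℤ), n ≤ w → 0 < h → W ((i, s), (w, h)) = 0) (f : GridState n → R) :
    ∑ y, (∑ r ∈ GridDiagram.allRects n N, if r.Connects x y then W r else 0) * f y =
      ∑ p ∈ (univ : Finset (ZMod n)).offDiag, (∑ h ∈ Ioo 0 (N : ℤ), if x p.2 = x p.1 + (h : ZMod n) then
        W ((p.1, x p.1), (((p.2 - p.1).val : ℤ), h)) else 0) * f (x * Equiv.swap p.1 p.2) := by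
  have step : ∑ y, (∑ r ∈ GridDiagram.allRects n N, if r.Connects x y then W r else 0) * f y =
      ∑ i : ZMod n, ∑ w ∈ Ioo 0 (N : ℤ), ∑ h ∈ Ioo 0 (N : ℤ),
        (if x (i + (w : ZMod n)) = x i + (h : ZMod n) then W ((i, x i), (w, h)) else 0) *
          f (x * Equiv.swap i (i + (w : ZMod n))) := by
    simp only [sum_mul]
    rw [sum_comm, GridDiagram.allRects, sum_product, ← univ_product_univ, sum_product]
    refine sum_congr rfl fun i _ => ?_
    rw [sum_eq_single (x i)]
    · rw [sum_product]
      refine sum_congr rfl fun w _ => sum_congr rfl fun h _ => ?_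
      rw [sum_eq_single (x * Equiv.swap i (i + (w : ZMod n)))]
      · congr 1
        refine if_congr ?_ rfl rfl
        rw [connects_iff]
        simp [Rect.west, Rect.south, Rect.east, Rect.north, Rect.width, Rect.height]
      · intro y _ hy
        rw [if_neg, zero_mul]
        rw [connects_iff]
        rintro ⟨-, -, h3⟩
        exact hy h3
      · simp
    · intro s _ hs
      refine sum_eq_zero fun q _ => sum_eq_zero fun y _ => ?_
      rw [if_neg, zero_mul]
      rintro ⟨h1, -⟩
      exact hs h1.symm
    · simp
  rw [step]
  have hoff : (univ : Finset (ZMod n)).offDiag =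
      (univ ×ˢ univ : Finset (ZMod n × ZMod n)).filter fun p => p.1 ≠ p.2 := by
    ext p; simp
  rw [hoff, sum_filter, sum_product]
  refine sum_congr rfl fun i _ => ?_
  rw [← sum_filter]
  refine (sum_of_injOn (fun j : ZMod n => ((j - i).val : ℤ)) ?_ ?_ ?_ ?_).symm
  · intro j _ k _ h
    have : (j - i).val = (k - i).val := Int.ofNat.inj h
    exact sub_left_injective (ZMod.val_injective n this)
  · intro j hj
    have hj : i ≠ j := by simpa using hj
    have h1 := ZMod.val_lt (j - i)
    have h2 : (j - i).val ≠ 0 := by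
      rw [Ne, ZMod.val_eq_zero, sub_eq_zero]; exact hj.symm
    simp only [coe_Ioo, Set.mem_Ioo]
    omega
  · intro w hw hne
    rw [mem_Ioo] at hw
    refine sum_eq_zero fun h hh => ?_
    rw [mem_Ioo] at hh
    split_ifs with hx
    · rw [hW _ _ _ _ ?_ hh.1, zero_mul]
      by_contra hcon
      push Not at hcon
      refine hne ⟨i + (w : ZMod n), ?_, ?_⟩
      · simp only [coe_filter, mem_univ, true_and, Set.mem_ofPred_eq, ne_eq, left_eq_add]
        intro h0
        lift w to ℕ using hw.1.le
        rw [Int.cast_natCast, ZMod.natCast_eq_zero_iff] at h0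
        exact absurd (Nat.le_of_dvd (by omega) h0) (by omega)
      · exact (exists_unique_lift hw.1.le hcon rfl).symm
    · rw [zero_mul]
  · intro j _
    rw [sum_mul]
    simp only [lift_spec]

/-- Among the rectangles with given corners in the 4-fold cover, only the one of height less than
`n` does not contain all markings of a column. -/
lemma sum_lrun {u : ZMod n → R} (hu : ∏ l, u l = 0) {s s' : ZMod n} (hs : s ≠ s') :
    (∑ h ∈ Ioo 0 ((2 * n : ℕ) : ℤ), if s' = s + (h : ZMod n) then lrun u s 0 h else 0) = run u s s' := by
  have hlt := ZMod.val_lt (s' - s)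
  have hpos : (s' - s).val ≠ 0 := by rw [Ne, ZMod.val_eq_zero, sub_eq_zero]; exact hs.symm
  rw [sum_eq_single ((s' - s).val : ℤ), if_pos (lift_spec s s').symm,
    lrun_eq_run u s (by omega) (by omega), lift_spec, Int.cast_zero, add_zero]
  · intro h hh hne
    rw [mem_Ioo] at hh
    rw [ite_eq_right_iff]
    intro e
    refine lrun_eq_zero hu s ?_
    by_contra hcon
    exact hne (exists_unique_lift hh.1.le (by omega) e.symm)
  · intro hcon
    exact absurd (mem_Ioo.2 ⟨by omega, by push_cast; omega⟩) hcon

open scoped Classical in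
/-- Rectangles in the 4-fold cover are counted by `rectOp`. -/
lemma sum_rects (hF : IsGridVal F) (f : GridState n → R) (x : GridState n) :
    ∑ y, (∑ r ∈ GridDiagram.allRects n (2 * n), if r.Connects x y then prodSq F r.1 r.squares else 0) * f y =
      rectOp F f x := by
  rw [sum_connects (by omega) _ x, rectOp]
  · refine sum_congr rfl fun p hp => ?_
    have hp : p.1 ≠ p.2 := by simpa using hp
    congr 1
    rw [rectAway, ← sum_lrun (prod_arc_eq_zero hF hp) (x.injective.ne hp)]
    refine sum_congr rfl fun h _ => if_congr Iff.rfl ?_ rfl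
    have hlt := ZMod.val_lt (p.2 - p.1)
    rw [Rect.squares, prodSq_box]
    congr 1
    funext l
    simp only [Rect.width]
    rw [lrun_eq_run _ _ (by omega) (by omega), lift_spec, Int.cast_zero, add_zero, arc]
  · intro i s w h hw hh
    refine prodSq_box_eq_zero hF.row _ (a := 0) (b := w) (l := 0) (by omega) ?_
    intro p
    simp only [Rect.squares, mem_product, mem_Ico, mem_singleton, Rect.width, Rect.height]
    omega

lemma sum_offDiag_of_mem {c : ZMod n} {g : ZMod n × ZMod n → R} (e w : ZMod n → R)
    (h : ∀ p : ZMod n × ZMod n, p.1 ≠ p.2 → g p = (if p.2 = c then e p.1 else 0) + if p.1 = c then w p.2 else 0) :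
    ∑ p ∈ (univ : Finset (ZMod n)).offDiag, g p = ∑ i ∈ univ.erase c, (w i + e i) := by
  have hoff : (univ : Finset (ZMod n)).offDiag =
      (univ ×ˢ univ : Finset (ZMod n × ZMod n)).filter fun p => p.1 ≠ p.2 := by
    ext p; simp
  rw [hoff, sum_filter, sum_congr rfl (g := fun p : ZMod n × ZMod n =>
    (if p.2 = c then if p.1 ≠ c then e p.1 else 0 else 0) +
      if p.1 = c then if p.2 ≠ c then w p.2 else 0 else 0)]
  · rw [sum_add_distrib, sum_product, sum_product, sum_comm (s := univ) (t := univ)]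
    simp only [sum_ite_irrel, sum_const_zero, sum_ite_eq', mem_univ, if_true]
    rw [sum_add_distrib, add_comm, ← sum_filter, ← sum_filter]
    have : (univ : Finset (ZMod n)).filter (fun i => i ≠ c) = univ.erase c := by ext; simp
    rw [this]
  · rintro ⟨i, j⟩ -
    by_cases hij : i = j
    · subst hij
      by_cases hi : i = c <;> simp [hi]
    · simp only [ne_eq, hij, not_false_eq_true, if_true]
      rw [h _ hij]
      congr 1
      · by_cases hj : j = c
        · subst hj; simp [hij]
        · simp [hj]
      · by_cases hi : i = c
        · subst hi; simp [Ne.symm hij]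
        · simp [hi]

end Corners

section Corners

variable {R : Type*} [CommRing R] {n : ℕ} [NeZero n] {F : ZMod n → ZMod n → R}

lemma prodSq_pent_east {i c : ZMod n} (hi : i ≠ c) (s : ZMod n) (h t : ℤ) :
    prodSq F (i, s) (Pent.squares (((i, s), (((c - i).val : ℤ), h)), (true, t))) =
      liftTurn (F c) (arc F i (c - 1)) (F (c - 1)) s h t := by
  have hlt := ZMod.val_lt (c - i)
  have hpos : (c - i).val ≠ 0 := by rw [Ne, ZMod.val_eq_zero, sub_eq_zero]; exact hi.symm
  simp only [Pent.squares, Pent.rect, Pent.brokenEast, Pent.turn, Rect.width, Rect.height, if_true]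
  rw [prodSq_union, prodSq_union, prodSq_box, Ioo_eq_Ico_succ, prodSq_column, prodSq_column, lift_spec,
    liftTurn]
  · have e : i + (((((c - i).val : ℤ) - 1 : ℤ)) : ZMod n) = c - 1 := by
      rw [Int.cast_sub, ← add_sub_assoc, lift_spec, Int.cast_one]
    rw [e, mul_assoc, mul_comm (lrun (F c) _ _ _)]
    congr 2
    funext l
    rw [lrun_eq_run _ _ (by omega) (by omega), e, Int.cast_zero, add_zero, arc]
  all_goals
    intro a b
    simp only [mem_union, mem_product, mem_Ico, mem_Ioo, mem_singleton]
    omega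

lemma prodSq_pent_west {j c : ZMod n} (hj : c ≠ j) (s : ZMod n) (h t : ℤ) :
    prodSq F (c, s) (Pent.squares (((c, s), (((j - c).val : ℤ), h)), (false, t))) =
      liftTurn (F c) (arc F (c + 1) j) (F (c - 1)) s h t := by
  have hlt := ZMod.val_lt (j - c)
  have hpos : (j - c).val ≠ 0 := by rw [Ne, ZMod.val_eq_zero, sub_eq_zero]; exact hj.symm
  simp only [Pent.squares, Pent.rect, Pent.brokenEast, Pent.turn, Rect.width, Rect.height,
    Bool.false_eq_true, if_false]
  rw [prodSq_union, prodSq_union, prodSq_box, Ioo_eq_Ico_succ, prodSq_column, prodSq_column, liftTurn]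
  · have e : c + ((-1 : ℤ) : ZMod n) = c - 1 := by push_cast; ring
    rw [e, Int.cast_zero, add_zero, mul_assoc, mul_comm (lrun (F c) _ _ _)]
    congr 2
    funext l
    rw [lrun_eq_run _ _ (by omega) (by omega), lift_spec, Int.cast_one, arc]
  all_goals
    intro a b
    simp only [mem_union, mem_product, mem_Ico, mem_Ioo, mem_singleton]
    omega

lemma prodSq_hexa_east {i c : ZMod n} (hi : i ≠ c) (s : ZMod n) (h : ℤ) {t t' : ℤ} (h1 : t < t') :
    prodSq F (i, s) (Hexa.squares (((i, s), (((c - i).val : ℤ), h)), (true, (t, t')))) =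
      liftTwoTurn (F (c - 1)) (arc F i (c - 1)) (F c) s h t t' := by
  have hlt := ZMod.val_lt (c - i)
  have hpos : (c - i).val ≠ 0 := by rw [Ne, ZMod.val_eq_zero, sub_eq_zero]; exact hi.symm
  simp only [Hexa.squares, Hexa.rect, Hexa.brokenEast, Hexa.lower, Hexa.upper, Rect.width, Rect.height,
    if_true]
  rw [product_union, prodSq_union, prodSq_union, prodSq_union, prodSq_box, Ioo_eq_Ico_succ, Ioo_eq_Ico_succ,
    prodSq_column, prodSq_column, prodSq_column, lift_spec, liftTwoTurn]
  · have e : i + (((((c - i).val : ℤ) - 1 : ℤ)) : ZMod n) = c - 1 := by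
      rw [Int.cast_sub, ← add_sub_assoc, lift_spec, Int.cast_one]
    have e' : (fun l => lrun (fun k => F k l) i 0 (((c - i).val : ℤ) - 1)) = arc F i (c - 1) := by
      funext l
      rw [lrun_eq_run _ _ (by omega) (by omega), e, Int.cast_zero, add_zero, arc]
    rw [e, e']
    ring
  all_goals
    intro a b
    simp only [mem_union, mem_product, mem_Ico, mem_Ioo, mem_singleton]
    omega

lemma prodSq_hexa_west {j c : ZMod n} (hj : c ≠ j) (s : ZMod n) (h : ℤ) {t t' : ℤ} (h1 : t < t') :
    prodSq F (c, s) (Hexa.squares (((c, s), (((j - c).val : ℤ), h)), (false, (t, t')))) =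
      liftTwoTurn (F c) (arc F (c + 1) j) (F (c - 1)) s h t t' := by
  have hlt := ZMod.val_lt (j - c)
  have hpos : (j - c).val ≠ 0 := by rw [Ne, ZMod.val_eq_zero, sub_eq_zero]; exact hj.symm
  simp only [Hexa.squares, Hexa.rect, Hexa.brokenEast, Hexa.lower, Hexa.upper, Rect.width, Rect.height,
    Bool.false_eq_true, if_false]
  rw [product_union, prodSq_union, prodSq_union, prodSq_union, prodSq_box, Ioo_eq_Ico_succ, Ioo_eq_Ico_succ,
    prodSq_column, prodSq_column, prodSq_column, liftTwoTurn]
  · have e : c + ((-1 : ℤ) : ZMod n) = c - 1 := by push_cast; ring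
    have e' : (fun l => lrun (fun k => F k l) c 1 ((j - c).val : ℤ)) = arc F (c + 1) j := by
      funext l
      rw [lrun_eq_run _ _ (by omega) (by omega), lift_spec, Int.cast_one, arc]
    rw [e, e', Int.cast_zero, add_zero]
    ring
  all_goals
    intro a b
    simp only [mem_union, mem_product, mem_Ico, mem_Ioo, mem_singleton]
    omega

/-- The conditions on the position of a pentagon relative to the crossing point in row `A`. -/
def PentAt (c A : ZMod n) (p : Pent n) : Prop :=
  p.rect.west ≠ p.rect.east ∧ (if p.brokenEast then p.rect.east = c else p.rect.west = c) ∧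
    p.turn ∈ Ico 0 p.rect.height ∧ p.rect.south + (p.turn : ZMod n) = A

/-- The conditions on the position of a hexagon relative to the crossing points. -/
def HexaAt (c A B : ZMod n) (h : Hexa n) : Prop :=
  h.rect.west ≠ h.rect.east ∧ 0 ≤ h.lower ∧ h.lower < h.upper ∧ h.upper < h.rect.height ∧
    (if h.brokenEast then
      h.rect.east = c ∧ h.rect.south + (h.lower : ZMod n) = B ∧ h.rect.south + (h.upper : ZMod n) = A
    else
      h.rect.west = c ∧ h.rect.south + (h.lower : ZMod n) = A ∧ h.rect.south + (h.upper : ZMod n) = B)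

open scoped Classical in
/-- Pentagons in the 4-fold cover are counted by their corners: the other column `i` of the corners is
west or east of the broken side. -/
lemma sum_pents (hF : IsGridVal F) (c A : ZMod n) (f : GridState n → R) (x : GridState n) :
    ∑ y, (∑ r ∈ GridDiagram.allRects n (2 * n), if r.Connects x y then
      ∑ bt ∈ (univ : Finset Bool) ×ˢ Ico 0 (2 * n : ℤ),
        if PentAt c A (r, bt) then prodSq F r.1 (Pent.squares (r, bt)) else 0 else 0) * f y =
      crossOp c (pentW F c A) f x := by
  rw [sum_connects (by omega) _ x, crossOp, sum_offDiag_of_mem (c := c)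
    (fun i => turn (fun l => F c l * arc F i (c - 1) l) (arc F i (c - 1))
      (fun l => F (c - 1) l * arc F i (c - 1) l) A (x i) (x c) * f (x * Equiv.swap c i))
    (fun i => turn (fun l => F c l * arc F (c + 1) i l) (arc F (c + 1) i)
      (fun l => F (c - 1) l * arc F (c + 1) i l) A (x c) (x i) * f (x * Equiv.swap c i))]
  · refine sum_congr rfl fun i _ => ?_
    rw [← add_mul, Equiv.swap_comm c i]; rfl
  · rintro ⟨i, j⟩ hij
    have hij : i ≠ j := hij
    have hji := hij.symm
    rw [← sum_liftTurn (hF.col c) (hF.col (c - 1)), ← sum_liftTurn (hF.col c) (hF.col (c - 1))]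
    simp only [PentAt, sum_product, Fintype.sum_bool, Pent.rect, Pent.brokenEast, Pent.turn, Rect.east,
      Rect.west, Rect.width, Rect.south, Rect.height, lift_spec, if_true, Bool.false_eq_true, if_false]
    by_cases hjc : j = c
    · subst hjc
      simp only [hij, ne_eq, not_false_eq_true, true_and, if_true, if_false, false_and, add_zero,
        sum_const_zero, prodSq_pent_east hij]
      rw [Equiv.swap_comm j i]
    · by_cases hic : i = c
      · subst hic
        simp only [hij, hji, ne_eq, not_false_eq_true, true_and, if_true, if_false, false_and, zero_add,
          sum_const_zero, prodSq_pent_west hij]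
      · simp [hic, hjc]
  · rintro i s w h hw hh
    refine sum_eq_zero fun bt _ => ?_
    rw [ite_eq_right_iff]
    rintro ⟨hne, -, -⟩
    -- For `w = n` the two vertical sides would lie on the same circle, and for `w > n` even the part of
    -- the polygon away from the broken side contains a whole row.
    have hw' : w ≠ n := by
      rintro rfl
      exact hne (by simp [Pent.rect, Rect.east, Rect.west, Rect.width])
    obtain ⟨b, t⟩ := bt
    cases b
    · refine prodSq_box_eq_zero hF.row _ (a := 1) (b := w) (l := 0) (by omega) ?_
      intro p
      simp only [Pent.squares, Pent.brokenEast, Pent.rect, Rect.width, Rect.height, mem_union,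
        mem_product, mem_Ico, mem_singleton, Bool.false_eq_true, if_false]
      omega
    · refine prodSq_box_eq_zero hF.row _ (a := 0) (b := w - 1) (l := 0) (by omega) ?_
      intro p
      simp only [Pent.squares, Pent.brokenEast, Pent.rect, Rect.width, Rect.height, mem_union,
        mem_product, mem_Ico, mem_singleton, if_true]
      omega

open scoped Classical in
/-- Hexagons in the 4-fold cover are counted by their corners. -/
lemma sum_hexas (hF : IsGridVal F) {c A B : ZMod n} (hAB : A ≠ B) (f : GridState n → R) (x : GridState n) :
    ∑ y, (∑ r ∈ GridDiagram.allRects n (2 * n), if r.Connects x y then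
      ∑ bt ∈ (univ : Finset Bool) ×ˢ (Ico 0 (2 * n : ℤ) ×ˢ Ico 0 (2 * n : ℤ)),
        if HexaAt c A B (r, bt) then prodSq F r.1 (Hexa.squares (r, bt)) else 0 else 0) * f y =
      crossOp c (hexW F c A B) f x := by
  rw [sum_connects (by omega) _ x, crossOp, sum_offDiag_of_mem (c := c)
    (fun i => twoTurn (fun l => F (c - 1) l * arc F i (c - 1) l) (arc F i (c - 1))
      (fun l => F c l * arc F i (c - 1) l) B A (x i) (x c) * f (x * Equiv.swap c i))
    (fun i => twoTurn (fun l => F c l * arc F (c + 1) i l) (arc F (c + 1) i)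
      (fun l => F (c - 1) l * arc F (c + 1) i l) A B (x c) (x i) * f (x * Equiv.swap c i))]
  · refine sum_congr rfl fun i _ => ?_
    rw [← add_mul, Equiv.swap_comm c i]; rfl
  · rintro ⟨i, j⟩ hij
    have hij : i ≠ j := hij
    have hji := hij.symm
    rw [← sum_liftTwoTurn (hF.col (c - 1)) (hF.col c) _ hAB.symm,
      ← sum_liftTwoTurn (hF.col c) (hF.col (c - 1)) _ hAB]
    simp only [HexaAt, sum_product (univ : Finset Bool), Fintype.sum_bool, Hexa.rect, Hexa.brokenEast,
      Hexa.lower, Hexa.upper, Rect.east,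
      Rect.west, Rect.width, Rect.south, Rect.height, lift_spec, if_true, Bool.false_eq_true, if_false]
    by_cases hjc : j = c
    · subst hjc
      simp only [hij, ne_eq, not_false_eq_true, true_and, if_true, if_false, false_and, and_false, add_zero,
        sum_const_zero]
      rw [Equiv.swap_comm j i]
      congr 1
      refine sum_congr rfl fun h _ => if_congr Iff.rfl (sum_congr rfl fun t _ => ?_) rfl
      split_ifs with ht
      · exact prodSq_hexa_east hij _ _ ht.2.1
      · rfl
    · by_cases hic : i = c
      · subst hic
        simp only [hij, hji, ne_eq, not_false_eq_true, true_and, if_true, if_false, false_and, and_false,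
          zero_add, sum_const_zero]
        congr 1
        refine sum_congr rfl fun h _ => if_congr Iff.rfl (sum_congr rfl fun t _ => ?_) rfl
        split_ifs with ht
        · exact prodSq_hexa_west hij _ _ ht.2.1
        · rfl
      · simp [hic, hjc]
  · rintro i s w h hw hh
    refine sum_eq_zero fun bt _ => ?_
    rw [ite_eq_right_iff]
    rintro ⟨hne, -, -⟩
    -- For `w = n` the two vertical sides would lie on the same circle, and for `w > n` even the part of
    -- the polygon away from the broken side contains a whole row.
    have hw' : w ≠ n := by
      rintro rfl
      exact hne (by simp [Hexa.rect, Rect.east, Rect.west, Rect.width])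
    obtain ⟨b, t, t'⟩ := bt
    cases b
    · refine prodSq_box_eq_zero hF.row _ (a := 1) (b := w) (l := 0) (by omega) ?_
      intro p
      simp only [Hexa.squares, Hexa.brokenEast, Hexa.rect, Rect.width, Rect.height, mem_union,
        mem_product, mem_Ico, mem_singleton, Bool.false_eq_true, if_false]
      omega
    · refine prodSq_box_eq_zero hF.row _ (a := 0) (b := w - 1) (l := 0) (by omega) ?_
      intro p
      simp only [Hexa.squares, Hexa.brokenEast, Hexa.rect, Rect.width, Rect.height, mem_union,
        mem_product, mem_Ico, mem_singleton, if_true]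
      omega

end Corners

/-! ### The maps after specializing `v` to `1` -/

section Specialize

variable {n : ℕ} [NeZero n]

/-- The specialization `v = 1` of `𝔽[V_1, …, V_n, v]`. -/
noncomputable def setOne (n : ℕ) : BaseRing n →ₐ[ZMod 2] BaseRing n :=
  MvPolynomial.aeval fun o => o.elim 1 fun i => MvPolynomial.X (some i)

/-- The value of the square in column `k` and row `l`: zero if it contains an `X`-marking, and otherwise
the product of the variables of the `O`-markings in it. -/
noncomputable def gridVal (G : GridDiagram n) (k l : ZMod n) : BaseRing n :=
  if G.x k = l then 0 else ∏ i, if G.oCol i = k ∧ G.oRow i = l then MvPolynomial.X (some i) else 1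

variable (G : GridDiagram n)

lemma setOne_weight (q : ZMod n × ZMod n) (S : Finset (ℤ × ℤ)) (m : ℕ) :
    setOne n (G.weight q S m) = ∏ s ∈ S, ∏ i, if G.oCol i = q.1 + (s.1 : ZMod n) ∧
      G.oRow i = q.2 + (s.2 : ZMod n) then MvPolynomial.X (some i) else 1 := by
  rw [GridDiagram.weight, map_mul, map_pow, map_prod, setOne, MvPolynomial.aeval_X, Option.elim_none,
    one_pow, mul_one, prod_comm]
  refine prod_congr rfl fun i _ => ?_
  rw [map_pow, MvPolynomial.aeval_X, Option.elim_some, GridDiagram.oMult, prod_ite, prod_const,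
    prod_const_one, mul_one]

open scoped Classical in
/-- At `v = 1`, the weight of a region without `X`-markings is the product of the values of its squares,
and a region with an `X`-marking has value zero. -/
lemma setOne_weight_xFree (q : ZMod n × ZMod n) (S : Finset (ℤ × ℤ)) (m : ℕ) :
    (if G.XFree q S then setOne n (G.weight q S m) else 0) = prodSq (gridVal G) q S := by
  rw [setOne_weight, prodSq]
  split_ifs with h
  · refine prod_congr rfl fun s hs => ?_
    rw [gridVal, if_neg (h s hs)]
  · rw [GridDiagram.XFree] at h
    push Not at h
    obtain ⟨s, hs, h⟩ := h
    exact (prod_eq_zero hs (by rw [gridVal, if_pos h])).symm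

lemma isGridVal_gridVal : IsGridVal (gridVal G) where
  col k := prod_eq_zero (mem_univ (G.x k)) (by simp [gridVal])
  row l := prod_eq_zero (mem_univ (G.x.symm l)) (by simp [gridVal])

lemma gridVal_eq_one {k l : ZMod n} (hx : G.x k ≠ l) (ho : G.o k ≠ l) : gridVal G k l = 1 := by
  rw [gridVal, if_neg hx]
  refine prod_eq_one fun i _ => if_neg ?_
  rintro ⟨rfl, rfl⟩
  exact ho (by simp [GridDiagram.o])

variable {G} {G' : GridDiagram n} {c A B : ZMod n}

lemma gridVal_interchange (h : G.ColumnInterchange G' c) : gridVal G' = swapVal (gridVal G) c := by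
  obtain ⟨h1, h2, h3⟩ := h
  funext k l
  rw [swapVal, gridVal, gridVal, h3 k]
  refine if_congr Iff.rfl rfl (prod_congr rfl fun i _ => if_congr ?_ rfl rfl)
  rw [h1, h2, Equiv.swap_apply_eq_iff]

lemma interchange_o (h : G.ColumnInterchange G' c) (k : ZMod n) :
    G'.o k = G.o (Equiv.swap (c - 1) c k) := by
  obtain ⟨h1, h2, -⟩ := h
  obtain ⟨i, rfl⟩ := G'.oCol.surjective k
  rw [h1, Equiv.swap_apply_self, ← h1]
  simp [GridDiagram.o, h2]

lemma interchange_symm (h : G.ColumnInterchange G' c) : G'.ColumnInterchange G c := by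
  obtain ⟨h1, h2, h3⟩ := h
  exact ⟨fun i => by rw [h1, Equiv.swap_apply_self], fun i => (h2 i).symm,
    fun k => by rw [h3, Equiv.swap_apply_self]⟩

lemma isDrawing_interchange (h : G.ColumnInterchange G' c) (hd : G.IsDrawing c A B) :
    G'.IsDrawing c B A where
  ne := hd.ne.symm
  x_east := by rw [h.2.2, Equiv.swap_apply_right]; exact hd.x_west
  o_east := by rw [interchange_o h, Equiv.swap_apply_right]; exact hd.o_west
  x_west := by rw [h.2.2, Equiv.swap_apply_left]; exact hd.x_east
  o_west := by rw [interchange_o h, Equiv.swap_apply_left]; exact hd.o_east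

/-- The distance of `l` from `A` exceeds the one from `A + 1` by one, unless `l = A`, where the
latter distance is `n - 1`. -/
lemma val_sub_eq {A l : ZMod n} (h : l ≠ A) : (l - A).val = (l - (A + 1)).val + 1 := by
  have := val_sub_succ_lt h.symm
  have e : l - A = (((l - (A + 1)).val + 1 : ℕ) : ZMod n) := by
    push_cast; rw [ZMod.natCast_zmod_val]; ring
  rw [e, ZMod.val_cast_of_lt this]

/-- The arcs between the rows `A` and `B`, in terms of the distance from `A + 1`. -/
lemma inArc_iff (h : A ≠ B) {l : ZMod n} : GridDiagram.InArc A B l ↔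
    l = A ∨ (l - (A + 1)).val ≤ (B - (A + 1)).val := by
  rw [GridDiagram.InArc]
  by_cases hl : l = A
  · simp [hl]
  · rw [val_sub_eq hl, val_sub_eq h.symm]
    simp [hl]

lemma inArc_iff' (h : A ≠ B) {l : ZMod n} : GridDiagram.InArc B A l ↔
    (B - (A + 1)).val ≤ (l - (A + 1)).val := by
  have hA := val_sub_succ_self A
  have hB := val_sub_succ_lt h
  have hl := ZMod.val_lt (l - (A + 1))
  rw [GridDiagram.InArc]
  have e : l - B = (l - (A + 1)) - (B - (A + 1)) := by ring
  have e' : A - B = (A - (A + 1)) - (B - (A + 1)) := by ring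
  have e'' : (A - B).val = n - 1 - (B - (A + 1)).val := by rw [e', ZMod.val_sub (by omega), hA]
  rw [e'']
  rcases le_or_gt (B - (A + 1)).val (l - (A + 1)).val with hle | hlt
  · rw [e, ZMod.val_sub hle]
    omega
  · have e2 : l - B = (((l - (A + 1)).val + n - (B - (A + 1)).val : ℕ) : ZMod n) := by
      rw [Nat.cast_sub (by omega), Nat.cast_add, ZMod.natCast_zmod_val, ZMod.natCast_zmod_val,
        ZMod.natCast_self]
      ring
    rw [e2, ZMod.val_cast_of_lt (by omega)]
    omega

lemma isDrawnVal_gridVal (hd : G.IsDrawing c A B) : IsDrawnVal (gridVal G) c A B where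
  ne := hd.ne
  west l hl := by
    have h1 := (inArc_iff' hd.ne).1 hd.x_west
    have h2 := (inArc_iff' hd.ne).1 hd.o_west
    refine gridVal_eq_one G ?_ ?_ <;> rintro rfl <;> omega
  east l hA hl := by
    have h1 := (inArc_iff hd.ne).1 hd.x_east
    have h2 := (inArc_iff hd.ne).1 hd.o_east
    refine gridVal_eq_one G ?_ ?_ <;> rintro rfl
    · exact absurd (h1.resolve_left hA) (by omega)
    · exact absurd (h2.resolve_left hA) (by omega)

/-- The matrix entry of `L` from `x` to `y`. -/
noncomputable def entry (L : GC n →ₗ[BaseRing n] GC n) (x y : GridState n) : BaseRing n := L (Pi.single x 1) y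

/-- The transpose of `L` after the specialization `v = 1`: it sends the function `f` on grid states to the
function whose value at `x` is the pairing of `f` with the image of `x`. -/
noncomputable def dualOp (L : GC n →ₗ[BaseRing n] GC n) (f : GridState n → BaseRing n) (x : GridState n) :
    BaseRing n :=
  ∑ y, setOne n (entry L x y) * f y

lemma entry_linearMapOf (C : GridState n → GridState n → BaseRing n) (x y : GridState n) :
    entry (GridDiagram.linearMapOf C) x y = C x y := by
  rw [entry, GridDiagram.linearMapOf, Fintype.linearCombination_apply, Fintype.sum_eq_single x]
  · simp [Finset.sum_apply, Pi.single_apply]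
  · intro z hz; simp [hz]

/-- The differential at `v = 1` is the operator of the rectangle weights. -/
lemma dualOp_bdry4 (f : GridState n → BaseRing n) :
    dualOp G.bdry4 f = rectOp (gridVal G) f := by
  classical
  funext x
  rw [dualOp, ← sum_rects (isGridVal_gridVal G)]
  refine sum_congr rfl fun y _ => ?_
  rw [GridDiagram.bdry4, entry_linearMapOf, map_sum, sum_filter]
  congr 1
  refine sum_congr rfl fun r _ => ?_
  rw [← setOne_weight_xFree G _ _ (r.mult x y), ite_and]

lemma ite_sum_zero {ι M : Type*} [AddCommMonoid M] (s : Finset ι) (P : Prop) [Decidable P] (g : ι → M) :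
    ∑ i ∈ s, (if P then g i else 0) = if P then ∑ i ∈ s, g i else 0 := by
  split_ifs <;> simp

/-- The pentagon map at `v = 1` is the operator of the pentagon weights. -/
lemma dualOp_pentMap (f : GridState n → BaseRing n) :
    dualOp (G.pentMap c A) f = crossOp c (pentW (gridVal G) c A) f := by
  classical
  funext x
  rw [dualOp, ← sum_pents (isGridVal_gridVal G)]
  refine sum_congr rfl fun y _ => ?_
  rw [GridDiagram.pentMap, entry_linearMapOf, map_sum, sum_filter, sum_product]
  congr 1
  refine sum_congr rfl fun r _ => ?_
  rw [← ite_sum_zero]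
  refine sum_congr rfl fun p _ => ?_
  rw [← setOne_weight_xFree G _ _ (r.mult x y), ← ite_and, ← ite_and]
  refine if_congr ?_ rfl rfl
  rw [Pent.Connects, PentAt, Pent.rect]

/-- The hexagon map at `v = 1` is the operator of the hexagon weights. -/
lemma dualOp_hexMap (hAB : A ≠ B) (f : GridState n → BaseRing n) :
    dualOp (G.hexMap c A B) f = crossOp c (hexW (gridVal G) c A B) f := by
  classical
  funext x
  rw [dualOp, ← sum_hexas (isGridVal_gridVal G) hAB]
  refine sum_congr rfl fun y _ => ?_
  rw [GridDiagram.hexMap, entry_linearMapOf, map_sum, sum_filter, sum_product]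
  congr 1
  refine sum_congr rfl fun r _ => ?_
  rw [← ite_sum_zero]
  refine sum_congr rfl fun p _ => ?_
  rw [← setOne_weight_xFree G _ _ (r.mult x y), ← ite_and, ← ite_and]
  refine if_congr ?_ rfl rfl
  rw [Hexa.Connects, HexaAt, Hexa.rect]

end Specialize

/-! ### The Maslov function as a translation-invariant form -/

section Saw

variable {n : ℕ} [NeZero n]

/-- The sawtooth function `t ↦ 1 - 2t / n` on the circle of length `n`, evaluated at `t + 1/2`. -/
def hsaw (t : ZMod n) : ℚ := 1 - (2 * (t.val : ℚ) + 1) / n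

/-- The sawtooth function at integers; it vanishes at the jump. -/
def saw (t : ZMod n) : ℚ := (hsaw t + hsaw (t - 1)) / 2

lemma cast_ne_zero' : (n : ℚ) ≠ 0 := Nat.cast_ne_zero.2 (NeZero.ne n)

/-- The sawtooth function decreases linearly, except for one jump. -/
lemma hsaw_sub_hsaw (t : ZMod n) : hsaw t - hsaw (t - 1) = (if t = 0 then 2 else 0) - 2 / n := by
  have hn : (n : ℚ) ≠ 0 := cast_ne_zero'
  have hpos := NeZero.pos n
  rw [hsaw, hsaw]
  split_ifs with h
  · have h1 := val_sub_succ_self (0 : ZMod n)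
    rw [zero_add] at h1
    rw [h, h1, ZMod.val_zero, Nat.cast_sub (by omega)]
    field_simp
    push_cast
    ring
  · have h1 := val_sub_eq h
    rw [sub_zero, zero_add] at h1
    rw [h1]
    field_simp
    push_cast
    ring

lemma hsaw_reflect (t : ZMod n) : hsaw (-t - 1) = -hsaw t := by
  have hn : (n : ℚ) ≠ 0 := cast_ne_zero'
  have hlt := ZMod.val_lt t
  have e : -t - 1 = ((n - 1 - t.val : ℕ) : ZMod n) := by
    rw [Nat.cast_sub (by omega), Nat.cast_sub (by omega), ZMod.natCast_zmod_val, ZMod.natCast_self]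
    push_cast; ring
  rw [hsaw, hsaw, e, ZMod.val_cast_of_lt (by omega), Nat.cast_sub (by omega), Nat.cast_sub (by omega)]
  field_simp
  push_cast
  ring

lemma saw_neg (t : ZMod n) : saw (-t) = -saw t := by
  have h1 := hsaw_reflect t
  have h2 := hsaw_reflect (t - 1)
  rw [show -(t - 1) - 1 = -t by ring] at h2
  rw [saw, saw, h1, h2]; ring

lemma sum_hsaw : ∑ t : ZMod n, hsaw t = 0 := by
  have h : ∑ t : ZMod n, hsaw t = ∑ t : ZMod n, hsaw (-t - 1) :=
    (Fintype.sum_equiv (Equiv.subLeft (-1 : ZMod n)) _ _ fun t => by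
      rw [Equiv.subLeft_apply]; congr 1; ring)
  simp only [hsaw_reflect, sum_neg_distrib] at h
  linarith

lemma sum_hsaw_sub (a : ZMod n) : ∑ t : ZMod n, hsaw (t - a) = 0 := by
  rw [← sum_hsaw (n := n)]
  exact Fintype.sum_equiv (Equiv.subRight a) _ _ fun t => rfl

lemma sum_hsaw_sub' (a : ZMod n) : ∑ t : ZMod n, hsaw (a - t) = 0 := by
  rw [← sum_hsaw (n := n)]
  exact Fintype.sum_equiv (Equiv.subLeft a) _ _ fun t => rfl

lemma sum_saw_sub (a : ZMod n) : ∑ t : ZMod n, saw (t - a) = 0 := by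
  simp only [saw, sub_sub]
  rw [← sum_div, sum_add_distrib, sum_hsaw_sub, sum_hsaw_sub, add_zero, zero_div]

lemma sum_saw_sub' (a : ZMod n) : ∑ t : ZMod n, saw (a - t) = 0 := by
  have : ∀ t, saw (a - t) = -saw (t - a) := fun t => by rw [← saw_neg, neg_sub]
  simp only [this, sum_neg_distrib, sum_saw_sub, neg_zero]

/-- The number of times that the rows with offsets `a`, …, `b - 1` from `s` meet the row `m`. -/
lemma count_eq (s m : ZMod n) {a b : ℤ} (hab : a ≤ b) :
    ∑ l ∈ Ico a b, (if m = s + (l : ZMod n) then (1 : ℚ) else 0) =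
      (hsaw (m - s - (a : ZMod n)) - hsaw (m - s - (b : ZMod n))) / 2 + (b - a) / n := by
  induction b, hab using Int.leInduction with
  | base => simp
  | succ b hab ih =>
    have h : insert b (Ico a b) = Ico a (b + 1) := by
      ext l; simp only [mem_insert, mem_Ico]; omega
    rw [← h, sum_insert (by simp), ih]
    have h1 := hsaw_sub_hsaw (m - s - (b : ZMod n))
    have h2 : m = s + (b : ZMod n) ↔ m - s - (b : ZMod n) = 0 := by
      rw [sub_eq_zero, sub_eq_iff_eq_add']
    simp only [← h2] at h1
    have h3 : m - s - ((b + 1 : ℤ) : ZMod n) = m - s - (b : ZMod n) - 1 := by push_cast; ring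
    rw [h3]
    have hn : (n : ℚ) ≠ 0 := cast_ne_zero'
    split_ifs at h1 ⊢ <;> (push_cast; linear_combination (-1 / 2) * h1)

/-- The sawtooth function in terms of the order on the fundamental domain. -/
lemma hsaw_sub_eq (k l : ZMod n) : hsaw (l - k) =
    2 * (if k.val ≤ l.val then 1 else 0) - 1 - (2 * ((l.val : ℚ) - k.val) + 1) / n := by
  have hn : (n : ℚ) ≠ 0 := cast_ne_zero'
  have h1 := ZMod.val_lt k
  have h2 := ZMod.val_lt l
  rw [hsaw]
  split_ifs with h
  · rw [ZMod.val_sub h, Nat.cast_sub h]; ring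
  · have e : l - k = ((n + l.val - k.val : ℕ) : ZMod n) := by
      rw [Nat.cast_sub (by omega), Nat.cast_add, ZMod.natCast_zmod_val, ZMod.natCast_zmod_val,
        ZMod.natCast_self]
      ring
    rw [e, ZMod.val_cast_of_lt (by omega), Nat.cast_sub (by omega)]
    field_simp
    push_cast
    ring

lemma saw_sub_eq (k l : ZMod n) : saw (l - k) =
    (if k.val ≤ l.val then 1 else 0) - (if l.val ≤ k.val then 1 else 0) -
      2 * ((l.val : ℚ) - k.val) / n := by
  have h1 := hsaw_reflect (k - l)
  rw [neg_sub] at h1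
  rw [saw, h1, hsaw_sub_eq, hsaw_sub_eq]
  ring

/-- The self-pairing of a set of points, one in each column. -/
def sawForm (x : Equiv.Perm (ZMod n)) : ℚ := ∑ k, ∑ l, saw (l - k) * saw (x l - x k)

/-- The pairing of a set of points with a set of markings. -/
def hsawForm (mk x : Equiv.Perm (ZMod n)) : ℚ := ∑ k, ∑ l, hsaw (l - k) * hsaw (mk l - x k)

/-- The moment `∑ k · x(k)`. The moments of the state and of the markings measure how the terms of the
Maslov function fail to be translation-invariant, and they cancel. -/
def momentSum (x : Equiv.Perm (ZMod n)) : ℚ := ∑ k, (k.val : ℚ) * (x k).val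

lemma sum_saw_mul_sub (x : Equiv.Perm (ZMod n)) :
    ∑ k, ∑ l, saw (l - k) * (((x l).val : ℚ) - (x k).val) = 0 := by
  simp only [mul_sub, sum_sub_distrib]
  rw [sum_comm]
  simp only [← sum_mul, sum_saw_sub, sum_saw_sub', zero_mul, sum_const_zero, sub_zero]

lemma sum_hsaw_mul_sub (mk x : Equiv.Perm (ZMod n)) :
    ∑ k, ∑ l, hsaw (l - k) * (((mk l).val : ℚ) - (x k).val + 1 / 2) = 0 := by
  have : ∀ k l, hsaw (l - k) * (((mk l).val : ℚ) - (x k).val + 1 / 2) =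
      hsaw (l - k) * ((mk l).val : ℚ) - hsaw (l - k) * (((x k).val : ℚ) - 1 / 2) := fun k l => by ring
  simp only [this, sum_sub_distrib]
  rw [sum_comm]
  simp only [← sum_mul, sum_hsaw_sub, sum_hsaw_sub', zero_mul, sum_const_zero, sub_zero]

lemma sum_perm (x : Equiv.Perm (ZMod n)) : ∑ k, ((x k).val : ℚ) = ∑ k : ZMod n, (k.val : ℚ) :=
  Equiv.sum_comp x fun k : ZMod n => (k.val : ℚ)

lemma sum_sub_mul_sub (mk x : Equiv.Perm (ZMod n)) (e : ℚ) :
    ∑ k : ZMod n, ∑ l : ZMod n, ((l.val : ℚ) - k.val + e) * (((mk l).val : ℚ) - (x k).val + e) =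
      n * momentSum mk + n * momentSum x - 2 * (∑ k : ZMod n, (k.val : ℚ)) ^ 2 + n ^ 2 * e ^ 2 := by
  set T := ∑ k : ZMod n, (k.val : ℚ) with hT
  have h : ∀ k l : ZMod n, ((l.val : ℚ) - k.val + e) * (((mk l).val : ℚ) - (x k).val + e) =
      (l.val : ℚ) * (mk l).val + (k.val : ℚ) * (x k).val - (l.val : ℚ) * (x k).val -
        (k.val : ℚ) * (mk l).val + e * l.val - e * k.val + e * (mk l).val - e * (x k).val + e ^ 2 :=
    fun k l => by ring
  have h1 : ∑ k : ZMod n, ∑ l : ZMod n, (l.val : ℚ) * ((x k).val : ℚ) = T ^ 2 := by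
    simp only [← sum_mul]
    rw [← mul_sum, sum_perm, sq]
  have h2 : ∑ k : ZMod n, ∑ l : ZMod n, (k.val : ℚ) * ((mk l).val : ℚ) = T ^ 2 := by
    simp only [← mul_sum]
    rw [← sum_mul, sum_perm, sq]
  simp only [h, sum_add_distrib, sum_sub_distrib, h1, h2, sum_const, card_univ, ZMod.card, nsmul_eq_mul,
    momentSum]
  simp only [← mul_sum, sum_perm]
  ring

/-- The number of pairs of points of a state in south-west position. The product of two signs is
expanded by `saw_sub_eq`; the mixed terms sum to zero by `sum_saw_mul_sub`. -/
lemma sum_sign_mul_sign (x : Equiv.Perm (ZMod n)) :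
    4 * (#{p : ZMod n × ZMod n | p.1.val < p.2.val ∧ (x p.1).val < (x p.2).val} : ℚ) =
      sawForm x + 8 / n * momentSum x - 8 / n ^ 2 * (∑ k : ZMod n, (k.val : ℚ)) ^ 2 + n ^ 2 - n := by
  have hn : (n : ℚ) ≠ 0 := cast_ne_zero'
  have h1 : ∀ k l : ZMod n,
      2 * (if k.val < l.val ∧ (x k).val < (x l).val then (1 : ℚ) else 0) +
        2 * (if l.val < k.val ∧ (x l).val < (x k).val then (1 : ℚ) else 0) - 1 +
        (if k = l then 1 else 0) =
      saw (l - k) * saw (x l - x k) + 2 / n * (saw (l - k) * (((x l).val : ℚ) - (x k).val)) +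
        2 / n * (saw (x l - x k) * ((l.val : ℚ) - k.val)) +
        4 / n ^ 2 * (((l.val : ℚ) - k.val + 0) * (((x l).val : ℚ) - (x k).val + 0)) := by
    intro k l
    have e : saw (l - k) * saw (x l - x k) + 2 / n * (saw (l - k) * (((x l).val : ℚ) - (x k).val)) +
        2 / n * (saw (x l - x k) * ((l.val : ℚ) - k.val)) +
        4 / n ^ 2 * (((l.val : ℚ) - k.val + 0) * (((x l).val : ℚ) - (x k).val + 0)) =
        (saw (l - k) + 2 * ((l.val : ℚ) - k.val) / n) *
          (saw (x l - x k) + 2 * (((x l).val : ℚ) - (x k).val) / n) := by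
      field_simp; ring
    rw [e, saw_sub_eq, saw_sub_eq, sub_add_cancel, sub_add_cancel]
    by_cases hkl : k = l
    · subst hkl; simp
    · have h2 : k.val ≠ l.val := fun h => hkl (ZMod.val_injective n h)
      have h3 : (x k).val ≠ (x l).val := fun h => hkl (x.injective (ZMod.val_injective n h))
      rw [if_neg hkl]
      rcases h2.lt_or_gt with h2 | h2 <;> rcases h3.lt_or_gt with h3 | h3 <;>
        simp [h2, h3, h2.le, h3.le, not_lt.2 h2.le, not_lt.2 h3.le, not_le.2 h2, not_le.2 h3] <;> norm_num
  have h2 := sum_congr rfl fun (k : ZMod n) (_ : k ∈ univ) =>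
    sum_congr rfl fun (l : ZMod n) (_ : l ∈ univ) => h1 k l
  have h3 : ∑ k : ZMod n, ∑ l : ZMod n, saw (x l - x k) * ((l.val : ℚ) - k.val) = 0 := by
    have := sum_saw_mul_sub x.symm
    rw [← Equiv.sum_comp x] at this
    rw [← this]
    refine sum_congr rfl fun k _ => ?_
    exact Fintype.sum_equiv x _ _ fun l => by simp
  have h4 : (#{p : ZMod n × ZMod n | p.1.val < p.2.val ∧ (x p.1).val < (x p.2).val} : ℚ) =
      ∑ k : ZMod n, ∑ l : ZMod n, if k.val < l.val ∧ (x k).val < (x l).val then (1 : ℚ) else 0 := by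
    rw [card_filter, Nat.cast_sum, Fintype.sum_prod_type]
    push_cast
    rfl
  have h5 : ∑ k : ZMod n, ∑ l : ZMod n, (if l.val < k.val ∧ (x l).val < (x k).val then (1 : ℚ) else 0) =
      ∑ k : ZMod n, ∑ l : ZMod n, if k.val < l.val ∧ (x k).val < (x l).val then (1 : ℚ) else 0 :=
    sum_comm
  simp only [sum_add_distrib, sum_sub_distrib, ← mul_sum, h5, ← h4, sum_saw_mul_sub, h3,
    sum_sub_mul_sub, sum_const, card_univ, ZMod.card, nsmul_eq_mul, sum_ite_eq, mem_univ, if_true] at h2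
  rw [sawForm]
  have : (4 : ℚ) / n ^ 2 * (n * momentSum x + n * momentSum x) = 8 / n * momentSum x := by
    field_simp; ring
  linear_combination h2 + this

/-- The number of pairs of a point of a state and a marking in south-west position. Markings are
shifted by one half in both directions from the points with the same coordinates, so that the
inequality is weak where the point is the first one of the pair and strict where the marking is. -/
lemma sum_sign_mul_sign' (mk x : Equiv.Perm (ZMod n)) :
    2 * ((#{p : ZMod n × ZMod n | p.1.val ≤ p.2.val ∧ (x p.1).val ≤ (mk p.2).val} : ℚ) +
        #{p : ZMod n × ZMod n | p.1.val < p.2.val ∧ (mk p.1).val < (x p.2).val}) =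
      hsawForm mk x + 4 / n * (momentSum x + momentSum mk) -
        8 / n ^ 2 * (∑ k : ZMod n, (k.val : ℚ)) ^ 2 + 1 + n ^ 2 := by
  have hn : (n : ℚ) ≠ 0 := cast_ne_zero'
  have h1 : ∀ k l : ZMod n,
      2 * (if k.val ≤ l.val ∧ (x k).val ≤ (mk l).val then (1 : ℚ) else 0) +
        2 * (if l.val < k.val ∧ (mk l).val < (x k).val then (1 : ℚ) else 0) - 1 =
      hsaw (l - k) * hsaw (mk l - x k) + 2 / n * (hsaw (l - k) * (((mk l).val : ℚ) - (x k).val + 1 / 2)) +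
        2 / n * (hsaw (mk l - x k) * ((l.val : ℚ) - k.val + 1 / 2)) +
        4 / n ^ 2 * (((l.val : ℚ) - k.val + 1 / 2) * (((mk l).val : ℚ) - (x k).val + 1 / 2)) := by
    intro k l
    have e : hsaw (l - k) * hsaw (mk l - x k) +
        2 / n * (hsaw (l - k) * (((mk l).val : ℚ) - (x k).val + 1 / 2)) +
        2 / n * (hsaw (mk l - x k) * ((l.val : ℚ) - k.val + 1 / 2)) +
        4 / n ^ 2 * (((l.val : ℚ) - k.val + 1 / 2) * (((mk l).val : ℚ) - (x k).val + 1 / 2)) =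
        (hsaw (l - k) + (2 * ((l.val : ℚ) - k.val) + 1) / n) *
          (hsaw (mk l - x k) + (2 * (((mk l).val : ℚ) - (x k).val) + 1) / n) := by
      field_simp; ring
    rw [e, hsaw_sub_eq, hsaw_sub_eq, sub_add_cancel, sub_add_cancel]
    rcases le_or_gt k.val l.val with h2 | h2 <;> rcases le_or_gt (x k).val (mk l).val with h3 | h3 <;>
      simp [h2, h3, not_lt.2, not_le.2] <;> norm_num
  have h2 := sum_congr rfl fun (k : ZMod n) (_ : k ∈ univ) =>
    sum_congr rfl fun (l : ZMod n) (_ : l ∈ univ) => h1 k l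
  have h3 : ∑ k : ZMod n, ∑ l : ZMod n, hsaw (mk l - x k) * ((l.val : ℚ) - k.val + 1 / 2) = 0 := by
    have := sum_hsaw_mul_sub mk.symm x.symm
    rw [← Equiv.sum_comp x] at this
    rw [← this]
    refine sum_congr rfl fun k _ => ?_
    exact Fintype.sum_equiv mk _ _ fun l => by simp
  have h4 : (#{p : ZMod n × ZMod n | p.1.val ≤ p.2.val ∧ (x p.1).val ≤ (mk p.2).val} : ℚ) =
      ∑ k : ZMod n, ∑ l : ZMod n, if k.val ≤ l.val ∧ (x k).val ≤ (mk l).val then (1 : ℚ) else 0 := by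
    rw [card_filter, Nat.cast_sum, Fintype.sum_prod_type]
    push_cast
    rfl
  have h5 : (#{p : ZMod n × ZMod n | p.1.val < p.2.val ∧ (mk p.1).val < (x p.2).val} : ℚ) =
      ∑ k : ZMod n, ∑ l : ZMod n, if l.val < k.val ∧ (mk l).val < (x k).val then (1 : ℚ) else 0 := by
    rw [card_filter, Nat.cast_sum, Fintype.sum_prod_type, sum_comm]
    push_cast
    rfl
  simp only [sum_add_distrib, sum_sub_distrib, ← mul_sum, ← h5, ← h4, sum_hsaw_mul_sub, h3,
    sum_sub_mul_sub, sum_const, card_univ, ZMod.card, nsmul_eq_mul] at h2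
  rw [hsawForm]
  have : (4 : ℚ) / n ^ 2 * (n * momentSum mk + n * momentSum x + n ^ 2 * (1 / 2) ^ 2) =
      4 / n * (momentSum x + momentSum mk) + 1 := by
    field_simp; ring
  linear_combination h2 + this

/-- Up to a constant that depends on `n` only, the Maslov function is a translation-invariant
quadratic form. -/
lemma maslovOf_eq (mk : Equiv.Perm (ZMod n)) (x : GridState n) :
    (GridDiagram.maslovOf mk x : ℚ) =
      (sawForm x - 2 * hsawForm mk x + sawForm mk) / 4 + (1 - (n : ℚ) / 2 - 1 / 2) := by
  have h1 := sum_sign_mul_sign x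
  have h2 := sum_sign_mul_sign mk
  have h3 := sum_sign_mul_sign' mk x
  rw [GridDiagram.maslovOf]
  push_cast
  linear_combination h1 / 4 + h2 / 4 - h3 / 2

end Saw

/-! ### The Maslov function and polygons -/

section Maslov

variable {n : ℕ} [NeZero n]

/-- Exchanging two values changes a sum along a permutation by a second difference. -/
lemma sum_sub_sum_swap (φ : ZMod n → ZMod n → ℚ) (x : Equiv.Perm (ZMod n)) {i j : ZMod n} (hij : i ≠ j) :
    ∑ k, φ k (x k) - ∑ k, φ k ((x * Equiv.swap i j) k) =
      φ i (x i) + φ j (x j) - φ i (x j) - φ j (x i) := by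
  have h : ∀ k ∈ univ, k ∉ ({i, j} : Finset (ZMod n)) → φ k (x k) - φ k ((x * Equiv.swap i j) k) = 0 := by
    intro k _ hk
    simp only [mem_insert, mem_singleton, not_or] at hk
    rw [Equiv.Perm.mul_apply, Equiv.swap_apply_of_ne_of_ne hk.1 hk.2, sub_self]
  rw [← sum_sub_distrib, ← sum_subset (subset_univ _) h, sum_pair hij, Equiv.Perm.mul_apply,
    Equiv.Perm.mul_apply, Equiv.swap_apply_left, Equiv.swap_apply_right]
  ring

lemma hsawForm_sub_state (mk x : Equiv.Perm (ZMod n)) {i j : ZMod n} (hij : i ≠ j) :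
    hsawForm mk x - hsawForm mk (x * Equiv.swap i j) =
      ∑ k, (hsaw (k - i) - hsaw (k - j)) * (hsaw (mk k - x i) - hsaw (mk k - x j)) := by
  rw [hsawForm, hsawForm, sum_comm, sum_comm (γ := ZMod n) (f := fun k l => hsaw (l - k) *
    hsaw (mk l - (x * Equiv.swap i j) k)), ← sum_sub_distrib]
  refine sum_congr rfl fun l _ => ?_
  rw [sum_sub_sum_swap (fun k v => hsaw (l - k) * hsaw (mk l - v)) x hij]
  ring

lemma hsawForm_sub_markings (mk x : Equiv.Perm (ZMod n)) {i j : ZMod n} (hij : i ≠ j) :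
    hsawForm mk x - hsawForm (mk * Equiv.swap i j) x =
      ∑ k, (hsaw (i - k) - hsaw (j - k)) * (hsaw (mk i - x k) - hsaw (mk j - x k)) := by
  rw [hsawForm, hsawForm, ← sum_sub_distrib]
  refine sum_congr rfl fun k _ => ?_
  rw [sum_sub_sum_swap (fun l v => hsaw (l - k) * hsaw (v - x k)) mk hij]
  ring

lemma sawForm_sub (x : Equiv.Perm (ZMod n)) {i j : ZMod n} (hij : i ≠ j) :
    sawForm x - sawForm (x * Equiv.swap i j) =
      ∑ k, (saw (k - i) - saw (k - j)) * (saw (x k - x i) - saw (x k - x j)) +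
        ∑ k, (saw (k - i) - saw (k - j)) *
          (saw ((x * Equiv.swap i j) k - x i) - saw ((x * Equiv.swap i j) k - x j)) := by
  set y := x * Equiv.swap i j with hy
  have h1 : sawForm x - ∑ k, ∑ l, saw (l - k) * saw (y l - x k) =
      ∑ k, (saw (k - i) - saw (k - j)) * (saw (x k - x i) - saw (x k - x j)) := by
    rw [sawForm, ← sum_sub_distrib]
    refine sum_congr rfl fun k _ => ?_
    rw [hy, sum_sub_sum_swap (fun l v => saw (l - k) * saw (v - x k)) x hij, ← neg_sub k i, ← neg_sub k j,
      ← neg_sub (x k) (x i), ← neg_sub (x k) (x j), saw_neg, saw_neg, saw_neg, saw_neg]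
    ring
  have h2 : (∑ k, ∑ l, saw (l - k) * saw (y l - x k)) - sawForm y =
      ∑ k, (saw (k - i) - saw (k - j)) * (saw (y k - x i) - saw (y k - x j)) := by
    rw [sawForm, sum_comm, sum_comm (γ := ZMod n) (f := fun k l => saw (l - k) * saw (y l - y k)),
      ← sum_sub_distrib]
    refine sum_congr rfl fun l _ => ?_
    rw [hy, sum_sub_sum_swap (fun k v => saw (l - k) * saw (y l - v)) x hij]
    ring
  rw [← h1, ← h2]
  ring

/-- The number of the given squares that contain a marking. -/
def count (mk : Equiv.Perm (ZMod n)) (q : ZMod n × ZMod n) (S : Finset (ℤ × ℤ)) : ℚ :=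
  ∑ s ∈ S, if mk (q.1 + (s.1 : ZMod n)) = q.2 + (s.2 : ZMod n) then 1 else 0

lemma count_union (mk : Equiv.Perm (ZMod n)) (q : ZMod n × ZMod n) {S T : Finset (ℤ × ℤ)}
    (h : ∀ a b, (a, b) ∈ S → (a, b) ∉ T) : count mk q (S ∪ T) = count mk q S + count mk q T :=
  sum_union (disjoint_left.2 fun p hp => h p.1 p.2 hp)

lemma count_column (mk : Equiv.Perm (ZMod n)) (i s : ZMod n) (k : ℤ) {a b : ℤ} (h : a ≤ b) :
    count mk (i, s) ({k} ×ˢ Ico a b) =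
      (hsaw (mk (i + (k : ZMod n)) - s - (a : ZMod n)) - hsaw (mk (i + (k : ZMod n)) - s - (b : ZMod n))) / 2 +
        (b - a) / n := by
  rw [count, sum_product, sum_singleton, ← count_eq s _ h]

lemma sum_ite_mul_ite (z : Equiv.Perm (ZMod n)) (a b : ZMod n) :
    (∑ k, (if k = a then (1 : ℚ) else 0) * if z k = b then 1 else 0) = if z a = b then 1 else 0 := by
  simp only [ite_mul, one_mul, zero_mul, sum_ite_eq', mem_univ, if_true]

lemma sum_mul_offsets (f g : ZMod n → ℚ) (hf : ∑ k, f k = 0) (hg : ∑ k, g k = 0) (z : Equiv.Perm (ZMod n))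
    (a b : ℚ) : ∑ k, (f k + a) * (g (z k) + b) = ∑ k, f k * g (z k) + n * (a * b) := by
  have hg' : ∑ k, g (z k) = 0 := by rw [Equiv.sum_comp z g, hg]
  have : ∀ k, (f k + a) * (g (z k) + b) = f k * g (z k) + f k * b + a * g (z k) + a * b := fun k => by ring
  simp only [this, sum_add_distrib, ← sum_mul, ← mul_sum, hf, hg', sum_const, card_univ, ZMod.card,
    nsmul_eq_mul]
  ring

/-- The number of markings in a rectangle, possibly wrapping around the torus, in terms of the
sawtooth function. -/
lemma count_box (mk : Equiv.Perm (ZMod n)) (i s : ZMod n) {w h : ℤ} (hw : 0 ≤ w) (hh : 0 ≤ h) :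
    count mk (i, s) (Ico 0 w ×ˢ Ico 0 h) =
      (∑ k, (hsaw (k - i) - hsaw (k - (i + (w : ZMod n)))) *
        (hsaw (mk k - s) - hsaw (mk k - (s + (h : ZMod n))))) / 4 + w * h / n := by
  have hn : (n : ℚ) ≠ 0 := cast_ne_zero'
  have h1 : count mk (i, s) (Ico 0 w ×ˢ Ico 0 h) =
      ∑ k, (∑ a ∈ Ico 0 w, if k = i + (a : ZMod n) then (1 : ℚ) else 0) *
        ∑ b ∈ Ico 0 h, if mk k = s + (b : ZMod n) then (1 : ℚ) else 0 := by
    simp only [sum_mul_sum]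
    symm
    rw [count, sum_product, sum_comm]
    refine sum_congr rfl fun a _ => ?_
    rw [sum_comm]
    refine sum_congr rfl fun b _ => ?_
    rw [sum_ite_mul_ite]
  have h2 := sum_mul_offsets (fun k => (hsaw (k - i) - hsaw (k - (i + (w : ZMod n)))) / 2)
    (fun k => (hsaw (k - s) - hsaw (k - (s + (h : ZMod n)))) / 2)
    (by rw [← sum_div, sum_sub_distrib, sum_hsaw_sub, sum_hsaw_sub]; norm_num)
    (by rw [← sum_div, sum_sub_distrib, sum_hsaw_sub, sum_hsaw_sub]; norm_num) mk (w / n) (h / n)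
  rw [h1]
  simp only [count_eq _ _ hw, count_eq _ _ hh, Int.cast_zero, sub_zero, sub_sub _ i, sub_sub _ s, add_zero]
  rw [h2, sum_div]
  congr 1
  · exact sum_congr rfl fun k _ => by ring
  · field_simp

/-- The average multiplicity in the direction of one factor of the torus. -/
lemma sum_average (i k : ZMod n) {w : ℤ} (hw : 0 ≤ w) :
    ∑ a ∈ Ico 0 w, ∑ e ∈ ({0, 1} : Finset ℤ), (if k = i + ((a + e : ℤ) : ZMod n) then (1 : ℚ) else 0) =
      saw (k - i) - saw (k - (i + (w : ZMod n))) + 2 * w / n := by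
  have h : ∀ a : ℤ, ∑ e ∈ ({0, 1} : Finset ℤ), (if k = i + ((a + e : ℤ) : ZMod n) then (1 : ℚ) else 0) =
      (if k = i + (a : ZMod n) then (1 : ℚ) else 0) + if k = i + 1 + (a : ZMod n) then (1 : ℚ) else 0 := by
    intro a
    rw [sum_pair (by norm_num), add_zero]
    congr 1
    refine if_congr ?_ rfl rfl
    rw [Int.cast_add, Int.cast_one, add_comm (a : ZMod n), add_assoc]
  simp only [h, sum_add_distrib, count_eq _ _ hw, saw]
  rw [show k - (i + 1) - ((0 : ℤ) : ZMod n) = k - i - 1 by push_cast; ring,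
    show k - (i + 1) - (w : ZMod n) = k - (i + (w : ZMod n)) - 1 by ring,
    show k - i - ((0 : ℤ) : ZMod n) = k - i by push_cast; ring,
    show k - i - (w : ZMod n) = k - (i + (w : ZMod n)) by ring]
  push_cast
  ring

lemma pointMeasure_eq_sum (r : Rect n) (x : GridState n) :
    r.pointMeasure x = (∑ k,
      (∑ a ∈ Ico 0 r.width, ∑ e ∈ ({0, 1} : Finset ℤ),
        if k = r.west + ((a + e : ℤ) : ZMod n) then (1 : ℚ) else 0) *
      ∑ b ∈ Ico 0 r.height, ∑ e ∈ ({0, 1} : Finset ℤ),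
        if x k = r.south + ((b + e : ℤ) : ZMod n) then (1 : ℚ) else 0) / 4 := by
  simp only [sum_mul_sum]
  symm
  rw [Rect.pointMeasure, Rect.squares, sum_product, sum_comm, sum_div]
  refine sum_congr rfl fun a _ => ?_
  rw [sum_comm, sum_div]
  refine sum_congr rfl fun b _ => ?_
  rw [sum_comm, sum_div]
  refine sum_congr rfl fun e _ => ?_
  rw [sum_comm, sum_div]
  refine sum_congr rfl fun f _ => ?_
  rw [sum_ite_mul_ite]
  split_ifs <;> simp

/-- The number of points in a rectangle, counted with their average multiplicity, in terms of the
sawtooth function. -/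
lemma pointMeasure_eq (r : Rect n) (hw : 0 ≤ r.width) (hh : 0 ≤ r.height) (x : GridState n) :
    r.pointMeasure x = (∑ k, (saw (k - r.west) - saw (k - r.east)) *
      (saw (x k - r.south) - saw (x k - r.north))) / 4 + r.width * r.height / n := by
  have hn : (n : ℚ) ≠ 0 := cast_ne_zero'
  have h2 := sum_mul_offsets (fun k => saw (k - r.west) - saw (k - r.east))
    (fun k => saw (k - r.south) - saw (k - r.north))
    (by rw [sum_sub_distrib, sum_saw_sub, sum_saw_sub, sub_self])
    (by rw [sum_sub_distrib, sum_saw_sub, sum_saw_sub, sub_self]) x (2 * r.width / n) (2 * r.height / n)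
  rw [pointMeasure_eq_sum]
  simp only [sum_average _ _ hw, sum_average _ _ hh]
  rw [Rect.east, Rect.north] at h2 ⊢
  rw [h2]
  field_simp
  ring

/-- The change of the Maslov function along a rectangle. -/
lemma maslovOf_sub_maslovOf (mk : Equiv.Perm (ZMod n)) {r : Rect n} {x y : GridState n}
    (hr : r.Connects x y) (hne : r.west ≠ r.east) (hw : 0 ≤ r.width) (hh : 0 ≤ r.height) :
    (GridDiagram.maslovOf mk x : ℚ) - GridDiagram.maslovOf mk y =
      r.pointMeasure x + r.pointMeasure y - 2 * count mk r.1 r.squares := by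
  obtain ⟨h1, h2, h3⟩ := connects_iff.1 hr
  have e1 := sawForm_sub x hne
  have e2 := hsawForm_sub_state mk x hne
  rw [← h3] at e1 e2
  rw [h1, h2] at e1 e2
  have e3 : count mk r.1 r.squares = _ := count_box mk r.west r.south hw hh
  rw [maslovOf_eq, maslovOf_eq, pointMeasure_eq r hw hh, pointMeasure_eq r hw hh, e3]
  rw [Rect.east, Rect.north] at *
  linear_combination e1 / 4 - e2 / 2

/-- In the direction of one factor of the torus, the two sides of a rectangle are hit by the same
odd number of halves of squares. -/
lemma sum_average_corner {i j : ZMod n} (hij : i ≠ j) {w : ℤ} (hw : 0 ≤ w) (hj : j = i + (w : ZMod n)) :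
    ∃ N : ℕ, ∑ a ∈ Ico 0 w, ∑ e ∈ ({0, 1} : Finset ℤ),
        (if i = i + ((a + e : ℤ) : ZMod n) then (1 : ℚ) else 0) = 2 * N + 1 ∧
      ∑ a ∈ Ico 0 w, ∑ e ∈ ({0, 1} : Finset ℤ),
        (if j = i + ((a + e : ℤ) : ZMod n) then (1 : ℚ) else 0) = 2 * N + 1 := by
  have hn : (n : ℚ) ≠ 0 := cast_ne_zero'
  refine ⟨∑ a ∈ Ico 0 w, if j = i + (a : ZMod n) then 1 else 0, ?_, ?_⟩
  all_goals
    push_cast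
    simp only [← Int.cast_add]
    rw [sum_average _ _ hw, count_eq _ _ hw, ← hj]
    have h1 := saw_neg (j - i)
    have h3 := hsaw_sub_hsaw (j - i)
    have h4 := hsaw_sub_hsaw (0 : ZMod n)
    rw [if_neg (sub_ne_zero.2 hij.symm)] at h3
    rw [if_pos rfl] at h4
    rw [show j - i - (w : ZMod n) = 0 by rw [hj]; ring, Int.cast_zero, sub_zero]
    rw [neg_sub] at h1
  · have h2 := hsaw_reflect (0 : ZMod n)
    rw [neg_zero] at h2
    rw [h1]
    simp only [saw, sub_self]
    push_cast
    linear_combination (1 / 2) * h4 - (1 / 2) * h3 + h2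
  · simp only [saw, sub_self]
    push_cast
    linear_combination (1 / 2) * h4 - (1 / 2) * h3

/-- Circles other than those of the sides are hit by an even number of halves of squares. -/
lemma sum_average_even {i j k : ZMod n} (hi : k ≠ i) (hj : k ≠ j) {w : ℤ} (hw : 0 ≤ w)
    (h : j = i + (w : ZMod n)) :
    ∃ N : ℕ, ∑ a ∈ Ico 0 w, ∑ e ∈ ({0, 1} : Finset ℤ),
        (if k = i + ((a + e : ℤ) : ZMod n) then (1 : ℚ) else 0) = 2 * N := by
  refine ⟨∑ a ∈ Ico 0 w, if k = i + (a : ZMod n) then 1 else 0, ?_⟩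
  push_cast
  simp only [← Int.cast_add]
  rw [sum_average _ _ hw, count_eq _ _ hw, ← h]
  have h3 := hsaw_sub_hsaw (k - i)
  have h4 := hsaw_sub_hsaw (k - j)
  rw [if_neg (sub_ne_zero.2 hi)] at h3
  rw [if_neg (sub_ne_zero.2 hj)] at h4
  rw [Int.cast_zero, sub_zero, show k - i - (w : ZMod n) = k - j by rw [h]; ring]
  simp only [saw]
  push_cast
  linear_combination (1 / 2) * h4 - (1 / 2) * h3

/-- The multiplicity of a rectangle is a natural number, without rounding: twice the corners
contribute odd numbers, and every other point contributes the same even amount for both states. -/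
lemma two_mul_mult_add_one {r : Rect n} {x y : GridState n}
    (hr : r.Connects x y) (hne : r.west ≠ r.east) (hw : 0 ≤ r.width) (hh : 0 ≤ r.height) :
    2 * (r.mult x y : ℚ) + 1 = r.pointMeasure x + r.pointMeasure y := by
  suffices h : ∃ m : ℕ, r.pointMeasure x + r.pointMeasure y = 2 * m + 1 by
    obtain ⟨m, hm⟩ := h
    rw [Rect.mult, hm, show ((2 * (m : ℚ) + 1 - 1) / 2) = m by ring, Nat.floor_natCast]
  obtain ⟨h1, h2, h3, h4, h5⟩ := hr
  have hne' : r.south ≠ r.north := by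
    rw [← h1, ← h2]; exact x.injective.ne hne
  rw [pointMeasure_eq_sum, pointMeasure_eq_sum, ← add_div, ← sum_add_distrib]
  set X : ZMod n → ℚ := fun k => ∑ a ∈ Ico 0 r.width, ∑ e ∈ ({0, 1} : Finset ℤ),
        if k = r.west + ((a + e : ℤ) : ZMod n) then (1 : ℚ) else 0 with hX
  set Y : ZMod n → ℚ := fun k => ∑ b ∈ Ico 0 r.height, ∑ e ∈ ({0, 1} : Finset ℤ),
        if k = r.south + ((b + e : ℤ) : ZMod n) then (1 : ℚ) else 0 with hY
  change ∃ m : ℕ, (∑ k, (X k * Y (x k) + X k * Y (y k))) / 4 = _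
  obtain ⟨N, hN1, hN2⟩ : ∃ N : ℕ, X r.west = 2 * N + 1 ∧ X r.east = 2 * N + 1 :=
    sum_average_corner hne hw rfl
  obtain ⟨L, hL1, hL2⟩ : ∃ L : ℕ, Y r.south = 2 * L + 1 ∧ Y r.north = 2 * L + 1 :=
    sum_average_corner hne' hh rfl
  have hrest : ∀ k ∈ (univ.erase r.west).erase r.east,
      ∃ m : ℕ, X k * Y (x k) + X k * Y (y k) = 8 * m := by
    intro k hk
    simp only [mem_erase, mem_univ, and_true] at hk
    obtain ⟨N, hN⟩ : ∃ N : ℕ, X k = 2 * N := sum_average_even hk.2 hk.1 hw rfl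
    have hk1 : x k ≠ r.south := by rw [← h1]; exact x.injective.ne hk.2
    have hk2 : x k ≠ r.north := by rw [← h2]; exact x.injective.ne hk.1
    obtain ⟨L, hL⟩ : ∃ L : ℕ, Y (x k) = 2 * L := sum_average_even hk1 hk2 hh rfl
    refine ⟨N * L, ?_⟩
    rw [h5 k hk.2 hk.1, hN, hL]
    push_cast; ring
  choose! m hm using hrest
  refine ⟨∑ k ∈ (univ.erase r.west).erase r.east, m k + (2 * N * L + N + L), ?_⟩
  rw [← add_sum_erase _ _ (mem_univ r.west), ← add_sum_erase _ _ (show r.east ∈ univ.erase r.west by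
    simp [hne.symm]), sum_congr rfl hm, h1, h2, h3, h4, hN1, hN2, hL1, hL2, ← mul_sum]
  push_cast
  ring

lemma saw_sub_saw (t : ZMod n) : saw (t + 1) - saw t =
    (if t = -1 then 1 else 0) + (if t = 0 then 1 else 0) - 2 / n := by
  have h1 := hsaw_sub_hsaw (t + 1)
  have h2 := hsaw_sub_hsaw t
  rw [add_sub_cancel_right] at h1
  rw [saw, saw, add_sub_cancel_right]
  simp only [← eq_neg_iff_add_eq_zero] at h1
  split_ifs at h1 h2 ⊢ <;> linear_combination (1 / 2) * h1 + (1 / 2) * h2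

/-- The change of the Maslov function when the markings of the columns `c - 1` and `c` are interchanged. -/
lemma maslovOf_sub_interchange (mk : Equiv.Perm (ZMod n)) (x : GridState n) {c : ZMod n} (hc : c - 1 ≠ c) :
    (GridDiagram.maslovOf mk x : ℚ) - GridDiagram.maslovOf (mk * Equiv.swap (c - 1) c) x =
      hsaw (mk (c - 1) - x c) - hsaw (mk c - x c) + saw (mk c - mk (c - 1)) := by
  have e1 := sawForm_sub mk hc
  have e2 := hsawForm_sub_markings mk x hc
  have e3 : ∀ k, hsaw (c - 1 - k) - hsaw (c - k) = 2 / n - if k = c then 2 else 0 := by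
    intro k
    have := hsaw_sub_hsaw (c - k)
    rw [show c - k - 1 = c - 1 - k by ring] at this
    simp only [sub_eq_zero, eq_comm (a := c)] at this
    linear_combination -this
  have e4 : ∀ k, saw (k - (c - 1)) - saw (k - c) =
      (if k = c - 1 then 1 else 0) + (if k = c then 1 else 0) - 2 / n := by
    intro k
    have := saw_sub_saw (k - c)
    rw [show k - c + 1 = k - (c - 1) by ring] at this
    have h1 : k - c = -1 ↔ k = c - 1 := by rw [sub_eq_iff_eq_add, neg_add_eq_sub]
    rw [this]
    simp only [h1, sub_eq_zero]
  have e5 : ∀ a : ZMod n, ∀ z : Equiv.Perm (ZMod n), ∑ k, hsaw (a - z k) = 0 := fun a z => by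
    rw [Equiv.sum_comp z fun k => hsaw (a - k), sum_hsaw_sub']
  have e6 : ∀ a : ZMod n, ∀ z : Equiv.Perm (ZMod n), ∑ k, saw (z k - a) = 0 := fun a z => by
    rw [Equiv.sum_comp z fun k => saw (k - a), sum_saw_sub]
  simp only [e3, sub_mul, sum_sub_distrib, ite_mul, zero_mul, sum_ite_eq', mem_univ, if_true, mul_sub,
    ← mul_sum, e5] at e2
  simp only [e4, sub_mul, add_mul, sum_sub_distrib, sum_add_distrib, ite_mul, zero_mul, one_mul,
    sum_ite_eq', mem_univ, if_true, mul_sub, ← mul_sum, e6] at e1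
  simp only [Equiv.Perm.mul_apply, Equiv.swap_apply_left, Equiv.swap_apply_right] at e1
  have e7 : saw (0 : ZMod n) = 0 := by
    have := saw_neg (0 : ZMod n)
    rw [neg_zero] at this; linarith
  have e8 := saw_neg (mk c - mk (c - 1))
  rw [neg_sub] at e8
  rw [maslovOf_eq, maslovOf_eq]
  simp only [sub_self, e7, e8] at e1
  linear_combination e1 / 4 - e2 / 2

end Maslov

section Maslov

variable {n : ℕ} [NeZero n]

/-- If the marking in row `m'` lies north of `A` and south of `B`, and the marking in row `m` lies north of
`B` and south of `A`, then the rows `m`, `A`, `m'` are in cyclic order. -/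
lemma hsaw_drawing {A B m m' : ZMod n} (hAB : A ≠ B) (hm' : GridDiagram.InArc A B m')
    (hm : GridDiagram.InArc B A m) (hne : m ≠ m') :
    hsaw (m - A - 1) - hsaw (m' - A) + saw (m' - m) = 2 / n - 1 := by
  have hn : (n : ℚ) ≠ 0 := cast_ne_zero'
  rw [inArc_iff' hAB] at hm
  rw [GridDiagram.InArc] at hm'
  have h1 := val_sub_eq hAB.symm
  have h2 := ZMod.val_lt (m - (A + 1))
  have h3 := ZMod.val_lt (m' - A)
  have e : m' - m = (((m' - A).val + n - (m - (A + 1)).val - 1 : ℕ) : ZMod n) := by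
    rw [Nat.cast_sub (by omega), Nat.cast_sub (by omega), Nat.cast_add, ZMod.natCast_zmod_val,
      ZMod.natCast_zmod_val, ZMod.natCast_self]
    push_cast; ring
  have hlt : (m' - A).val + n - (m - (A + 1)).val - 1 ≠ n := by
    intro h
    rw [h, ZMod.natCast_self, sub_eq_zero] at e
    exact hne e.symm
  have e1 : (m' - m).val = (m' - A).val + n - (m - (A + 1)).val - 1 := by
    rw [e, ZMod.val_cast_of_lt (by omega)]
  have e2 : (m' - m).val = (m' - m - 1).val + 1 := by
    have := val_sub_eq (A := 0) (sub_ne_zero.2 hne.symm)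
    rwa [sub_zero, zero_add] at this
  have e3 : ((m' - m).val : ℚ) = (m' - A).val + n - (m - (A + 1)).val - 1 := by
    rw [e1, Nat.cast_sub (by omega), Nat.cast_sub (by omega)]; push_cast; ring
  have e4 : ((m' - m - 1).val : ℚ) = (m' - m).val - 1 := by rw [e2]; push_cast; ring
  rw [saw, sub_sub m]
  simp only [hsaw, e4, e3]
  field_simp
  ring

variable {c A B : ZMod n} {mk : Equiv.Perm (ZMod n)}

/-- The markings given by `mk` lie in the bigons as in a drawing. -/
structure MarkingsDrawn (mk : Equiv.Perm (ZMod n)) (c A B : ZMod n) : Prop where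
  ne : A ≠ B
  east : GridDiagram.InArc A B (mk c)
  west : GridDiagram.InArc B A (mk (c - 1))

lemma pred_ne_self {A B : ZMod n} (c : ZMod n) (h : A ≠ B) : c - 1 ≠ c := by
  intro hc
  have h1 : (1 : ZMod n) = 0 := by rwa [sub_eq_self] at hc
  exact h (by rw [← mul_one A, ← mul_one B, h1, mul_zero, mul_zero])

lemma count_box_pred (q : ZMod n × ZMod n) {w h : ℤ} (hw : 1 ≤ w) :
    count mk q (Ico 0 w ×ˢ Ico 0 h) =
      count mk q (Ico 0 (w - 1) ×ˢ Ico 0 h) + count mk q ({w - 1} ×ˢ Ico 0 h) := by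
  rw [← count_union]
  · congr 1
    ext ⟨a, b⟩
    simp only [mem_union, mem_product, mem_Ico, mem_singleton]
    omega
  · intro a b
    simp only [mem_product, mem_Ico, mem_singleton]
    omega

lemma count_box_succ (q : ZMod n × ZMod n) {w h : ℤ} (hw : 1 ≤ w) :
    count mk q (Ico 0 w ×ˢ Ico 0 h) =
      count mk q (Ico 1 w ×ˢ Ico 0 h) + count mk q ({0} ×ˢ Ico 0 h) := by
  rw [← count_union]
  · congr 1
    ext ⟨a, b⟩
    simp only [mem_union, mem_product, mem_Ico, mem_singleton]
    omega
  · intro a b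
    simp only [mem_product, mem_Ico, mem_singleton]
    omega

/-- The change of the Maslov function along a pentagon: along the rectangle that agrees with it
outside of the bigon it changes as in `maslovOf_sub_maslovOf`, and the interchange of the two
columns accounts for the difference. -/
lemma maslovOf_sub_pent (hd : MarkingsDrawn mk c A B) {p : Pent n} {x y : GridState n}
    (hp : p.Connects c A x y) (hw : 0 < p.rect.width) (hh : 0 < p.rect.height) :
    (GridDiagram.maslovOf mk x : ℚ) - GridDiagram.maslovOf (mk * Equiv.swap (c - 1) c) y =
      2 * (p.rect.mult x y : ℚ) - 2 * count mk p.rect.1 p.squares := by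
  have hc := pred_ne_self c hd.ne
  obtain ⟨hr, hne, hside, ht, hA⟩ := hp
  have e1 := maslovOf_sub_maslovOf mk hr hne hw.le hh.le
  rw [← two_mul_mult_add_one hr hne hw.le hh.le] at e1
  have e2 := maslovOf_sub_interchange mk y hc
  have e3 := hsaw_drawing hd.ne hd.east hd.west (mk.injective.ne hc)
  suffices h : 2 * (count mk p.rect.1 p.squares - count mk p.rect.1 p.rect.squares) =
      hsaw (mk c - y c) - hsaw (mk (c - 1) - y c) - saw (mk c - mk (c - 1)) - 1 by
    linear_combination e1 + e2 + h
  obtain ⟨-, -, hyw, hye, -⟩ := hr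
  obtain ⟨⟨⟨i, s⟩, w, h⟩, b, t⟩ := p
  simp only [Pent.turn, Pent.brokenEast, Pent.rect, Rect.west, Rect.east, Rect.south, Rect.north,
    Rect.width, Rect.height, mem_Ico] at *
  cases b
  · simp only [Bool.false_eq_true, if_false] at hside
    subst hside
    simp only [Pent.squares, Rect.squares, Pent.rect, Pent.brokenEast, Pent.turn, Rect.width, Rect.height,
      Bool.false_eq_true, if_false]
    rw [count_union, count_union, count_box_succ (i, s) (w := w) (by omega), Ioo_eq_Ico_succ,
      count_column _ _ _ _ (by omega), count_column _ _ _ _ (by omega), count_column _ _ _ _ (by omega),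
      hyw, Int.cast_zero, add_zero, show i + ((-1 : ℤ) : ZMod n) = i - 1 by push_cast; ring,
      show mk (i - 1) - s - ((t + 1 : ℤ) : ZMod n) = mk (i - 1) - A - 1 by rw [← hA]; push_cast; ring,
      sub_sub (mk i) s (t : ZMod n), sub_sub (mk i) s (h : ZMod n), sub_sub (mk (i - 1)) s, hA]
    · push_cast
      linear_combination e3
    all_goals
      intro a b
      simp only [mem_union, mem_product, mem_Ico, mem_Ioo, mem_singleton]
      omega
  · simp only [if_true] at hside
    simp only [Pent.squares, Rect.squares, Pent.rect, Pent.brokenEast, Pent.turn, Rect.width, Rect.height,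
      if_true]
    rw [hside] at hye
    rw [count_union, count_union, count_box_pred (i, s) (w := w) (by omega), Ioo_eq_Ico_succ,
      count_column _ _ _ _ (by omega), count_column _ _ _ _ (by omega), count_column _ _ _ _ (by omega),
      hye, hside, show i + ((w - 1 : ℤ) : ZMod n) = c - 1 by rw [← hside]; push_cast; ring,
      show mk (c - 1) - s - ((t + 1 : ℤ) : ZMod n) = mk (c - 1) - A - 1 by rw [← hA]; push_cast; ring,
      sub_sub (mk c) s (t : ZMod n), hA, Int.cast_zero, sub_zero, sub_zero]
    · push_cast
      linear_combination e3
    all_goals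
      intro a b
      simp only [mem_union, mem_product, mem_Ico, mem_Ioo, mem_singleton]
      omega

/-- The change of the Maslov function along a hexagon: it contains one marking less than the
rectangle that agrees with it outside of the bigons. -/
lemma maslovOf_sub_hexa (hd : MarkingsDrawn mk c A B) {p : Hexa n} {x y : GridState n}
    (hp : p.Connects c A B x y) (hw : 0 < p.rect.width) (hh : 0 < p.rect.height) :
    (GridDiagram.maslovOf mk x : ℚ) - GridDiagram.maslovOf mk y =
      2 * (p.rect.mult x y : ℚ) - 2 * count mk p.rect.1 p.squares - 1 := by
  have hc := pred_ne_self c hd.ne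
  obtain ⟨hr, hne, h0, h1, h2, hside⟩ := hp
  have e1 := maslovOf_sub_maslovOf mk hr hne hw.le hh.le
  rw [← two_mul_mult_add_one hr hne hw.le hh.le] at e1
  have e3 := hsaw_drawing hd.ne hd.east hd.west (mk.injective.ne hc)
  have e4 := hsaw_drawing hd.ne.symm hd.west hd.east (mk.injective.ne hc.symm)
  have e5 := saw_neg (mk c - mk (c - 1))
  rw [neg_sub] at e5
  suffices h : count mk p.rect.1 p.squares - count mk p.rect.1 p.rect.squares = -1 by
    linear_combination e1 + 2 * h
  clear e1 hr hne
  obtain ⟨⟨⟨i, s⟩, w, h⟩, b, t, u⟩ := p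
  simp only [Hexa.lower, Hexa.upper, Hexa.brokenEast, Hexa.rect, Rect.west, Rect.east, Rect.south,
    Rect.width, Rect.height] at *
  cases b
  · simp only [Bool.false_eq_true, if_false] at hside
    obtain ⟨rfl, hA, hB⟩ := hside
    simp only [Hexa.squares, Rect.squares, Hexa.rect, Hexa.brokenEast, Hexa.lower, Hexa.upper, Rect.width,
      Rect.height, Bool.false_eq_true, if_false]
    rw [product_union, count_union, count_union, count_union, count_box_succ (i, s) (w := w) (by omega), Ioo_eq_Ico_succ,
      Ioo_eq_Ico_succ,
      count_column _ _ _ _ (by omega), count_column _ _ _ _ (by omega), count_column _ _ _ _ (by omega),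
      count_column _ _ _ _ (by omega),
      Int.cast_zero, add_zero, show i + ((-1 : ℤ) : ZMod n) = i - 1 by push_cast; ring,
      show mk (i - 1) - s - ((t + 1 : ℤ) : ZMod n) = mk (i - 1) - A - 1 by rw [← hA]; push_cast; ring,
      show mk i - s - ((u + 1 : ℤ) : ZMod n) = mk i - B - 1 by rw [← hB]; push_cast; ring,
      sub_sub (mk i) s (t : ZMod n), sub_sub (mk (i - 1)) s, hA, hB]
    · push_cast
      linear_combination (1 / 2) * e3 + (1 / 2) * e4 - (1 / 2) * e5
    all_goals
      intro a b
      simp only [mem_union, mem_product, mem_Ico, mem_Ioo, mem_singleton]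
      omega
  · simp only [if_true] at hside
    obtain ⟨hside, hB, hA⟩ := hside
    simp only [Hexa.squares, Rect.squares, Hexa.rect, Hexa.brokenEast, Hexa.lower, Hexa.upper, Rect.width,
      Rect.height, if_true]
    rw [product_union, count_union, count_union, count_union, count_box_pred (i, s) (w := w) (by omega), Ioo_eq_Ico_succ,
      Ioo_eq_Ico_succ,
      count_column _ _ _ _ (by omega), count_column _ _ _ _ (by omega), count_column _ _ _ _ (by omega),
      count_column _ _ _ _ (by omega),
      hside, show i + ((w - 1 : ℤ) : ZMod n) = c - 1 by rw [← hside]; push_cast; ring,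
      show mk (c - 1) - s - ((u + 1 : ℤ) : ZMod n) = mk (c - 1) - A - 1 by rw [← hA]; push_cast; ring,
      show mk c - s - ((t + 1 : ℤ) : ZMod n) = mk c - B - 1 by rw [← hB]; push_cast; ring,
      sub_sub (mk c) s (u : ZMod n), sub_sub (mk (c - 1)) s (t : ZMod n), hA, hB]
    · push_cast
      linear_combination (1 / 2) * e3 + (1 / 2) * e4 - (1 / 2) * e5
    all_goals
      intro a b
      simp only [mem_union, mem_product, mem_Ico, mem_Ioo, mem_singleton]
      omega

end Maslov

/-! ### Homogeneous maps -/

section Homogeneous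

variable {n : ℕ} [NeZero n]

/-- The polynomials of bidegree `(a, b)`. -/
noncomputable def bidegree (n : ℕ) (a : ℤ) (b : ℚ) : Submodule (ZMod 2) (BaseRing n) :=
  Submodule.span (ZMod 2) {p | ∃ e : Option (Fin n) →₀ ℕ,
    2 * (e none : ℤ) - 2 * ∑ i, (e (some i) : ℤ) = a ∧ -∑ i, (e (some i) : ℚ) = b ∧
      p = MvPolynomial.monomial e 1}

lemma mul_mem_bidegree {p q : BaseRing n} {a a' : ℤ} {b b' : ℚ} (hp : p ∈ bidegree n a b)
    (hq : q ∈ bidegree n a' b') : p * q ∈ bidegree n (a + a') (b + b') := by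
  have h := Submodule.mul_mem_mul hp hq
  rw [bidegree, bidegree, Submodule.span_mul_span] at h
  refine Submodule.span_mono ?_ h
  rintro _ ⟨_, ⟨e, h1, h2, rfl⟩, _, ⟨e', h1', h2', rfl⟩, rfl⟩
  refine ⟨e + e', ?_, ?_, by simp [MvPolynomial.monomial_mul]⟩
  · simp only [Finsupp.add_apply, Nat.cast_add, sum_add_distrib]
    linarith
  · simp only [Finsupp.add_apply, Nat.cast_add, sum_add_distrib]
    linarith

/-- The substitution of `V_i v` for `V_i` and of `1` for `v`, which sends the monomial `V_1^{a_1} ⋯ V_n^{a_n} v^m`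
to `V_1^{a_1} ⋯ V_n^{a_n} v^{a_1 + ⋯ + a_n}`. -/
noncomputable def insertV (n : ℕ) : BaseRing n →ₐ[ZMod 2] BaseRing n :=
  MvPolynomial.aeval fun o => o.elim 1 fun i => MvPolynomial.X (some i) * MvPolynomial.X none

lemma insertV_setOne (p : BaseRing n) : insertV n (setOne n p) = insertV n p := by
  have : (insertV n).comp (setOne n) = insertV n := by
    refine MvPolynomial.algHom_ext fun o => ?_
    cases o <;> simp [insertV, setOne]
  exact DFunLike.congr_fun this p

lemma monomial_option (e : Option (Fin n) →₀ ℕ) : (MvPolynomial.monomial e 1 : BaseRing n) =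
    MvPolynomial.X none ^ e none * ∏ i, MvPolynomial.X (some i) ^ e (some i) := by
  rw [MvPolynomial.monomial_eq, map_one, one_mul, Finsupp.prod_fintype _ _ (by simp), Fintype.prod_option]

/-- In a homogeneous polynomial, the exponent of `v` is determined by the exponents of the other variables.
So the specialization `v = 1` loses nothing. -/
lemma eq_zero_of_setOne_eq_zero {p : BaseRing n} {a : ℤ} {b : ℚ} (hp : p ∈ bidegree n a b)
    (h : setOne n p = 0) : p = 0 := by
  -- In degree `a` the exponent of `v` minus the sum of the others is `a / 2`, so that `insertV` recovers
  -- `p` up to this power of `v`, which has to be put on the side where it is nonnegative.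
  have key : MvPolynomial.X none ^ (-(a / 2)).toNat * p =
      MvPolynomial.X none ^ (a / 2).toNat * insertV n p := by
    clear h
    rw [bidegree] at hp
    induction hp using Submodule.span_induction with
    | zero => simp
    | add x y _ _ hx hy => rw [mul_add, hx, hy, map_add, mul_add]
    | smul c x _ hx => rw [map_smul, mul_smul_comm, mul_smul_comm, hx]
    | mem x hx =>
      obtain ⟨e, h1, -, rfl⟩ := hx
      have h2 : insertV n (MvPolynomial.monomial e 1) =
          MvPolynomial.X none ^ (∑ i, e (some i)) * ∏ i, MvPolynomial.X (some i) ^ e (some i) := by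
        rw [monomial_option, map_mul, map_prod, map_pow, insertV]
        simp only [map_pow, MvPolynomial.aeval_X, Option.elim_none, Option.elim_some, one_pow, one_mul,
          mul_pow, prod_mul_distrib, prod_pow_eq_pow_sum]
        rw [mul_comm]
      have h3 : (-(a / 2)).toNat + e none = (a / 2).toNat + ∑ i, e (some i) := by
        have : (∑ i, (e (some i) : ℤ)) = ((∑ i, e (some i) : ℕ) : ℤ) := by push_cast; rfl
        rw [this] at h1
        omega
      rw [h2, monomial_option, ← mul_assoc, ← mul_assoc, ← pow_add, ← pow_add, h3]
  rw [← insertV_setOne, h, map_zero, mul_zero] at key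
  exact (mul_eq_zero.1 key).resolve_left (pow_ne_zero _ (MvPolynomial.X_ne_zero _))

variable {G G' G'' : GridDiagram n} {L L' : GC n →ₗ[BaseRing n] GC n}

lemma apply_eq_sum (L : GC n →ₗ[BaseRing n] GC n) (g : GC n) (z : GridState n) :
    L g z = ∑ y, g y * entry L y z := by
  conv_lhs => rw [← univ_sum_single g]
  rw [map_sum, Finset.sum_apply]
  refine sum_congr rfl fun y _ => ?_
  have : (Pi.single y (g y) : GC n) = g y • Pi.single y 1 := by
    rw [← Pi.single_smul, smul_eq_mul, mul_one]
  rw [this, map_smul, Pi.smul_apply, smul_eq_mul, entry]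

lemma entry_comp (L' L : GC n →ₗ[BaseRing n] GC n) (x z : GridState n) :
    entry (L' ∘ₗ L) x z = ∑ y, entry L x y * entry L' y z := by
  rw [entry, LinearMap.comp_apply, apply_eq_sum]; rfl

lemma entry_add (L' L : GC n →ₗ[BaseRing n] GC n) (x z : GridState n) :
    entry (L' + L) x z = entry L' x z + entry L x z := rfl

lemma dualOp_comp (L' L : GC n →ₗ[BaseRing n] GC n) (f : GridState n → BaseRing n) :
    dualOp (L' ∘ₗ L) f = dualOp L (dualOp L' f) := by
  funext x
  simp only [dualOp, entry_comp, map_sum, map_mul, sum_mul, mul_sum]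
  rw [sum_comm]
  exact sum_congr rfl fun y _ => sum_congr rfl fun z _ => mul_assoc _ _ _

lemma dualOp_add (L' L : GC n →ₗ[BaseRing n] GC n) (f : GridState n → BaseRing n) (x : GridState n) :
    dualOp (L' + L) f x = dualOp L' f x + dualOp L f x := by
  simp only [dualOp, entry_add, map_add, add_mul, sum_add_distrib]

/-- The matrix entries of `L` are homogeneous of the right bidegrees for `L` to be homogeneous of degree
`(a, b)` as a map from the complex of `G` to the complex of `G'`. -/
def HasDegree (G G' : GridDiagram n) (L : GC n →ₗ[BaseRing n] GC n) (a : ℤ) (b : ℚ) : Prop :=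
  ∀ x y, entry L x y ∈ bidegree n (G.maslov x - G'.maslov y + a) (G.alexander x - G'.alexander y + b)

lemma HasDegree.comp {a a' : ℤ} {b b' : ℚ} (h' : HasDegree G' G'' L' a' b') (h : HasDegree G G' L a b) :
    HasDegree G G'' (L' ∘ₗ L) (a + a') (b + b') := by
  intro x z
  rw [entry_comp]
  refine Submodule.sum_mem _ fun y _ => ?_
  have := mul_mem_bidegree (h x y) (h' y z)
  convert this using 2 <;> ring

lemma HasDegree.add {a : ℤ} {b : ℚ} (h' : HasDegree G G' L' a b) (h : HasDegree G G' L a b) :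
    HasDegree G G' (L' + L) a b := fun x z => Submodule.add_mem _ (h' x z) (h x z)

lemma hasDegree_id : HasDegree G G LinearMap.id 0 0 := by
  intro x y
  rw [entry, LinearMap.id_apply]
  by_cases h : x = y
  · subst h
    rw [Pi.single_eq_same]
    exact Submodule.subset_span ⟨0, by simp, by simp, by simp⟩
  · rw [Pi.single_eq_of_ne (Ne.symm h)]
    exact Submodule.zero_mem _

lemma HasDegree.isHomogeneousMap {a : ℤ} {b : ℚ} (h : HasDegree G G' L a b) :
    GridDiagram.IsHomogeneousMap G G' L a b := by
  intro d s z hz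
  rw [GridDiagram.homogeneous] at hz
  induction hz using Submodule.span_induction with
  | zero => rw [map_zero]; exact Submodule.zero_mem _
  | add x y _ _ hx hy => rw [map_add]; exact Submodule.add_mem _ hx hy
  | smul c x _ hx =>
    rw [LinearMap.map_smul_of_tower]
    exact Submodule.smul_mem _ c hx
  | mem z hz =>
    obtain ⟨x, e, h1, h2, rfl⟩ := hz
    have h3 : L (Pi.single x (MvPolynomial.monomial e 1)) =
        ∑ y, Pi.single y (MvPolynomial.monomial e 1 * entry L x y) := by
      funext z
      rw [apply_eq_sum, Finset.sum_apply, Fintype.sum_eq_single x, Fintype.sum_eq_single z]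
      · simp
      · intro y hy; rw [Pi.single_eq_of_ne hy.symm]
      · intro y hy; rw [Pi.single_eq_of_ne hy, zero_mul]
    rw [h3]
    refine Submodule.sum_mem _ fun y _ => ?_
    have h4 := h x y
    generalize entry L x y = p at h4 ⊢
    rw [bidegree] at h4
    induction h4 using Submodule.span_induction with
    | zero => rw [mul_zero, Pi.single_zero]; exact Submodule.zero_mem _
    | add p q _ _ hp hq => rw [mul_add, Pi.single_add]; exact Submodule.add_mem _ hp hq
    | smul c p _ hp =>
      rw [mul_smul_comm, Pi.single_smul]
      exact Submodule.smul_mem _ c hp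
    | mem p hp =>
      obtain ⟨e', h1', h2', rfl⟩ := hp
      refine Submodule.subset_span ⟨y, e + e', ?_, ?_, ?_⟩
      · simp only [Finsupp.add_apply, Nat.cast_add, sum_add_distrib]
        linarith
      · simp only [Finsupp.add_apply, Nat.cast_add, sum_add_distrib]
        linarith
      · rw [MvPolynomial.monomial_mul, one_mul]

/-- A homogeneous map is determined by its specialization at `v = 1`. -/
lemma HasDegree.eq_zero {a : ℤ} {b : ℚ} (h : HasDegree G G' L a b) (h0 : ∀ f x, dualOp L f x = 0) :
    L = 0 := by
  have h1 : ∀ x y, entry L x y = 0 := by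
    intro x y
    refine eq_zero_of_setOne_eq_zero (h x y) ?_
    have := h0 (Pi.single y 1) x
    rwa [dualOp, Fintype.sum_eq_single y, Pi.single_eq_same, mul_one] at this
    intro z hz; rw [Pi.single_eq_of_ne hz, mul_zero]
  refine LinearMap.ext fun g => funext fun z => ?_
  rw [apply_eq_sum]
  simp [h1]

/-! ### Degrees of the maps that count polygons -/

lemma weight_eq_monomial (G : GridDiagram n) (q : ZMod n × ZMod n) (S : Finset (ℤ × ℤ)) (m : ℕ) :
    G.weight q S m = MvPolynomial.monomial (Finsupp.equivFunOnFinite.symm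
      fun o => o.elim m fun i => G.oMult q S i) 1 := by
  rw [monomial_option, GridDiagram.weight, mul_comm]
  rfl

lemma sum_oMult (G : GridDiagram n) (q : ZMod n × ZMod n) (S : Finset (ℤ × ℤ)) :
    ∑ i, (G.oMult q S i : ℚ) = count G.o q S := by
  classical
  simp only [GridDiagram.oMult, card_filter, Nat.cast_sum, count]
  rw [sum_comm]
  refine sum_congr rfl fun s _ => ?_
  rw [Fintype.sum_eq_single (G.oCol.symm (q.1 + (s.1 : ZMod n)))]
  · simp only [Equiv.apply_symm_apply, true_and, GridDiagram.o, Equiv.trans_apply, Nat.cast_ite,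
      Nat.cast_one, Nat.cast_zero]
    congr
  · intro i hi
    rw [if_neg, Nat.cast_zero]
    rintro ⟨h, -⟩
    exact hi (by rw [← h, Equiv.symm_apply_apply])

lemma weight_mem_bidegree (G : GridDiagram n) {q : ZMod n × ZMod n} {S : Finset (ℤ × ℤ)} {m : ℕ} {a : ℤ}
    {b : ℚ} (ha : (a : ℚ) = 2 * m - 2 * count G.o q S) (hb : b = -count G.o q S) :
    G.weight q S m ∈ bidegree n a b := by
  refine Submodule.subset_span ⟨_, ?_, ?_, weight_eq_monomial G q S m⟩
  · rw [← sum_oMult] at ha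
    simp only [Finsupp.equivFunOnFinite_symm_apply_apply, Option.elim_none, Option.elim_some]
    exact_mod_cast ha.symm
  · rw [hb, ← sum_oMult]
    simp

lemma count_eq_zero (G : GridDiagram n) {q : ZMod n × ZMod n} {S : Finset (ℤ × ℤ)} (h : G.XFree q S) :
    count G.x q S = 0 :=
  sum_eq_zero fun s hs => if_neg (h s hs)

/-- A rectangle without `X`-markings does not wrap around the torus. -/
lemma width_lt_of_xFree {q : ZMod n × ZMod n} {w h : ℤ} (hh : 0 < h) (hX : G.XFree q (Ico 0 w ×ˢ Ico 0 h)) :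
    w < n := by
  by_contra hcon
  have hlt := ZMod.val_lt (G.x.symm q.2 - q.1)
  refine hX (((G.x.symm q.2 - q.1).val : ℤ), 0) ?_ ?_
  · simp only [mem_product, mem_Ico]; omega
  · simp

lemma height_lt_of_xFree {q : ZMod n × ZMod n} {w h : ℤ} (hw : 0 < w) (hX : G.XFree q (Ico 0 w ×ˢ Ico 0 h)) :
    h < n := by
  by_contra hcon
  have hlt := ZMod.val_lt (G.x q.1 - q.2)
  refine hX (0, ((G.x q.1 - q.2).val : ℤ)) ?_ ?_
  · simp only [mem_product, mem_Ico]; omega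
  · simp

lemma west_ne_east {r : Rect n} (hw : 0 < r.width) (hw' : r.width < n) : r.west ≠ r.east := by
  obtain ⟨⟨i, s⟩, w, h⟩ := r
  simp only [Rect.west, Rect.east, Rect.width] at *
  lift w to ℕ using hw.le
  rw [ne_eq, left_eq_add, Int.cast_natCast, ZMod.natCast_eq_zero_iff]
  intro hd
  exact absurd (Nat.le_of_dvd (by omega) hd) (by omega)

lemma mem_allRects {N : ℕ} {r : Rect n} : r ∈ GridDiagram.allRects n N ↔
    (0 < r.width ∧ r.width < N) ∧ 0 < r.height ∧ r.height < N := by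
  simp only [GridDiagram.allRects, mem_product, mem_univ, true_and, mem_Ioo]
  rfl

/-- The Alexander grading is half the difference of the two Maslov functions, and there are no
`X`-markings to count for the second one. -/
lemma hasDegree_bdry4 (G : GridDiagram n) : HasDegree G G G.bdry4 (-1) 0 := by
  classical
  intro x y
  rw [GridDiagram.bdry4, entry_linearMapOf]
  refine Submodule.sum_mem _ fun r hr => ?_
  rw [mem_filter, mem_allRects] at hr
  obtain ⟨⟨⟨hw, -⟩, hh, -⟩, hc, hX⟩ := hr
  have hne := west_ne_east hw (width_lt_of_xFree hh hX)
  have h1 := maslovOf_sub_maslovOf G.o hc hne hw.le hh.le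
  have h2 := maslovOf_sub_maslovOf G.x hc hne hw.le hh.le
  rw [← two_mul_mult_add_one hc hne hw.le hh.le] at h1 h2
  rw [count_eq_zero G hX] at h2
  refine weight_mem_bidegree G ?_ ?_
  · rw [GridDiagram.maslov, GridDiagram.maslov]
    push_cast
    linear_combination h1
  · rw [GridDiagram.alexander, GridDiagram.alexander]
    linear_combination (1 / 2) * h1 - (1 / 2) * h2

variable {c A B : ZMod n}

lemma markingsDrawn_o (hd : G.IsDrawing c A B) : MarkingsDrawn G.o c A B := ⟨hd.ne, hd.o_east, hd.o_west⟩

lemma markingsDrawn_x (hd : G.IsDrawing c A B) : MarkingsDrawn G.x c A B := ⟨hd.ne, hd.x_east, hd.x_west⟩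

lemma hasDegree_pentMap (hi : G.ColumnInterchange G' c) (hd : G.IsDrawing c A B) :
    HasDegree G G' (G.pentMap c A) 0 0 := by
  classical
  intro x y
  rw [GridDiagram.pentMap, entry_linearMapOf]
  refine Submodule.sum_mem _ fun p hp => ?_
  rw [mem_filter, mem_product] at hp
  obtain ⟨⟨hr, -⟩, hc, hX⟩ := hp
  obtain ⟨⟨hw, -⟩, hh, -⟩ := mem_allRects.1 hr
  have ho : G'.o = G.o * Equiv.swap (c - 1) c := Equiv.ext fun k => interchange_o hi k
  have hx : G'.x = G.x * Equiv.swap (c - 1) c := Equiv.ext fun k => hi.2.2 k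
  have h1 := maslovOf_sub_pent (markingsDrawn_o hd) hc hw hh
  have h2 := maslovOf_sub_pent (markingsDrawn_x hd) hc hw hh
  rw [count_eq_zero G hX] at h2
  rw [← ho] at h1
  rw [← hx] at h2
  refine weight_mem_bidegree G ?_ ?_
  · rw [GridDiagram.maslov, GridDiagram.maslov]
    push_cast
    linear_combination h1
  · rw [GridDiagram.alexander, GridDiagram.alexander]
    linear_combination (1 / 2) * h1 - (1 / 2) * h2

lemma hasDegree_hexMap (hd : G.IsDrawing c A B) : HasDegree G G (G.hexMap c A B) 1 0 := by
  classical
  intro x y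
  rw [GridDiagram.hexMap, entry_linearMapOf]
  refine Submodule.sum_mem _ fun p hp => ?_
  rw [mem_filter, mem_product] at hp
  obtain ⟨⟨hr, -⟩, hc, hX⟩ := hp
  obtain ⟨⟨hw, -⟩, hh, -⟩ := mem_allRects.1 hr
  have h1 := maslovOf_sub_hexa (markingsDrawn_o hd) hc hw hh
  have h2 := maslovOf_sub_hexa (markingsDrawn_x hd) hc hw hh
  rw [count_eq_zero G hX] at h2
  refine weight_mem_bidegree G ?_ ?_
  · rw [GridDiagram.maslov, GridDiagram.maslov]
    push_cast
    linear_combination h1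
  · rw [GridDiagram.alexander, GridDiagram.alexander]
    linear_combination (1 / 2) * h1 - (1 / 2) * h2

/-! ### The homotopy equivalence for columns -/

lemma add_self_eq_zero' (p : BaseRing n) : p + p = 0 := CharTwo.add_self_eq_zero p

lemma eq_of_add_eq_zero' {L L' : GC n →ₗ[BaseRing n] GC n} (h : L + L' = 0) : L = L' := by
  refine LinearMap.ext fun g => funext fun z => ?_
  have := congrFun (LinearMap.congr_fun h g) z
  simp only [LinearMap.add_apply, Pi.add_apply, LinearMap.zero_apply, Pi.zero_apply] at this
  exact CharTwo.add_eq_zero.1 this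

/-- Both sides are homogeneous of the same degree, so they may be compared at `v = 1`. -/
lemma pentMap_chain (hi : G.ColumnInterchange G' c) (hd : G.IsDrawing c A B) :
    G'.bdry4 ∘ₗ G.pentMap c A = G.pentMap c A ∘ₗ G.bdry4 := by
  have hp := hasDegree_pentMap hi hd
  have h1 : HasDegree G G' (G'.bdry4 ∘ₗ G.pentMap c A) (-1) 0 := by
    simpa using (hasDegree_bdry4 G').comp hp
  have h2 : HasDegree G G' (G.pentMap c A ∘ₗ G.bdry4) (-1) 0 := by
    simpa using hp.comp (hasDegree_bdry4 G)
  refine eq_of_add_eq_zero' ((h1.add h2).eq_zero fun f x => ?_)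
  rw [dualOp_add, dualOp_comp, dualOp_comp, dualOp_bdry4, dualOp_bdry4, dualOp_pentMap, dualOp_pentMap,
    gridVal_interchange hi, add_comm]
  exact rectOp_pentOp add_self_eq_zero' (isGridVal_gridVal G) A f x

lemma one_lt_of_ne {A B : ZMod n} (h : A ≠ B) : 1 < n := by
  have := val_sub_succ_lt h
  omega

lemma hexMap_homotopy (hi : G.ColumnInterchange G' c) (hd : G.IsDrawing c A B) :
    G.bdry4 ∘ₗ G.hexMap c A B + G.hexMap c A B ∘ₗ G.bdry4 + G'.pentMap c B ∘ₗ G.pentMap c A =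
      LinearMap.id := by
  have hp := hasDegree_pentMap hi hd
  have hp' := hasDegree_pentMap (interchange_symm hi) (isDrawing_interchange hi hd)
  have hh := hasDegree_hexMap hd
  have h1 : HasDegree G G (G.bdry4 ∘ₗ G.hexMap c A B) 0 0 := by simpa using (hasDegree_bdry4 G).comp hh
  have h2 : HasDegree G G (G.hexMap c A B ∘ₗ G.bdry4) 0 0 := by simpa using hh.comp (hasDegree_bdry4 G)
  have h3 : HasDegree G G (G'.pentMap c B ∘ₗ G.pentMap c A) 0 0 := by simpa using hp'.comp hp
  refine eq_of_add_eq_zero' ((((h1.add h2).add h3).add hasDegree_id).eq_zero fun f x => ?_)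
  have key := rectOp_hexOp add_self_eq_zero' (one_lt_of_ne hd.ne) (isGridVal_gridVal G)
    (isDrawnVal_gridVal hd) f x
  have hid : dualOp LinearMap.id f x = f x := by
    rw [dualOp, Fintype.sum_eq_single x]
    · simp [entry]
    · intro y hy; simp [entry, Pi.single_eq_of_ne hy]
  rw [dualOp_add, dualOp_add, dualOp_add, dualOp_comp, dualOp_comp, dualOp_comp, hid]
  simp only [dualOp_bdry4, dualOp_pentMap, dualOp_hexMap hd.ne]
  rw [gridVal_interchange hi, ← key, add_comm (crossOp c (hexW (gridVal G) c A B) (rectOp (gridVal G) f) x)]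
  exact add_self_eq_zero' _

/-- The relations for the primed maps are those of the interchanged diagram, in which the crossing
points `A` and `B` change roles. -/
theorem areHomotopyInverse (hi : G.ColumnInterchange G' c) (hd : G.IsDrawing c A B) :
    G.AreHomotopyInverse G' (G.pentMap c A) (G'.pentMap c B) (G.hexMap c A B) (G'.hexMap c B A) where
  chain := pentMap_chain hi hd
  chain' := pentMap_chain (interchange_symm hi) (isDrawing_interchange hi hd)
  bigraded := (hasDegree_pentMap hi hd).isHomogeneousMap
  bigraded' := (hasDegree_pentMap (interchange_symm hi) (isDrawing_interchange hi hd)).isHomogeneousMap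
  degree := (hasDegree_hexMap hd).isHomogeneousMap
  degree' := (hasDegree_hexMap (isDrawing_interchange hi hd)).isHomogeneousMap
  homotopy := hexMap_homotopy hi hd
  homotopy' := hexMap_homotopy (interchange_symm hi) (isDrawing_interchange hi hd)

end Homogeneous

/-! ### Existence of drawings -/

section Drawing

variable {n : ℕ} [NeZero n] {G G' : GridDiagram n} {c : ZMod n}

lemma inArc_iff_val {a b t : ZMod n} : GridDiagram.InArc a b t ↔
    (a.val ≤ b.val ∧ a.val ≤ t.val ∧ t.val ≤ b.val) ∨
      (b.val < a.val ∧ (a.val ≤ t.val ∨ t.val ≤ b.val)) := by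
  have key : ∀ k l : ZMod n, (l - k).val = if k.val ≤ l.val then l.val - k.val else n + l.val - k.val := by
    intro k l
    have h1 := ZMod.val_lt k
    split_ifs with h
    · exact ZMod.val_sub h
    · have e : l - k = ((n + l.val - k.val : ℕ) : ZMod n) := by
        rw [Nat.cast_sub (by omega), Nat.cast_add, ZMod.natCast_zmod_val, ZMod.natCast_zmod_val,
          ZMod.natCast_self]
        ring
      rw [e, ZMod.val_cast_of_lt (by omega)]
  have h1 := ZMod.val_lt a
  have h2 := ZMod.val_lt b
  have h3 := ZMod.val_lt t
  rw [GridDiagram.InArc, key, key]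
  split_ifs <;> omega

lemma x_ne_o (G : GridDiagram n) (k : ZMod n) : G.x k ≠ G.o k := by
  have := G.no_square_doubly_marked (G.oCol.symm k)
  rwa [Equiv.apply_symm_apply] at this

lemma inArc_left (a b : ZMod n) : GridDiagram.InArc a b a := by
  rw [inArc_iff_val]; omega

lemma inArc_right (a b : ZMod n) : GridDiagram.InArc a b b := by
  rw [inArc_iff_val]; omega

lemma inArc_or {a b : ZMod n} (h : a ≠ b) (t : ZMod n) :
    GridDiagram.InArc a b t ∨ GridDiagram.InArc b a t := by
  have := (ZMod.val_injective n).ne h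
  rw [inArc_iff_val, inArc_iff_val]; omega

/-- If the markings of column `c - 1` lie in the same one of the two arcs between the markings of
column `c`, then the crossing points may be placed in the rows of the two markings of column `c`. -/
lemma exists_isDrawing_of_inArc
    (h : (GridDiagram.InArc (G.o c) (G.x c) (G.x (c - 1)) ∧ GridDiagram.InArc (G.o c) (G.x c) (G.o (c - 1))) ∨
      (GridDiagram.InArc (G.x c) (G.o c) (G.x (c - 1)) ∧ GridDiagram.InArc (G.x c) (G.o c) (G.o (c - 1)))) :
    ∃ A B : ZMod n, G.IsDrawing c A B := by
  rcases h with h | h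
  · exact ⟨G.x c, G.o c, x_ne_o G c, inArc_left _ _, inArc_right _ _, h.1, h.2⟩
  · exact ⟨G.o c, G.x c, (x_ne_o G c).symm, inArc_right _ _, inArc_left _ _, h.1, h.2⟩

lemma exists_isDrawing (h : G.ColumnCommutation G' c ∨ G.ColumnSwitch G' c) :
    ∃ A B : ZMod n, G.IsDrawing c A B := by
  apply exists_isDrawing_of_inArc
  rcases h with ⟨-, h⟩ | ⟨-, h | h⟩
  · have hne : (G.x c).val ≠ (G.o c).val := fun h => x_ne_o G c (ZMod.val_injective n h)
    simp only [inArc_iff_val]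
    rcases h with h | h | h
    · have h1 := Set.disjoint_left.1 h Set.left_mem_uIcc
      have h2 := Set.disjoint_left.1 h Set.right_mem_uIcc
      simp only [GridDiagram.columnInterval, Set.mem_uIcc] at h1 h2
      omega
    · have h1 := h Set.left_mem_uIcc
      have h2 := h Set.right_mem_uIcc
      simp only [GridDiagram.columnInterior, Set.uIoo, Set.mem_Ioo, inf_lt_iff, lt_sup_iff] at h1 h2
      omega
    · have h1 := h Set.left_mem_uIcc
      have h2 := h Set.right_mem_uIcc
      simp only [GridDiagram.columnInterior, Set.uIoo, Set.mem_Ioo, inf_lt_iff, lt_sup_iff] at h1 h2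
      omega
  · rw [h]
    rcases inArc_or (x_ne_o G c).symm (G.o (c - 1)) with h1 | h1
    · exact Or.inl ⟨inArc_left _ _, h1⟩
    · exact Or.inr ⟨inArc_right _ _, h1⟩
  · rw [h]
    rcases inArc_or (x_ne_o G c).symm (G.x (c - 1)) with h1 | h1
    · exact Or.inl ⟨h1, inArc_right _ _⟩
    · exact Or.inr ⟨h1, inArc_left _ _⟩

end Drawing

/-! ### The complex of the 4-fold cover is the complex of the diagram -/

section Cover

variable {n : ℕ} [NeZero n]

/-- In the direction of one factor of the torus, interior circles of a rectangle count twice and its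
sides once. -/
lemma sum_average_split (i k : ZMod n) {w : ℤ} (hw : 0 < w) :
    ∑ a ∈ Ico 0 w, ∑ e ∈ ({0, 1} : Finset ℤ), (if k = i + ((a + e : ℤ) : ZMod n) then (1 : ℚ) else 0) =
      2 * (∑ a ∈ Ioo 0 w, if k = i + (a : ZMod n) then 1 else 0) + (if k = i then 1 else 0) +
        if k = i + (w : ZMod n) then 1 else 0 := by
  have h := sum_average i k hw.le
  have h0 := count_eq i k (a := 1) (b := w) (by omega)
  have h1 := hsaw_sub_hsaw (k - i)
  have h2 := hsaw_sub_hsaw (k - (i + (w : ZMod n)))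
  simp only [sub_eq_zero] at h1 h2
  rw [h, Ioo_eq_Ico_succ, zero_add, h0, saw, saw, sub_sub k i (w : ZMod n)]
  push_cast
  split_ifs at h1 h2 ⊢ <;> linear_combination (1 / 2) * h1 + (1 / 2) * h2

lemma sum_Ioo_eq_zero_left (i : ZMod n) {w : ℤ} (hw : w ≤ n) :
    ∑ a ∈ Ioo 0 w, (if i = i + (a : ZMod n) then (1 : ℚ) else 0) = 0 := by
  refine sum_eq_zero fun a ha => if_neg fun h => ?_
  rw [mem_Ioo] at ha
  lift a to ℕ using ha.1.le
  rw [left_eq_add, Int.cast_natCast, ZMod.natCast_eq_zero_iff] at h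
  exact absurd (Nat.le_of_dvd (by omega) h) (by omega)

lemma sum_Ioo_eq_zero_right (i : ZMod n) {w : ℤ} (hw : w ≤ n) :
    ∑ a ∈ Ioo 0 w, (if i + (w : ZMod n) = i + (a : ZMod n) then (1 : ℚ) else 0) = 0 := by
  refine sum_eq_zero fun a ha => if_neg fun h => ?_
  rw [mem_Ioo] at ha
  have h' : ((w - a : ℤ) : ZMod n) = 0 := by
    push_cast; rw [sub_eq_zero]; exact add_left_cancel h
  obtain ⟨b, hb⟩ := Int.eq_ofNat_of_zero_le (show 0 ≤ w - a by omega)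
  rw [hb, Int.cast_natCast, ZMod.natCast_eq_zero_iff] at h'
  exact absurd (Nat.le_of_dvd (by omega) h') (by omega)

/-- For rectangles that do not wrap around the torus, the multiplicity is the number of interior points. -/
lemma mult_eq_interiorCount {r : Rect n} {x y : GridState n} (hr : r.Connects x y)
    (hw : 0 < r.width) (hw' : r.width < n) (hh : 0 < r.height) (hh' : r.height < n) :
    r.mult x y = r.interiorCount x := by
  classical
  have hne := west_ne_east hw hw'
  have key := two_mul_mult_add_one hr hne hw.le hh.le
  obtain ⟨h1, h2, h3, h4, h5⟩ := hr
  have hne' : r.south ≠ r.north := by rw [← h1, ← h2]; exact x.injective.ne hne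
  set X : ZMod n → ℚ := fun k => ∑ a ∈ Ioo 0 r.width, if k = r.west + (a : ZMod n) then 1 else 0 with hX
  set Y : ZMod n → ℚ := fun k => ∑ a ∈ Ioo 0 r.height, if k = r.south + (a : ZMod n) then 1 else 0 with hY
  have hXw : X r.west = 0 := sum_Ioo_eq_zero_left _ hw'.le
  have hXe : X r.east = 0 := sum_Ioo_eq_zero_right _ hw'.le
  have hYs : Y r.south = 0 := sum_Ioo_eq_zero_left _ hh'.le
  have hYn : Y r.north = 0 := sum_Ioo_eq_zero_right _ hh'.le
  have hint : (r.interiorCount x : ℚ) = ∑ k, X k * Y (x k) := by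
    simp only [hX, hY, sum_mul_sum]
    rw [Rect.interiorCount, card_filter, Nat.cast_sum, sum_product]
    symm
    rw [sum_comm]
    refine sum_congr rfl fun a _ => ?_
    rw [sum_comm]
    refine sum_congr rfl fun b _ => ?_
    rw [sum_ite_mul_ite]
    push_cast
    rfl
  have hp : ∀ z : GridState n, r.pointMeasure z = (∑ k,
      (2 * X k + (if k = r.west then 1 else 0) + if k = r.east then 1 else 0) *
      (2 * Y (z k) + (if z k = r.south then 1 else 0) + if z k = r.north then 1 else 0)) / 4 := by
    intro z
    rw [pointMeasure_eq_sum]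
    simp only [sum_average_split _ _ hw, sum_average_split _ _ hh]
    rfl
  have hrest : ∀ z : GridState n, (∀ k, k ≠ r.west → k ≠ r.east → z k = x k) →
      ∀ k ∈ (univ.erase r.west).erase r.east,
      (2 * X k + (if k = r.west then 1 else 0) + if k = r.east then 1 else 0) *
      (2 * Y (z k) + (if z k = r.south then 1 else 0) + if z k = r.north then 1 else 0) =
      4 * (X k * Y (x k)) := by
    intro z hz k hk
    simp only [mem_erase, mem_univ, and_true] at hk
    have hk1 : x k ≠ r.south := by rw [← h1]; exact x.injective.ne hk.2
    have hk2 : x k ≠ r.north := by rw [← h2]; exact x.injective.ne hk.1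
    rw [hz k hk.2 hk.1, if_neg hk.1, if_neg hk.2, if_neg hk1, if_neg hk2]
    ring
  have hmem : r.east ∈ univ.erase r.west := by simp [hne.symm]
  rw [hp, hp, ← add_sum_erase _ _ (mem_univ r.west), ← add_sum_erase _ _ hmem,
    ← add_sum_erase _ _ (mem_univ r.west), ← add_sum_erase _ _ hmem,
    sum_congr rfl (hrest x fun _ _ _ => rfl), sum_congr rfl (hrest y h5), h1, h2, h3, h4, hXw, hXe, hYs, hYn]
    at key
  rw [← add_sum_erase _ _ (mem_univ r.west), ← add_sum_erase _ _ hmem, hXw, hXe] at hint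
  simp only [if_true, if_neg hne, if_neg hne.symm, if_neg hne', if_neg hne'.symm, ← mul_sum] at key
  have : (r.mult x y : ℚ) = r.interiorCount x := by linear_combination key / 2 - hint
  exact_mod_cast this

/-- A rectangle without `X`-markings in the 4-fold cover projects injectively to the torus, and its
multiplicity is the number of points in its interior. -/
lemma bdry4_eq_bdry (G : GridDiagram n) : G.bdry4 = G.bdry := by
  classical
  rw [GridDiagram.bdry4, GridDiagram.bdry]
  congr 1
  funext x y
  refine sum_congr ?_ ?_
  · ext r
    simp only [mem_filter, mem_allRects, Nat.cast_mul, Nat.cast_ofNat]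
    constructor
    · rintro ⟨⟨⟨hw, -⟩, hh, -⟩, hc, hX⟩
      exact ⟨⟨⟨hw, width_lt_of_xFree hh hX⟩, hh, height_lt_of_xFree hw hX⟩, hc, hX⟩
    · rintro ⟨⟨⟨hw, hw'⟩, hh, hh'⟩, hc, hX⟩
      exact ⟨⟨⟨hw, by omega⟩, hh, by omega⟩, hc, hX⟩
  · intro r hr
    rw [mem_filter, mem_allRects] at hr
    obtain ⟨⟨⟨hw, hw'⟩, hh, hh'⟩, hc, -⟩ := hr
    rw [mult_eq_interiorCount hc hw hw' hh hh']

end Cover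

/-! ### The isomorphism of homologies -/

section Homology

variable {n : ℕ} [NeZero n] {G G' : GridDiagram n} {P P' H H' : GC n →ₗ[BaseRing n] GC n}

lemma map_cycles (h : G'.bdry ∘ₗ P = P ∘ₗ G.bdry) : ∀ z ∈ G.cycles, P z ∈ G'.cycles := by
  intro z hz
  have h1 := LinearMap.congr_fun h z
  rw [LinearMap.mem_ker] at hz ⊢
  rw [LinearMap.comp_apply, LinearMap.comp_apply, hz, map_zero] at h1
  exact h1

/-- The map of homologies induced by a chain map. -/
noncomputable def homologyMap (h : G'.bdry ∘ₗ P = P ∘ₗ G.bdry) :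
    (G.cycles ⧸ G.boundaries) →ₗ[BaseRing n] (G'.cycles ⧸ G'.boundaries) :=
  Submodule.mapQ _ _ (P.restrict (map_cycles h)) fun z hz => by
    obtain ⟨w, hw⟩ := hz
    exact ⟨P w, by
      have h1 := LinearMap.congr_fun h w
      rw [LinearMap.comp_apply, LinearMap.comp_apply, hw] at h1
      exact h1⟩

lemma homologyMap_mk (h : G'.bdry ∘ₗ P = P ∘ₗ G.bdry) (z : G.cycles) :
    homologyMap h (G.boundaries.mkQ z) = G'.boundaries.mkQ ⟨P z, map_cycles h z z.2⟩ := rfl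

/-- A homotopy from a composition to the identity shows that the composition is the identity on
homology. -/
lemma homologyMap_homologyMap (h : G'.bdry ∘ₗ P = P ∘ₗ G.bdry) (h' : G.bdry ∘ₗ P' = P' ∘ₗ G'.bdry)
    (hH : G.bdry ∘ₗ H + H ∘ₗ G.bdry + P' ∘ₗ P = LinearMap.id) (ξ : G.cycles ⧸ G.boundaries) :
    homologyMap h' (homologyMap h ξ) = ξ := by
  obtain ⟨z, rfl⟩ := G.boundaries.mkQ_surjective ξ
  rw [homologyMap_mk, homologyMap_mk, Submodule.mkQ_apply, Submodule.mkQ_apply, Submodule.Quotient.eq]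
  refine ⟨-H z, ?_⟩
  have h1 := LinearMap.congr_fun hH z
  have hz : G.bdry (z : GC n) = 0 := z.2
  simp only [LinearMap.add_apply, LinearMap.comp_apply, hz, map_zero, add_zero, LinearMap.id_apply] at h1
  rw [map_neg]
  change -G.bdry (H z) = P' (P z) - (z : GC n)
  rw [neg_eq_iff_add_eq_zero, ← add_sub_assoc, h1, sub_self]

/-- Homotopy inverse bigraded chain maps induce isomorphisms of bigraded modules. -/
theorem exists_isBigradedIso (h : G.AreHomotopyInverse G' P P' H H') (i : Fin n) :
    ∃ φ : G.GH i ≃ₗ[UVRing] G'.GH i, GridDiagram.IsBigradedIso φ ∧ GridDiagram.IsInducedBy φ P := by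
  obtain ⟨hP, hP', hb, hb', -, -, hH, hH'⟩ := h
  rw [bdry4_eq_bdry, bdry4_eq_bdry] at hP hP' 
  rw [bdry4_eq_bdry] at hH hH'
  let φ : G.GH i ≃ₗ[UVRing] G'.GH i :=
    { toFun := homologyMap hP
      invFun := homologyMap hP'
      map_add' := fun a b => map_add (homologyMap hP) a b
      map_smul' := fun r a => map_smul (homologyMap hP) (uvHom i r) a
      left_inv := homologyMap_homologyMap hP hP' hH
      right_inv := homologyMap_homologyMap hP' hP hH' }
  have hφ : ∀ z : G.cycles, φ (G.homologyClass i z) = G'.homologyClass i ⟨P z, map_cycles hP z z.2⟩ :=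
    fun z => rfl
  refine ⟨φ, fun d s => ?_, fun z => ⟨map_cycles hP z z.2, hφ z⟩⟩
  ext ξ
  constructor
  · rintro ⟨_, ⟨z, hz, rfl⟩, rfl⟩
    refine ⟨⟨P z, map_cycles hP z z.2⟩, ?_, (hφ z).symm⟩
    have := hb d s z hz
    rwa [add_zero, add_zero] at this
  · rintro ⟨w, hw, rfl⟩
    refine ⟨φ.symm (G'.homologyClass i w), ⟨⟨P' w, map_cycles hP' w w.2⟩, ?_, rfl⟩,
      φ.apply_symm_apply _⟩
    have := hb' d s w hw
    rwa [add_zero, add_zero] at this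

end Homology

/-! ### Reflection in the diagonal -/

section Reflection

variable {n : ℕ} [NeZero n] {G G' : GridDiagram n}

lemma sawForm_inv (x : Equiv.Perm (ZMod n)) : sawForm x⁻¹ = sawForm x := by
  rw [sawForm, sawForm, ← Equiv.sum_comp x]
  refine sum_congr rfl fun k _ => ?_
  rw [← Equiv.sum_comp x]
  exact sum_congr rfl fun l _ => by simp [mul_comm]

lemma hsawForm_inv (mk x : Equiv.Perm (ZMod n)) : hsawForm mk⁻¹ x⁻¹ = hsawForm mk x := by
  rw [hsawForm, hsawForm, ← Equiv.sum_comp x]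
  refine sum_congr rfl fun k _ => ?_
  rw [← Equiv.sum_comp mk]
  exact sum_congr rfl fun l _ => by simp [mul_comm]

/-- The quadratic form of `maslovOf_eq` is symmetric in the two factors of the torus. -/
lemma maslovOf_inv (mk x : Equiv.Perm (ZMod n)) :
    GridDiagram.maslovOf mk⁻¹ x⁻¹ = GridDiagram.maslovOf mk x := by
  have : (GridDiagram.maslovOf mk⁻¹ x⁻¹ : ℚ) = GridDiagram.maslovOf mk x := by
    rw [maslovOf_eq, maslovOf_eq, sawForm_inv, sawForm_inv, hsawForm_inv]
  exact_mod_cast this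

lemma maslov_transpose (G : GridDiagram n) (x : GridState n) : G.transpose.maslov x⁻¹ = G.maslov x :=
  maslovOf_inv G.o x

lemma alexander_transpose (G : GridDiagram n) (x : GridState n) :
    G.transpose.alexander x⁻¹ = G.alexander x := by
  have h1 : GridDiagram.maslovOf G.transpose.o x⁻¹ = GridDiagram.maslovOf G.o x := maslovOf_inv G.o x
  have h2 : GridDiagram.maslovOf G.transpose.x x⁻¹ = GridDiagram.maslovOf G.x x := maslovOf_inv G.x x
  rw [GridDiagram.alexander, GridDiagram.alexander, h1, h2]

/-- Reflection of chains in the diagonal. -/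
noncomputable def flip (n : ℕ) [NeZero n] : GC n →ₗ[BaseRing n] GC n :=
  LinearMap.funLeft (BaseRing n) (BaseRing n) (fun x : GridState n => x⁻¹)

lemma flip_apply (z : GC n) (x : GridState n) : flip n z x = z x⁻¹ := rfl

lemma flip_flip (z : GC n) : flip n (flip n z) = z := by
  funext x
  rw [flip_apply, flip_apply, inv_inv]

lemma reflected_apply (f : GC n →ₗ[BaseRing n] GC n) (z : GC n) :
    GridDiagram.reflected f z = flip n (f (flip n z)) := rfl

lemma flip_single (x : GridState n) (p : BaseRing n) : flip n (Pi.single x p) = Pi.single x⁻¹ p := by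
  funext y
  rw [flip_apply]
  by_cases h : y = x⁻¹
  · subst h; simp
  · rw [Pi.single_eq_of_ne h, Pi.single_eq_of_ne]
    rintro rfl
    exact h (inv_inv y).symm

lemma flip_mem_homogeneous {d : ℤ} {s : ℚ} {z : GC n} (hz : z ∈ G.homogeneous d s) :
    flip n z ∈ G.transpose.homogeneous d s := by
  rw [GridDiagram.homogeneous] at hz
  induction hz using Submodule.span_induction with
  | zero => rw [map_zero]; exact Submodule.zero_mem _
  | add x y _ _ hx hy => rw [map_add]; exact Submodule.add_mem _ hx hy
  | smul c x _ hx =>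
    rw [LinearMap.map_smul_of_tower]
    exact Submodule.smul_mem _ c hx
  | mem z hz =>
    obtain ⟨x, e, h1, h2, rfl⟩ := hz
    rw [flip_single]
    refine Submodule.subset_span ⟨x⁻¹, e, ?_, ?_, rfl⟩
    · rw [maslov_transpose, h1]
    · rw [alexander_transpose, h2]

lemma transpose_transpose (G : GridDiagram n) : G.transpose.transpose = G := rfl

lemma isHomogeneousMap_reflected {f : GC n →ₗ[BaseRing n] GC n} {a : ℤ} {b : ℚ}
    (h : GridDiagram.IsHomogeneousMap G.transpose G'.transpose f a b) :
    GridDiagram.IsHomogeneousMap G G' (GridDiagram.reflected f) a b := by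
  intro d s z hz
  rw [reflected_apply, ← transpose_transpose G']
  exact flip_mem_homogeneous (h d s _ (flip_mem_homogeneous hz))

lemma reflected_comp (f g : GC n →ₗ[BaseRing n] GC n) :
    GridDiagram.reflected (f ∘ₗ g) = GridDiagram.reflected f ∘ₗ GridDiagram.reflected g := by
  refine LinearMap.ext fun z => ?_
  rw [LinearMap.comp_apply, reflected_apply, reflected_apply, reflected_apply, flip_flip,
    LinearMap.comp_apply]

lemma reflected_add (f g : GC n →ₗ[BaseRing n] GC n) :
    GridDiagram.reflected (f + g) = GridDiagram.reflected f + GridDiagram.reflected g := by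
  refine LinearMap.ext fun z => ?_
  rw [LinearMap.add_apply, reflected_apply, reflected_apply, reflected_apply, LinearMap.add_apply, map_add]

lemma reflected_id : GridDiagram.reflected (LinearMap.id : GC n →ₗ[BaseRing n] GC n) = LinearMap.id :=
  LinearMap.ext fun z => flip_flip z

/-- The reflected rectangle. -/
def flipRect (r : Rect n) : Rect n := ((r.1.2, r.1.1), (r.2.2, r.2.1))

lemma connects_flipRect {r : Rect n} {x y : GridState n} (h : r.Connects x y) :
    (flipRect r).Connects x⁻¹ y⁻¹ := by
  obtain ⟨h1, h2, h3, h4, h5⟩ := h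
  change x⁻¹ r.south = r.west ∧ x⁻¹ r.north = r.east ∧ y⁻¹ r.south = r.east ∧ y⁻¹ r.north = r.west ∧
    ∀ k, k ≠ r.south → k ≠ r.north → y⁻¹ k = x⁻¹ k
  refine ⟨?_, ?_, ?_, ?_, fun k hs hn => ?_⟩
  · rw [Equiv.Perm.inv_eq_iff_eq, h1]
  · rw [Equiv.Perm.inv_eq_iff_eq, h2]
  · rw [Equiv.Perm.inv_eq_iff_eq, h4]
  · rw [Equiv.Perm.inv_eq_iff_eq, h3]
  · rw [Equiv.Perm.inv_eq_iff_eq, h5]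
    · exact (x.apply_symm_apply k).symm
    · intro h
      rw [Equiv.Perm.inv_eq_iff_eq, h1] at h
      exact hs h
    · intro h
      rw [Equiv.Perm.inv_eq_iff_eq, h2] at h
      exact hn h

lemma pointMeasure_flipRect (r : Rect n) (x : GridState n) :
    (flipRect r).pointMeasure x⁻¹ = r.pointMeasure x := by
  classical
  rw [Rect.pointMeasure, Rect.pointMeasure, Rect.squares, Rect.squares, sum_product, sum_product_right]
  refine sum_congr rfl fun a _ => sum_congr rfl fun b _ => ?_
  rw [sum_comm]
  refine sum_congr rfl fun e _ => sum_congr rfl fun f _ => if_congr ?_ rfl rfl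
  change x⁻¹ (r.south + _) = r.west + _ ↔ _
  rw [Equiv.Perm.inv_eq_iff_eq, eq_comm]

lemma mult_flipRect (r : Rect n) (x y : GridState n) : (flipRect r).mult x⁻¹ y⁻¹ = r.mult x y := by
  rw [Rect.mult, Rect.mult, pointMeasure_flipRect, pointMeasure_flipRect]

lemma weight_flipRect (G : GridDiagram n) (r : Rect n) (m : ℕ) :
    G.transpose.weight (flipRect r).1 (flipRect r).squares m = G.weight r.1 r.squares m := by
  rw [GridDiagram.weight, GridDiagram.weight]
  congr 1
  refine prod_congr rfl fun i _ => ?_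
  congr 1
  rw [GridDiagram.oMult, GridDiagram.oMult]
  refine card_nbij' Prod.swap Prod.swap ?_ ?_ (fun _ _ => rfl) (fun _ _ => rfl)
  all_goals
    rintro ⟨a, b⟩ h
    simp only [coe_filter, Set.mem_ofPred_eq, Rect.squares, mem_product] at h ⊢
    exact ⟨⟨h.1.2, h.1.1⟩, h.2.2, h.2.1⟩

lemma xFree_flipRect {G : GridDiagram n} {r : Rect n} (h : G.XFree r.1 r.squares) :
    G.transpose.XFree (flipRect r).1 (flipRect r).squares := by
  rintro ⟨a, b⟩ hs he
  have hs' : (b, a) ∈ r.squares := by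
    simp only [Rect.squares, mem_product] at hs ⊢
    exact ⟨hs.2, hs.1⟩
  exact h (b, a) hs' ((G.x.symm_apply_eq.1 he).symm)

/-- Reflection of rectangles matches the differentials of a diagram and of its reflection. -/
lemma reflected_bdry4 (G : GridDiagram n) : GridDiagram.reflected G.transpose.bdry4 = G.bdry4 := by
  classical
  have h : ∀ x y, entry G.transpose.bdry4 x⁻¹ y⁻¹ = entry G.bdry4 x y := by
    intro x y
    rw [GridDiagram.bdry4, GridDiagram.bdry4, entry_linearMapOf, entry_linearMapOf]
    symm
    refine sum_nbij' flipRect flipRect ?_ ?_ (fun _ _ => rfl) (fun _ _ => rfl) ?_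
    · intro r hr
      rw [mem_filter, mem_allRects] at hr ⊢
      exact ⟨⟨hr.1.2, hr.1.1⟩, connects_flipRect hr.2.1, xFree_flipRect hr.2.2⟩
    · intro r hr
      rw [mem_filter, mem_allRects] at hr ⊢
      have h1 := connects_flipRect hr.2.1
      rw [inv_inv, inv_inv] at h1
      exact ⟨⟨hr.1.2, hr.1.1⟩, h1, xFree_flipRect hr.2.2⟩
    · intro r _
      rw [mult_flipRect, weight_flipRect]
  refine LinearMap.ext fun z => funext fun y => ?_
  rw [reflected_apply, flip_apply, apply_eq_sum, apply_eq_sum, ← Equiv.sum_comp (Equiv.inv (GridState n))]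
  refine sum_congr rfl fun x _ => ?_
  rw [Equiv.inv_apply, h, flip_apply, inv_inv]

lemma areHomotopyInverse_reflected {P P' H H' : GC n →ₗ[BaseRing n] GC n}
    (h : G.transpose.AreHomotopyInverse G'.transpose P P' H H') :
    G.AreHomotopyInverse G' (GridDiagram.reflected P) (GridDiagram.reflected P')
      (GridDiagram.reflected H) (GridDiagram.reflected H') where
  chain := by rw [← reflected_bdry4 G, ← reflected_bdry4 G', ← reflected_comp, ← reflected_comp, h.chain]
  chain' := by rw [← reflected_bdry4 G, ← reflected_bdry4 G', ← reflected_comp, ← reflected_comp, h.chain']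
  bigraded := isHomogeneousMap_reflected h.bigraded
  bigraded' := isHomogeneousMap_reflected h.bigraded'
  degree := isHomogeneousMap_reflected h.degree
  degree' := isHomogeneousMap_reflected h.degree'
  homotopy := by
    rw [← reflected_bdry4, ← reflected_comp, ← reflected_comp, ← reflected_comp, ← reflected_add,
      ← reflected_add, h.homotopy, reflected_id]
  homotopy' := by
    rw [← reflected_bdry4, ← reflected_comp, ← reflected_comp, ← reflected_comp, ← reflected_add,
      ← reflected_add, h.homotopy', reflected_id]

end Reflection

end GridInvariance

theorem mainTheorem2 {n : ℕ} [NeZero n] (G G' : GridDiagram n) :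
    -- invariance under commutations and switches of columns and of rows
    (∀ c : ZMod n,
      (G.ColumnCommutation G' c ∨ G.RowCommutation G' c ∨
        G.ColumnSwitch G' c ∨ G.RowSwitch G' c) →
      ∀ i : Fin n, ∃ φ : G.GH i ≃ₗ[UVRing] G'.GH i, GridDiagram.IsBigradedIso φ) ∧
    -- columns: the isomorphism comes from the pentagon maps and the hexagon maps
    (∀ c : ZMod n, (G.ColumnCommutation G' c ∨ G.ColumnSwitch G' c) →
      (∃ A B : ZMod n, G.IsDrawing c A B) ∧
      ∀ A B : ZMod n, G.IsDrawing c A B →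
        G.AreHomotopyInverse G' (G.pentMap c A) (G'.pentMap c B)
          (G.hexMap c A B) (G'.hexMap c B A) ∧
        ∀ i : Fin n, ∃ φ : G.GH i ≃ₗ[UVRing] G'.GH i,
          GridDiagram.IsBigradedIso φ ∧ GridDiagram.IsInducedBy φ (G.pentMap c A)) ∧
    -- rows: the same after reflection in the diagonal
    (∀ c : ZMod n, (G.RowCommutation G' c ∨ G.RowSwitch G' c) →
      (∃ A B : ZMod n, G.transpose.IsDrawing c A B) ∧
      ∀ A B : ZMod n, G.transpose.IsDrawing c A B →
        G.AreHomotopyInverse G'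
          (GridDiagram.reflected (G.transpose.pentMap c A))
          (GridDiagram.reflected (G'.transpose.pentMap c B))
          (GridDiagram.reflected (G.transpose.hexMap c A B))
          (GridDiagram.reflected (G'.transpose.hexMap c B A)) ∧
        ∀ i : Fin n, ∃ φ : G.GH i ≃ₗ[UVRing] G'.GH i,
          GridDiagram.IsBigradedIso φ ∧
          GridDiagram.IsInducedBy φ (GridDiagram.reflected (G.transpose.pentMap c A))) := by
  have columns : ∀ c : ZMod n, (G.ColumnCommutation G' c ∨ G.ColumnSwitch G' c) →
      (∃ A B : ZMod n, G.IsDrawing c A B) ∧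
      ∀ A B : ZMod n, G.IsDrawing c A B →
        G.AreHomotopyInverse G' (G.pentMap c A) (G'.pentMap c B)
          (G.hexMap c A B) (G'.hexMap c B A) ∧
        ∀ i : Fin n, ∃ φ : G.GH i ≃ₗ[UVRing] G'.GH i,
          GridDiagram.IsBigradedIso φ ∧ GridDiagram.IsInducedBy φ (G.pentMap c A) := by
    intro c h
    have hi : G.ColumnInterchange G' c := h.elim (fun h => h.1) fun h => h.1
    refine ⟨GridInvariance.exists_isDrawing h, fun A B hd => ?_⟩
    have key := GridInvariance.areHomotopyInverse hi hd
    exact ⟨key, GridInvariance.exists_isBigradedIso key⟩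
  have rows : ∀ c : ZMod n, (G.RowCommutation G' c ∨ G.RowSwitch G' c) →
      (∃ A B : ZMod n, G.transpose.IsDrawing c A B) ∧
      ∀ A B : ZMod n, G.transpose.IsDrawing c A B →
        G.AreHomotopyInverse G'
          (GridDiagram.reflected (G.transpose.pentMap c A))
          (GridDiagram.reflected (G'.transpose.pentMap c B))
          (GridDiagram.reflected (G.transpose.hexMap c A B))
          (GridDiagram.reflected (G'.transpose.hexMap c B A)) ∧
        ∀ i : Fin n, ∃ φ : G.GH i ≃ₗ[UVRing] G'.GH i,
          GridDiagram.IsBigradedIso φ ∧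
          GridDiagram.IsInducedBy φ (GridDiagram.reflected (G.transpose.pentMap c A)) := by
    intro c h
    have hi : G.transpose.ColumnInterchange G'.transpose c := h.elim (fun h => h.1) fun h => h.1
    refine ⟨GridInvariance.exists_isDrawing h, fun A B hd => ?_⟩
    have key := GridInvariance.areHomotopyInverse_reflected (GridInvariance.areHomotopyInverse hi hd)
    exact ⟨key, GridInvariance.exists_isBigradedIso key⟩
  refine ⟨fun c h i => ?_, columns, rows⟩
  have hcr : (G.ColumnCommutation G' c ∨ G.ColumnSwitch G' c) ∨
      (G.RowCommutation G' c ∨ G.RowSwitch G' c) := by tauto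
  rcases hcr with h | h
  · obtain ⟨⟨A, B, hd⟩, key⟩ := columns c h
    exact ((key A B hd).2 i).imp fun φ hφ => hφ.1
  · obtain ⟨⟨A, B, hd⟩, key⟩ := rows c h
    exact ((key A B hd).2 i).imp fun φ hφ => hφ.1
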